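/- Let $N\ge 1$. There is $s_0\in\mathbb R$, depending only on $N$, such that the following holds for every real $s\ge s_0$. Let $\Omega\subset\mathbb R^N$ be a bounded open set with $C^1$ boundary, let $T>0$, let $f\in L^1(0,T;L^1(\Omega))=L^1(\Omega\times(0,T))$ and $\theta_0\in L^1(\Omega)$, and let $$1\le q<\frac{2(N+1)-N}{N+1}\qquad(\text{that is, } 1\le q<\tfrac54 \text{ when } N=3).$$ Then there exists a weak solution $$\theta\in L^q(0,T;W^{1,q}(\Omega))\cap C([0,T];W^{-s,2}(\Omega))$$ of the heat equation with homogeneous Neumann boundary condition $$\theta_t-\Delta\theta=f \text{ in } \Omega\times(0,T),\qquad \frac{\partial\theta}{\partial n}=0 \text{ on } \partial\Omega\times(0,T),\qquad \theta(\cdot,0)=\theta_0 \text{ in } \Omega.$$ Here $W^{-s,2}(\Omega)$ is the dual of $W^{s,2}_0(\Omega)$ (the closure of $C_c^\infty(\Omega)$ in $W^{s,2}(\Omega)$); $\theta\in C([0,T];W^{-s,2}(\Omega))$ means that $\theta$ agrees for almost every $t\in(0,T)$ with a continuous map $[0,T]\to W^{-s,2}(\Omega)$, and the value of this map at $t=0$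 is $\theta_0$. Weak solution means that $$-\int_0^T\!\!\int_\Omega\theta\,\psi_t\,dx\,dt+\int_0^T\!\!\int_\Omega\nabla\theta\cdot\nabla\psi\,dx\,dt=\int_0^T\!\!\int_\Omega f\,\psi\,dx\,dt+\int_\Omega\theta_0\,\psi(\cdot,0)\,dx$$ for every $\psi\in C^\infty(\overline\Omega\times[0,T])$ with $\psi=0$ on $\Omega\times\{T\}$. -/

import Mathlib

open MeasureTheory Set Filter Topology TopologicalSpace
open scoped ContDiff Distributions ENNReal

namespace HeatL1

noncomputable section

/-- The Euclidean space `ℝ^N`. -/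
abbrev Space (N : ℕ) : Type := EuclideanSpace ℝ (Fin N)

/-- `Ω` has a `C¹` boundary: near every boundary point, `Ω` is the sublevel set `{ρ < 0}` of a
`C¹` function `ρ` whose differential does not vanish. -/
def HasC1Boundary {N : ℕ} (Ω : Set (Space N)) : Prop :=
  ∀ x₀ ∈ frontier Ω, ∃ U : Set (Space N), IsOpen U ∧ x₀ ∈ U ∧
    ∃ ρ : Space N → ℝ, ContDiffOn ℝ 1 ρ U ∧ (∀ x ∈ U, fderiv ℝ ρ x ≠ 0) ∧
      ∀ x ∈ U, (x ∈ Ω ↔ ρ x < 0)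

/-- The space-time cylinder `(0,T) × Ω`; the points are written `(t, x)`. -/
def cylinder {N : ℕ} (Ω : Opens (Space N)) (T : ℝ) : Set (ℝ × Space N) :=
  Ioo 0 T ×ˢ (Ω : Set (Space N))

/-- `G` is the weak gradient of `u` on `Ω`: both are locally integrable on `Ω` and
`∫_Ω u ∇φ = - ∫_Ω φ G` for all `φ ∈ C_c^∞(Ω)`. -/
structure HasWeakGradient {N : ℕ} (Ω : Opens (Space N)) (u : Space N → ℝ)
    (G : Space N → Space N) : Prop where
  locallyIntegrable_fun : LocallyIntegrableOn u Ω
  locallyIntegrable_grad : LocallyIntegrableOn G Ω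
  integral_eq : ∀ φ : 𝓓(Ω, ℝ),
    ∫ x in (Ω : Set (Space N)), u x • gradient φ x = - ∫ x in (Ω : Set (Space N)), φ x • G x

/-- `θ ∈ L^q(0,T; W^{1,q}(Ω))` with spatial weak gradient `G`: at almost every time `G(t,·)` is the
weak gradient of `θ(t,·)`, and `∫_0^T ∫_Ω |θ|^q + |G|^q < ∞`. -/
structure MemLqW1q {N : ℕ} (Ω : Opens (Space N)) (T q : ℝ) (θ : ℝ × Space N → ℝ)
    (G : ℝ × Space N → Space N) : Prop where
  memLp_fun : MemLp θ (ENNReal.ofReal q) (volume.restrict (cylinder Ω T))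
  memLp_grad : MemLp G (ENNReal.ofReal q) (volume.restrict (cylinder Ω T))
  hasWeakGradient : ∀ᵐ t ∂(volume.restrict (Ioo 0 T)),
    HasWeakGradient Ω (fun x => θ (t, x)) (fun x => G (t, x))

/-- The Sobolev(-Slobodeckij) norm of `W^{s,2}(Ω)` of a test function, for real `s ≥ 0`:
with `m = ⌊s⌋` and `σ = s - m`, its square is
`∑_{j ≤ m} ∫_Ω |D^j φ|²`, plus, if `σ > 0`,
`∫_Ω ∫_Ω |D^m φ(x) - D^m φ(y)|² / |x - y|^(N + 2σ)`. -/
def sobolevNorm {N : ℕ} (Ω : Opens (Space N)) (s : ℝ) (φ : 𝓓(Ω, ℝ)) : ℝ≥0∞ :=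
  ((∑ j ∈ Finset.range (⌊s⌋₊ + 1),
      ∫⁻ x in (Ω : Set (Space N)), ‖iteratedFDeriv ℝ j φ x‖ₑ ^ 2) +
    (if s = (⌊s⌋₊ : ℝ) then 0 else
      ∫⁻ x in (Ω : Set (Space N)), ∫⁻ y in (Ω : Set (Space N)),
        ‖iteratedFDeriv ℝ ⌊s⌋₊ φ x - iteratedFDeriv ℝ ⌊s⌋₊ φ y‖ₑ ^ 2 /
          (edist x y) ^ ((N : ℝ) + 2 * (s - (⌊s⌋₊ : ℝ))))) ^ (1 / 2 : ℝ)

/-- The norm of `W^{-s,2}(Ω)`, the dual of `W₀^{s,2}(Ω)`. As `W₀^{s,2}(Ω)` is the closure of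
`C_c^∞(Ω)` in the `W^{s,2}` norm, an element of the dual is the same as a linear functional on
`C_c^∞(Ω)` for which this norm is finite. -/
def negSobolevNorm {N : ℕ} (Ω : Opens (Space N)) (s : ℝ) (ℓ : 𝓓(Ω, ℝ) →ₗ[ℝ] ℝ) : ℝ≥0∞ :=
  ⨆ (φ : 𝓓(Ω, ℝ)) (_ : sobolevNorm Ω s φ ≤ 1), ‖ℓ φ‖ₑ

/-- `Θ ∈ C([0,T]; W^{-s,2}(Ω))`. -/
structure MemContNegSobolev {N : ℕ} (Ω : Opens (Space N)) (T s : ℝ)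
    (Θ : ℝ → (𝓓(Ω, ℝ) →ₗ[ℝ] ℝ)) : Prop where
  norm_lt_top : ∀ t ∈ Icc 0 T, negSobolevNorm Ω s (Θ t) < (⊤ : ℝ≥0∞)
  continuous : ∀ t ∈ Icc 0 T,
    Tendsto (fun t' => negSobolevNorm Ω s (Θ t' - Θ t)) (𝓝[Icc 0 T] t) (𝓝 0)

/-- The functional `ℓ` on `C_c^∞(Ω)` is the function `u`: `u` is integrable on `Ω` and
`ℓ φ = ∫_Ω u φ`. -/
def Represents {N : ℕ} (Ω : Opens (Space N)) (u : Space N → ℝ) (ℓ : 𝓓(Ω, ℝ) →ₗ[ℝ] ℝ) : Prop :=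
  IntegrableOn u Ω ∧ ∀ φ : 𝓓(Ω, ℝ), ℓ φ = ∫ x in (Ω : Set (Space N)), u x * φ x

/-- The weak form of `θ_t - Δθ = f` in `Ω × (0,T)`, `∂θ/∂n = 0` on `∂Ω × (0,T)`, `θ(0) = θ₀`,
where `G` is the spatial gradient of `θ`. The test functions are smooth up to the boundary of
`Ω × (0,T)`, unrestricted on `∂Ω`, and vanish at time `T`. -/
def IsWeakNeumannHeatSolution {N : ℕ} (Ω : Opens (Space N)) (T : ℝ) (f : ℝ × Space N → ℝ)
    (θ₀ : Space N → ℝ) (θ : ℝ × Space N → ℝ) (G : ℝ × Space N → Space N) : Prop :=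
  ∀ ψ : ℝ × Space N → ℝ, ContDiff ℝ ∞ ψ → (∀ x ∈ Ω, ψ (T, x) = 0) →
    - (∫ z in cylinder Ω T, θ z * deriv (fun τ => ψ (τ, z.2)) z.1)
      + ∫ z in cylinder Ω T, inner ℝ (G z) (gradient (fun y => ψ (z.1, y)) z.2)
    = (∫ z in cylinder Ω T, f z * ψ z) + ∫ x in (Ω : Set (Space N)), θ₀ x * ψ (0, x)

end

end HeatL1

/-!
The solution is the limit of an implicit Euler (Rothe) scheme with regularised data; everything
rests on a bound in `L^q(0,T;W^{1,q}(Ω))` which depends on the data through their `L¹` norms only.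
Write `⟨s⟩ = √(1+s²)`.

*The bound.* One step of the scheme is a Neumann resolvent problem with data in `L²`, solved by an
orthogonal projection onto the closure of the graph of the gradient on `C¹` functions
(`exists_resolvent`). For small `α > 0`, testing it with `S(u)`, where `S' = ⟨·⟩^{-(1+α)}`, so that
`S` is bounded and increasing with a convex primitive of linear growth, gives the renormalised
energy estimate of Boccardo and Gallouët (`IsRothe.energy`): the spatial `L¹` norms of `u` and the
space-time integral of `⟨u⟩^{-(1+α)} |∇u|²` are bounded by the `L¹` norms of the data. Gagliardo's
inequality for the function `⟨u⟩^{1+1/N-α}` converts the two into a bound for the space-time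
integral of `⟨u⟩^{1+2/N-α}` (`nonlinear_gagliardo`). By Young's inequality `|∇u|^q` is at most
`⟨u⟩^{-(1+α)} |∇u|² + ⟨u⟩^{(1+α)q/(2-q)}`, and the last exponent is at most `1+2/N-α` for small `α`
exactly when `q < (N+2)/(N+1)` (`exists_alpha`, `exists_rothe_bound`).

*The inequality on `Ω`.* Gagliardo's inequality, for functions not vanishing on the boundary, is
proved without an extension operator: near each point of the closure of a `C¹` domain there is a
basis of directions along which short segments issuing from points of `Ω` stay in `Ω`, and the
argument of integrating along lines parallel to the axes works in the oblique coordinates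
(`gagliardoOn_of_basis`, `gagliardoOn_nhds`, `gagliardo_inequality`).

*The limit.* For `q > 1`, bounded sequences in `L^q` have weak limits, tested against bounded
functions (`exists_weak_limit`; the limit is taken along an ultrafilter, so no subsequence is
chosen). The discrete weak formulation, obtained by summation by parts in time
(`IsRothe.discrete_weak_form`), is linear, and passes to the limit together with the definition of
the weak gradient (`exists_solution_of_isApproximateSolution`).

*Continuity in time.* The weak formulation says that the time derivative of `t ↦ ∫_Ω θ(t) φ` is
`∫_Ω f(t) φ - ∫_Ω ∇θ(t) · ∇φ`, which is bounded by an integrable function of `t` times the `C¹` norm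
of `φ`. For `s ≥ N + 1` the `W^{s,2}` norm controls the `C¹` norm of a test function, by integrating
derivatives along lines (`enorm_gradient_le_sobolevNorm`). Hence
`φ ↦ ∫_Ω θ₀ φ + ∫_0^t (∫_Ω f φ - ∫_Ω ∇θ · ∇φ)` is a continuous curve in `W^{-s,2}(Ω)`, and it is
`θ(t)` for almost every `t` (`IsWeakNeumannHeatSolution.exists_timeRepresentative`).
-/

namespace HeatL1

/-! ### Gagliardo's inequality on a bounded `C¹` domain -/

/-- The value of a `C¹` function at the endpoint of an interval is controlled by its `W^{1,1}` norm
on the interval. -/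
theorem enorm_zero_le_lintegral_Ioc {g : ℝ → ℝ} (hg : ContDiff ℝ 1 g) {h : ℝ} (hh : 0 < h) :
    ‖g 0‖ₑ ≤ ENNReal.ofReal (1 + 1 / h) * ∫⁻ t in Ioc 0 h, (‖g t‖ₑ + ‖deriv g t‖ₑ) := by
  have hgc : Continuous g := hg.continuous
  have hdc : Continuous (deriv g) := hg.continuous_deriv le_rfl
  have hgm : Measurable fun t => ‖g t‖ₑ := hgc.measurable.enorm
  rw [lintegral_add_left hgm]
  set A := ∫⁻ t in Ioc 0 h, ‖g t‖ₑ
  set B := ∫⁻ t in Ioc 0 h, ‖deriv g t‖ₑ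
  have key : ∀ t ∈ Ioc 0 h, ‖g 0‖ₑ ≤ ‖g t‖ₑ + B := by
    intro t ht
    have h1 : ∫ s in (0 : ℝ)..t, deriv g s = g t - g 0 :=
      intervalIntegral.integral_deriv_eq_sub
        (fun x _ => (hg.differentiable one_ne_zero).differentiableAt) (hdc.intervalIntegrable _ _)
    have h2 : g 0 = g t - ∫ s in (0 : ℝ)..t, deriv g s := by rw [h1]; ring
    rw [h2, intervalIntegral.integral_of_le ht.1.le]
    refine enorm_sub_le.trans (add_le_add le_rfl ?_)
    refine (enorm_integral_le_lintegral_enorm _).trans ?_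
    exact lintegral_mono_set (Ioc_subset_Ioc_right ht.2)
  have hint : ∫⁻ t in Ioc 0 h, ‖g 0‖ₑ ≤ ∫⁻ t in Ioc 0 h, (‖g t‖ₑ + B) :=
    setLIntegral_mono' measurableSet_Ioc key
  rw [lintegral_add_left hgm, setLIntegral_const, setLIntegral_const, Real.volume_Ioc, sub_zero]
    at hint
  have hh0 : ENNReal.ofReal h ≠ 0 := by simpa using hh
  have e1 : ENNReal.ofReal (1 / h) * ENNReal.ofReal h = 1 := by
    rw [← ENNReal.ofReal_mul (by positivity), one_div_mul_cancel hh.ne', ENNReal.ofReal_one]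
  calc ‖g 0‖ₑ = ENNReal.ofReal (1 / h) * (‖g 0‖ₑ * ENNReal.ofReal h) := by
        rw [mul_comm ‖g 0‖ₑ, ← mul_assoc, e1, one_mul]
    _ ≤ ENNReal.ofReal (1 / h) * (A + B * ENNReal.ofReal h) := by gcongr
    _ = ENNReal.ofReal (1 / h) * A + B := by
        rw [mul_add, mul_comm B, ← mul_assoc, e1, one_mul]
    _ ≤ ENNReal.ofReal (1 + 1 / h) * (A + B) := by
        rw [mul_add]
        have : (1 : ℝ≥0∞) ≤ ENNReal.ofReal (1 + 1 / h) := by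
          rw [← ENNReal.ofReal_one]; exact ENNReal.ofReal_le_ofReal (by simp [hh.le])
        gcongr
        · simp
        · exact le_mul_of_one_le_left (by simp) this

/-- The Gagliardo inequality on `Ω`, with the left-hand side restricted to `A`. The weight `w` is
the function that is to be interpolated in `L¹`. -/
def GagliardoOn {N : ℕ} (Ω A : Set (Space N)) : Prop :=
  ∃ C : ℝ≥0∞, C ≠ ⊤ ∧ ∀ v : Space N → ℝ, ContDiff ℝ 1 v → ∀ w : Space N → ℝ≥0∞, Measurable w →
    (∫⁻ x in Ω, w x) ≠ ⊤ → (∫⁻ x in Ω, (‖v x‖ₑ + ‖fderiv ℝ v x‖ₑ)) ≠ ⊤ →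
    ∫⁻ x in Ω ∩ A, w x ^ (1 / N : ℝ) * ‖v x‖ₑ ≤
      C * (∫⁻ x in Ω, w x) ^ (1 / N : ℝ) * ∫⁻ x in Ω, (‖v x‖ₑ + ‖fderiv ℝ v x‖ₑ)

theorem lintegral_basis_comp {N : ℕ} (b : Module.Basis (Fin N) ℝ (Space N)) :
    ∃ c : ℝ≥0∞, c ≠ 0 ∧ c ≠ ⊤ ∧ ∀ f : Space N → ℝ≥0∞, Measurable f →
      ∫⁻ y : Fin N → ℝ, f (b.equivFun.symm y) = c * ∫⁻ x, f x := by
  let L : (Fin N → ℝ) ≃L[ℝ] Space N := b.equivFun.symm.toContinuousLinearEquiv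
  have : (Measure.map L (volume : Measure (Fin N → ℝ))).IsAddHaarMeasure :=
    L.isAddHaarMeasure_map _
  have h := Measure.isAddLeftInvariant_eq_smul (Measure.map L (volume : Measure (Fin N → ℝ)))
    (volume : Measure (Space N))
  set c := Measure.addHaarScalarFactor (Measure.map L (volume : Measure (Fin N → ℝ)))
    (volume : Measure (Space N))
  have hc : 0 < c := Measure.addHaarScalarFactor_pos_of_isAddHaarMeasure _ _
  refine ⟨c, by exact_mod_cast hc.ne', by simp, fun f hf => ?_⟩
  have : ∫⁻ x, f x ∂(Measure.map L (volume : Measure (Fin N → ℝ))) = ∫⁻ y, f (L y) :=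
    lintegral_map hf L.continuous.measurable
  change ∫⁻ y, f (L y) = _
  rw [← this, h, lintegral_smul_measure]
  rfl

/-- The local inequality: near a point from which `Ω` contains segments in `N` independent
directions, uniformly, the value of `v` is bounded by integrals along the lines in these
directions, and the grid-lines lemma applies in the oblique coordinates. -/
theorem gagliardoOn_of_basis {N : ℕ} (hN : 1 ≤ N) {Ω A : Set (Space N)} (hΩ : IsOpen Ω)
    (hA : MeasurableSet A) (b : Module.Basis (Fin N) ℝ (Space N)) {h : ℝ} (hh : 0 < h)
    (hb : ∀ x ∈ Ω ∩ A, ∀ i, ∀ t ∈ Ioc 0 h, x + t • b i ∈ Ω) : GagliardoOn Ω A := by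
  obtain ⟨c, hc0, hct, hc⟩ := lintegral_basis_comp b
  obtain ⟨K, hK1, hK⟩ : ∃ K : ℝ, 1 ≤ K ∧ ∀ i, ‖b i‖ ≤ K := by
    refine ⟨1 + ∑ i, ‖b i‖, by simp [Finset.sum_nonneg], fun i => ?_⟩
    have := Finset.single_le_sum (f := fun i => ‖b i‖) (fun j _ => norm_nonneg _)
      (Finset.mem_univ i)
    linarith
  set C2 : ℝ≥0∞ := ENNReal.ofReal (1 + 1 / h) * ENNReal.ofReal K with hC2
  have hC2t : C2 ≠ ⊤ := ENNReal.mul_ne_top ENNReal.ofReal_ne_top ENNReal.ofReal_ne_top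
  have hNpos : (0 : ℝ) < N := by exact_mod_cast hN
  set p : ℝ := 1 / N with hp
  have hp0 : 0 < p := by positivity
  have hc1 : c ^ p ≠ ⊤ := ENNReal.rpow_ne_top_of_nonneg hp0.le hct
  refine ⟨C2 * c ^ p * 2 ^ (1 + p), ENNReal.mul_ne_top (ENNReal.mul_ne_top hC2t hc1)
    (ENNReal.rpow_ne_top_of_nonneg (by positivity) (by simp)), ?_⟩
  intro v hv w hw hwt hFt
  set F : Space N → ℝ≥0∞ := Ω.indicator fun x => ‖v x‖ₑ + ‖fderiv ℝ v x‖ₑ with hF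
  have hvc : Continuous v := hv.continuous
  have hdc : Continuous (fderiv ℝ v) := hv.continuous_fderiv one_ne_zero
  have hFm : Measurable F :=
    (hvc.measurable.enorm.add hdc.measurable.enorm).indicator hΩ.measurableSet
  have hFint : ∫⁻ x, F x = ∫⁻ x in Ω, (‖v x‖ₑ + ‖fderiv ℝ v x‖ₑ) :=
    lintegral_indicator hΩ.measurableSet _
  rw [← hFint] at hFt ⊢
  set B := ∫⁻ x, F x
  set W := ∫⁻ x in Ω, w x with hW
  -- In every direction `b i`, `‖v x‖` is at most a multiple of the integral over the whole line
  -- through `x`, as a short piece of this line lies in `Ω`.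
  have line : ∀ x ∈ Ω ∩ A, ∀ i, ‖v x‖ₑ ≤ C2 * ∫⁻ t : ℝ, F (x + t • b i) := by
    intro x hx i
    have hd : ∀ t : ℝ, HasDerivAt (fun t : ℝ => v (x + t • b i))
        (fderiv ℝ v (x + t • b i) (b i)) t := by
      intro t
      have h1 : HasDerivAt (fun t : ℝ => x + t • b i) (b i) t := by
        simpa using ((hasDerivAt_id t).smul_const (b i)).const_add x
      exact ((hv.differentiable one_ne_zero _).hasFDerivAt).comp_hasDerivAt t h1
    have hg : ContDiff ℝ 1 fun t : ℝ => v (x + t • b i) := by fun_prop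
    have := enorm_zero_le_lintegral_Ioc hg hh
    simp only [zero_smul, add_zero] at this
    refine this.trans ?_
    rw [hC2, mul_assoc]
    gcongr
    rw [← lintegral_const_mul' _ _ ENNReal.ofReal_ne_top,
      ← lintegral_indicator measurableSet_Ioc]
    refine lintegral_mono fun t => ?_
    by_cases ht : t ∈ Ioc 0 h
    · rw [indicator_of_mem ht, hF, indicator_of_mem (hb x hx i t ht), (hd t).deriv, mul_add]
      have hK1' : (1 : ℝ≥0∞) ≤ ENNReal.ofReal K := by simpa using hK1
      refine add_le_add (le_mul_of_one_le_left (by simp) hK1') ?_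
      rw [← ofReal_norm, ← ofReal_norm, ← ENNReal.ofReal_mul (by linarith)]
      refine ENNReal.ofReal_le_ofReal (((fderiv ℝ v _).le_opNorm _).trans ?_)
      rw [mul_comm]
      gcongr
      exact hK i
    · rw [indicator_of_notMem ht]; simp
  -- The grid-lines lemma is applied to a sum with weight `l`, still to be chosen, in front of `w`.
  have grid : ∀ l : ℝ≥0∞, l ≠ ⊤ →
      l ^ p * (c * ∫⁻ x in Ω ∩ A, w x ^ p * ‖v x‖ₑ) ≤ C2 * (c * (l * W + B)) ^ (1 + p) := by
    intro l hl
    set f : Space N → ℝ≥0∞ := fun x => l * Ω.indicator w x + F x with hf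
    have hfm : Measurable f := ((hw.indicator hΩ.measurableSet).const_mul l).add hFm
    have hLm : Measurable (b.equivFun.symm : (Fin N → ℝ) → Space N) :=
      (b.equivFun.symm.toContinuousLinearEquiv.continuous).measurable
    have hgl := lintegral_mul_prod_lintegral_pow_le (fun _ : Fin N => (volume : Measure ℝ))
      (p := p) hp0.le (by
        rw [Fintype.card_fin, hp]; field_simp; linarith) (hfm.comp hLm)
    have e1 : 1 - ((Fintype.card (Fin N) : ℝ) - 1) * p = p := by
      rw [Fintype.card_fin, hp]; field_simp; ring
    rw [e1] at hgl
    have hfint : ∫⁻ y : Fin N → ℝ, (f ∘ b.equivFun.symm) y = c * (l * W + B) := by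
      simp only [Function.comp]
      rw [hc f hfm, hf, lintegral_add_right _ hFm, lintegral_const_mul' _ _ hl,
        lintegral_indicator hΩ.measurableSet]
    rw [← volume_pi, hfint] at hgl
    have hm : MeasurableSet (Ω ∩ A) := hΩ.measurableSet.inter hA
    have hGm : Measurable ((Ω ∩ A).indicator fun x => w x ^ p * ‖v x‖ₑ) :=
      ((hw.pow_const p).mul hvc.measurable.enorm).indicator hm
    rw [← lintegral_indicator hm, ← hc _ hGm, ← lintegral_const_mul' _ _
      (ENNReal.rpow_ne_top_of_nonneg hp0.le hl)]
    refine le_trans ?_ (mul_le_mul_right hgl C2)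
    rw [← lintegral_const_mul' _ _ hC2t]
    refine lintegral_mono fun y => ?_
    set x := b.equivFun.symm y with hx
    by_cases hxA : x ∈ Ω ∩ A
    · simp only [indicator_of_mem hxA, Function.comp]
      have hline : ∀ i, ‖v x‖ₑ ≤ C2 * ∫⁻ t, f (b.equivFun.symm (Function.update y i t)) := by
        intro i
        refine (line x hxA i).trans (mul_le_mul' le_rfl ?_)
        have hupd : ∀ t, b.equivFun.symm (Function.update y i t) = x + (t - y i) • b i := by
          intro t
          have : Function.update y i t = y + (t - y i) • (Pi.single i 1 : Fin N → ℝ) := by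
            ext j
            by_cases hj : j = i
            · subst hj; simp
            · simp [hj]
          rw [this, map_add, map_smul]
          simp [hx]
        simp_rw [hupd]
        rw [lintegral_sub_right_eq_self (fun t => f (x + t • b i)) (y i)]
        exact lintegral_mono fun t => by simp [hf]
      have hv' : ‖v x‖ₑ = ∏ _i : Fin N, ‖v x‖ₑ ^ p := by
        rw [Finset.prod_const, Finset.card_univ, Fintype.card_fin, ← ENNReal.rpow_natCast,
          ← ENNReal.rpow_mul, hp, one_div_mul_cancel hNpos.ne', ENNReal.rpow_one]
      have hCp : C2 = ∏ _i : Fin N, C2 ^ p := by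
        rw [Finset.prod_const, Finset.card_univ, Fintype.card_fin, ← ENNReal.rpow_natCast,
          ← ENNReal.rpow_mul, hp, one_div_mul_cancel hNpos.ne', ENNReal.rpow_one]
      have hprod : ‖v x‖ₑ ≤
          C2 * ∏ i, (∫⁻ t, f (b.equivFun.symm (Function.update y i t))) ^ p := by
        nth_rewrite 1 [hv']
        nth_rewrite 1 [hCp]
        rw [← Finset.prod_mul_distrib]
        refine Finset.prod_le_prod' fun i _ => ?_
        rw [← ENNReal.mul_rpow_of_nonneg _ _ hp0.le]
        exact ENNReal.rpow_le_rpow (hline i) hp0.le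
      have hwf : l ^ p * w x ^ p ≤ f x ^ p := by
        rw [← ENNReal.mul_rpow_of_nonneg _ _ hp0.le]
        refine ENNReal.rpow_le_rpow ?_ hp0.le
        simp [hf, indicator_of_mem hxA.1]
      calc l ^ p * (w x ^ p * ‖v x‖ₑ) = (l ^ p * w x ^ p) * ‖v x‖ₑ := by ring
        _ ≤ f x ^ p * (C2 * ∏ i, (∫⁻ t, f (b.equivFun.symm (Function.update y i t))) ^ p) := by
            gcongr
        _ = _ := by ring
    · simp [indicator_of_notMem hxA]
  -- The choice `l = B / W` balances the two terms; it is not available if one of them vanishes.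
  by_cases hW0 : W = 0
  · have : ∀ᵐ x ∂(volume.restrict Ω), w x = 0 := by
      rwa [hW, lintegral_eq_zero_iff hw] at hW0
    have h2 : ∀ᵐ x ∂(volume.restrict (Ω ∩ A)), w x = 0 :=
      ae_restrict_of_ae_restrict_of_subset inter_subset_left this
    have : ∫⁻ x in Ω ∩ A, w x ^ p * ‖v x‖ₑ = 0 := by
      refine (lintegral_congr_ae (g := fun _ => 0) ?_).trans (by simp)
      filter_upwards [h2] with x hx
      simp [hx, hp0]
    rw [this]; simp
  by_cases hB0 : B = 0
  · have h1 : ∀ᵐ x ∂volume, F x = 0 := by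
      have := (lintegral_eq_zero_iff hFm).1 hB0
      exact this
    have : ∫⁻ x in Ω ∩ A, w x ^ p * ‖v x‖ₑ = 0 := by
      refine (lintegral_congr_ae (g := fun _ => 0) ?_).trans (by simp)
      filter_upwards [ae_restrict_of_ae h1, ae_restrict_mem (hΩ.measurableSet.inter hA)]
        with x hx hxm
      rw [hF, indicator_of_mem hxm.1] at hx
      have : ‖v x‖ₑ = 0 := (add_eq_zero.1 hx).1
      simp [this]
    rw [this]; simp
  have hl := grid (B / W) (ENNReal.div_ne_top hFt hW0)
  rw [ENNReal.div_mul_cancel hW0 hwt, ← two_mul] at hl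
  set X := ∫⁻ x in Ω ∩ A, w x ^ p * ‖v x‖ₑ
  have hBp0 : B ^ p ≠ 0 := by simp [hB0, hp0, ENNReal.rpow_eq_zero_iff, hFt]
  have hBpt : B ^ p ≠ ⊤ := ENNReal.rpow_ne_top_of_nonneg hp0.le hFt
  have hWp0 : W ^ p ≠ 0 := by simp [hW0, hp0, ENNReal.rpow_eq_zero_iff, hwt]
  have hWpt : W ^ p ≠ ⊤ := ENNReal.rpow_ne_top_of_nonneg hp0.le hwt
  have e2 : (c * (2 * B)) ^ (1 + p) = c * c ^ p * (2 ^ (1 + p) * (B * B ^ p)) := by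
    rw [ENNReal.mul_rpow_of_nonneg _ _ (by positivity), ENNReal.mul_rpow_of_nonneg _ _
      (by positivity), ENNReal.rpow_add _ _ hc0 hct, ENNReal.rpow_add _ _ hB0 hFt,
      ENNReal.rpow_one, ENNReal.rpow_one]
  rw [e2, ENNReal.div_rpow_of_nonneg _ _ hp0.le] at hl
  have hl2 : (B ^ p * c) * X ≤ (B ^ p * c) * (C2 * c ^ p * 2 ^ (1 + p) * W ^ p * B) := by
    calc (B ^ p * c) * X = (B ^ p / W ^ p) * (c * X) * W ^ p := by
          rw [mul_right_comm (B ^ p / W ^ p), ENNReal.div_mul_cancel hWp0 hWpt, mul_assoc]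
      _ ≤ C2 * (c * c ^ p * (2 ^ (1 + p) * (B * B ^ p))) * W ^ p := by gcongr
      _ = _ := by ring
  exact (ENNReal.mul_le_mul_iff_right (mul_ne_zero hBp0 hc0) (ENNReal.mul_ne_top hBpt hct)).1 hl2

/-- The vectors pointing into a half-space span, as they form an open set. -/
theorem exists_basis_neg {N : ℕ} {D : Space N →L[ℝ] ℝ} (hD : D ≠ 0) :
    ∃ b : Module.Basis (Fin N) ℝ (Space N), ∀ i, D (b i) < 0 := by
  set s : Set (Space N) := {x | D x < 0}
  have hs : IsOpen s := isOpen_lt D.continuous continuous_const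
  have hne : s.Nonempty := by
    obtain ⟨x, hx⟩ : ∃ x, D x ≠ 0 := by
      by_contra! h
      exact hD (ContinuousLinearMap.ext h)
    rcases lt_or_gt_of_ne hx with h | h
    · exact ⟨x, h⟩
    · exact ⟨-x, by simpa [s] using h⟩
  have hspan : Submodule.span ℝ s = ⊤ :=
    Submodule.eq_top_of_nonempty_interior' _
      (hne.mono ((hs.subset_interior_iff).2 Submodule.subset_span))
  let b := Module.Basis.ofSpan hspan.ge
  have : Fintype ↥((linearIndepOn_empty ℝ id).extend (empty_subset s)) :=
    FiniteDimensional.fintypeBasisIndex b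
  let b' : Module.Basis (Fin N) ℝ (Space N) :=
    b.reindex (b.indexEquiv (EuclideanSpace.basisFun (Fin N) ℝ).toBasis)
  refine ⟨b', fun i => ?_⟩
  have : b' i ∈ range b := ⟨_, (Module.Basis.reindex_apply _ _ _).symm⟩
  exact Module.Basis.ofSpan_subset hspan.ge this

/-- At a boundary point the defining function `ρ` decreases strictly along `N` independent
directions, by continuity of its differential also at nearby points, so that segments in these
directions starting in `Ω = {ρ < 0}` stay in `Ω`. -/
theorem gagliardoOn_nhds {N : ℕ} (hN : 1 ≤ N) {Ω : Set (Space N)} (hΩ : IsOpen Ω)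
    (hC : HasC1Boundary Ω) {x₀ : Space N} (hx₀ : x₀ ∈ closure Ω) :
    ∃ δ > 0, GagliardoOn Ω (Metric.ball x₀ δ) := by
  by_cases hxΩ : x₀ ∈ Ω
  · obtain ⟨δ, hδ, hball⟩ := Metric.isOpen_iff.1 hΩ x₀ hxΩ
    refine ⟨δ / 2, by positivity, gagliardoOn_of_basis hN hΩ measurableSet_ball
      (EuclideanSpace.basisFun (Fin N) ℝ).toBasis (h := δ / 2) (by positivity) ?_⟩
    rintro x ⟨_, hx⟩ i t ht
    apply hball
    rw [mem_ball_iff_norm] at hx ⊢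
    calc ‖x + t • (EuclideanSpace.basisFun (Fin N) ℝ).toBasis i - x₀‖
        = ‖(x - x₀) + t • (EuclideanSpace.basisFun (Fin N) ℝ).toBasis i‖ := by
          congr 1; abel
      _ ≤ ‖x - x₀‖ + ‖t • (EuclideanSpace.basisFun (Fin N) ℝ).toBasis i‖ := norm_add_le _ _
      _ < δ / 2 + δ / 2 := by
          refine add_lt_add_of_lt_of_le hx ?_
          rw [norm_smul]
          simpa [abs_of_pos ht.1] using ht.2
      _ = δ := by ring
  · have hfr : x₀ ∈ frontier Ω := by
      rw [hΩ.frontier_eq]; exact ⟨hx₀, hxΩ⟩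
    obtain ⟨U, hU, hxU, ρ, hρ, hdρ, hiff⟩ := hC x₀ hfr
    obtain ⟨b, hb⟩ := exists_basis_neg (hdρ x₀ hxU)
    have hcont : ContinuousAt (fderiv ℝ ρ) x₀ :=
      (hρ.continuousOn_fderiv_of_isOpen hU le_rfl).continuousAt (hU.mem_nhds hxU)
    have hev : ∀ᶠ x in 𝓝 x₀, x ∈ U ∧ ∀ i, fderiv ℝ ρ x (b i) < 0 := by
      refine (hU.eventually_mem hxU).and (eventually_all.2 fun i => ?_)
      have : ContinuousAt (fun x => fderiv ℝ ρ x (b i)) x₀ := hcont.clm_apply continuousAt_const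
      exact this.eventually_lt continuousAt_const (hb i)
    obtain ⟨δ, hδ, hball⟩ := Metric.eventually_nhds_iff_ball.1 hev
    set K := 1 + ∑ i, ‖b i‖ with hK
    have hK1 : 1 ≤ K := by simp [hK, Finset.sum_nonneg]
    have hbK : ∀ i, ‖b i‖ ≤ K := fun i => by
      have := Finset.single_le_sum (f := fun i => ‖b i‖) (fun j _ => norm_nonneg _)
        (Finset.mem_univ i)
      linarith
    have hKpos : 0 < K := by linarith
    refine ⟨δ / 2, by positivity, gagliardoOn_of_basis hN hΩ measurableSet_ball
      b (h := δ / 2 / K) (by positivity) ?_⟩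
    rintro x ⟨hxΩ', hx⟩ i t ht
    have hseg : ∀ s ∈ Icc 0 t, x + s • b i ∈ Metric.ball x₀ δ := by
      intro s hs
      rw [mem_ball_iff_norm] at hx ⊢
      calc ‖x + s • b i - x₀‖ = ‖(x - x₀) + s • b i‖ := by congr 1; abel
        _ ≤ ‖x - x₀‖ + ‖s • b i‖ := norm_add_le _ _
        _ < δ / 2 + δ / 2 := by
            refine add_lt_add_of_lt_of_le hx ?_
            rw [norm_smul, Real.norm_eq_abs, abs_of_nonneg hs.1]
            calc s * ‖b i‖ ≤ (δ / 2 / K) * K := by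
                  gcongr
                  · exact hs.2.trans ht.2
                  · exact hbK i
              _ = δ / 2 := by field_simp
        _ = δ := by ring
    have hd : ∀ s ∈ Icc 0 t, HasDerivAt (fun s : ℝ => ρ (x + s • b i))
        (fderiv ℝ ρ (x + s • b i) (b i)) s := by
      intro s hs
      have h1 : HasDerivAt (fun t : ℝ => x + t • b i) (b i) s := by
        simpa using ((hasDerivAt_id s).smul_const (b i)).const_add x
      have hyU := (hball _ (hseg s hs)).1
      have : DifferentiableAt ℝ ρ (x + s • b i) :=
        (hρ.differentiableOn one_ne_zero).differentiableAt (hU.mem_nhds hyU)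
      exact this.hasFDerivAt.comp_hasDerivAt s h1
    have hanti : StrictAntiOn (fun s : ℝ => ρ (x + s • b i)) (Icc 0 t) := by
      refine strictAntiOn_of_deriv_neg (convex_Icc 0 t)
        (fun s hs => (hd s hs).continuousAt.continuousWithinAt) fun s hs => ?_
      rw [interior_Icc] at hs
      rw [(hd s (Ioo_subset_Icc_self hs)).deriv]
      exact (hball _ (hseg s (Ioo_subset_Icc_self hs))).2 i
    have hlt := hanti (left_mem_Icc.2 ht.1.le) (right_mem_Icc.2 ht.1.le) ht.1
    simp only [zero_smul, add_zero] at hlt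
    have hx0 : x ∈ Metric.ball x₀ δ := by
      simpa using hseg 0 (left_mem_Icc.2 ht.1.le)
    refine (hiff _ (hball _ (hseg t (right_mem_Icc.2 ht.1.le))).1).2 (hlt.trans ?_)
    exact (hiff _ (hball _ hx0).1).1 hxΩ'

/-- Gagliardo's inequality with a weight, up to the boundary of a bounded `C¹` domain; the local
inequalities are combined by compactness. -/
theorem gagliardo_inequality {N : ℕ} (hN : 1 ≤ N) {Ω : Set (Space N)} (hΩ : IsOpen Ω)
    (hb : Bornology.IsBounded Ω) (hC : HasC1Boundary Ω) :
    ∃ C : ℝ≥0∞, C ≠ ⊤ ∧ ∀ v : Space N → ℝ, ContDiff ℝ 1 v → ∀ w : Space N → ℝ≥0∞, Measurable w →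
      (∫⁻ x in Ω, w x) ≠ ⊤ → (∫⁻ x in Ω, (‖v x‖ₑ + ‖fderiv ℝ v x‖ₑ)) ≠ ⊤ →
      ∫⁻ x in Ω, w x ^ (1 / N : ℝ) * ‖v x‖ₑ ≤
        C * (∫⁻ x in Ω, w x) ^ (1 / N : ℝ) * ∫⁻ x in Ω, (‖v x‖ₑ + ‖fderiv ℝ v x‖ₑ) := by
  have hcl : GagliardoOn Ω (closure Ω) := by
    refine hb.isCompact_closure.induction_on (p := GagliardoOn Ω) ?_ ?_ ?_ ?_
    · exact ⟨0, by simp, fun v _ w _ _ _ => by simp⟩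
    · rintro s t hst ⟨C, hCt, h⟩
      refine ⟨C, hCt, fun v hv w hw h1 h2 => le_trans ?_ (h v hv w hw h1 h2)⟩
      exact lintegral_mono_set (inter_subset_inter_right _ hst)
    · rintro s t ⟨C, hCt, h⟩ ⟨C', hCt', h'⟩
      refine ⟨C + C', ENNReal.add_ne_top.2 ⟨hCt, hCt'⟩, fun v hv w hw h1 h2 => ?_⟩
      rw [inter_union_distrib_left, add_mul, add_mul]
      exact (lintegral_union_le _ _ _).trans (add_le_add (h v hv w hw h1 h2) (h' v hv w hw h1 h2))
    · intro x hx
      obtain ⟨δ, hδ, h⟩ := gagliardoOn_nhds hN hΩ hC hx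
      exact ⟨_, mem_nhdsWithin_of_mem_nhds (Metric.ball_mem_nhds x hδ), h⟩
  obtain ⟨C, hCt, h⟩ := hcl
  refine ⟨C, hCt, fun v hv w hw h1 h2 => ?_⟩
  have := h v hv w hw h1 h2
  rwa [inter_eq_left.2 subset_closure] at this

/-! ### A nonlinear interpolation inequality for smooth functions -/

/-- The Japanese bracket `⟨s⟩ = (1 + s²)^{1/2}`. -/
noncomputable def jb (s : ℝ) : ℝ := √(1 + s ^ 2)

theorem one_le_jb (s : ℝ) : 1 ≤ jb s := Real.one_le_sqrt.2 (by nlinarith [sq_nonneg s])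

theorem jb_pos (s : ℝ) : 0 < jb s := one_pos.trans_le (one_le_jb s)

theorem abs_le_jb (s : ℝ) : |s| ≤ jb s := Real.abs_le_sqrt (by linarith)

theorem jb_le_one_add_abs (s : ℝ) : jb s ≤ 1 + |s| :=
  Real.sqrt_le_iff.2 ⟨by positivity, by nlinarith [sq_abs s, abs_nonneg s]⟩

theorem contDiff_jb : ContDiff ℝ ∞ jb := by
  unfold jb
  exact (contDiff_const.add (contDiff_id.pow 2)).sqrt (fun s => by positivity)

theorem continuous_jb : Continuous jb := contDiff_jb.continuous

theorem hasDerivAt_jb (s : ℝ) : HasDerivAt jb (s / jb s) s := by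
  have h : HasDerivAt (fun s : ℝ => 1 + s ^ 2) (2 * s) s := by
    simpa using (hasDerivAt_pow 2 s).const_add 1
  have := h.sqrt (by positivity)
  have e : s / jb s = 2 * s / (2 * √(1 + s ^ 2)) := by
    rw [mul_div_mul_left _ _ two_ne_zero]; rfl
  rw [e]
  exact this

theorem abs_jb_sub_le (s t : ℝ) : |jb s - jb t| ≤ |s - t| := by
  have : LipschitzWith 1 jb := lipschitzWith_of_nnnorm_deriv_le
    (fun s => (hasDerivAt_jb s).differentiableAt) fun s => by
      rw [(hasDerivAt_jb s).deriv, ← NNReal.coe_le_coe, coe_nnnorm, Real.norm_eq_abs, abs_div,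
        abs_of_pos (jb_pos s)]
      exact (div_le_one (jb_pos s)).2 (abs_le_jb s)
  simpa [Real.dist_eq] using this.dist_le_mul s t

theorem hasDerivAt_jb_rpow (b s : ℝ) :
    HasDerivAt (fun s => jb s ^ b) (s / jb s * b * jb s ^ (b - 1)) s :=
  (hasDerivAt_jb s).rpow_const (Or.inl (jb_pos s).ne')

theorem continuous_jb_rpow (b : ℝ) : Continuous fun s => jb s ^ b :=
  continuous_iff_continuousAt.2 fun s => (hasDerivAt_jb_rpow b s).continuousAt

theorem contDiff_jb_rpow (b : ℝ) : ContDiff ℝ ∞ fun s => jb s ^ b :=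
  contDiff_jb.rpow_const_of_ne fun s => (jb_pos s).ne'

theorem jb_rpow_neg_le_one {a : ℝ} (ha : 0 ≤ a) (s : ℝ) : jb s ^ (-a) ≤ 1 :=
  Real.rpow_le_one_of_one_le_of_nonpos (one_le_jb s) (by linarith)

/-- The pointwise form of Young's inequality behind the nonlinear interpolation inequality. -/
theorem exists_young_const {n b α : ℝ} (hn : 0 < n) (hb : 0 < b) (hbα : b = 1 + n - α)
    {ε : ℝ} (hε : 0 < ε) : ∃ C : ℝ, 0 ≤ C ∧ ∀ J d : ℝ, 1 ≤ J → 0 ≤ d →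
      J ^ b + b * J ^ (b - 1) * d ≤ ε * J ^ (b + n) + C * (1 + J ^ (-(1 + α)) * d ^ 2) := by
  refine ⟨(2 / ε) ^ (b / n) + b ^ 2 / (2 * ε), by positivity, fun J d hJ hd => ?_⟩
  have hJ0 : 0 < J := by linarith
  have h1 : J ^ b ≤ ε / 2 * J ^ (b + n) + (2 / ε) ^ (b / n) := by
    have hpow : J ^ (b + n) = J ^ b * J ^ n := Real.rpow_add hJ0 _ _
    by_cases h : 2 / ε ≤ J ^ n
    · have : J ^ b = ε / 2 * (J ^ b * (2 / ε)) := by field_simp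
      have h2 : ε / 2 * (J ^ b * (2 / ε)) ≤ ε / 2 * (J ^ b * J ^ n) := by gcongr
      have : 0 ≤ (2 / ε) ^ (b / n) := by positivity
      rw [hpow]; linarith
    · have h2 : J ^ b ≤ (2 / ε) ^ (b / n) := by
        have : J ^ b = (J ^ n) ^ (b / n) := by
          rw [← Real.rpow_mul hJ0.le]; congr 1; field_simp
        rw [this]
        exact Real.rpow_le_rpow (by positivity) (not_le.1 h).le (by positivity)
      have : 0 ≤ ε / 2 * J ^ (b + n) := by positivity
      linarith
  have h2 : b * J ^ (b - 1) * d ≤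
      ε / 2 * J ^ (b + n) + b ^ 2 / (2 * ε) * (J ^ (-(1 + α)) * d ^ 2) := by
    set A := J ^ ((b + n) / 2) with hA
    set B := J ^ (-(1 + α) / 2) * d with hB
    have e1 : J ^ (b + n) = A ^ 2 := by
      rw [hA, ← Real.rpow_natCast, ← Real.rpow_mul hJ0.le]; congr 1; push_cast; ring
    have e2 : J ^ (-(1 + α)) * d ^ 2 = B ^ 2 := by
      rw [hB, mul_pow, ← Real.rpow_natCast (J ^ _), ← Real.rpow_mul hJ0.le]
      congr 2; push_cast; ring
    have e3 : J ^ (b - 1) * d = A * B := by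
      rw [hA, hB, ← mul_assoc, ← Real.rpow_add hJ0]; congr 2; rw [hbα]; ring
    rw [e1, e2, mul_assoc, e3]
    have : b ^ 2 / (2 * ε) * B ^ 2 + ε / 2 * A ^ 2 - b * (A * B) =
        (ε * A - b * B) ^ 2 / (2 * ε) := by field_simp; ring
    have h4 : 0 ≤ (ε * A - b * B) ^ 2 / (2 * ε) := by positivity
    linarith
  have h3 : 0 ≤ (2 / ε) ^ (b / n) * (J ^ (-(1 + α)) * d ^ 2) := by positivity
  have h4 : 0 ≤ b ^ 2 / (2 * ε) := by positivity
  nlinarith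

theorem lintegral_ne_top_of_continuous {N : ℕ} {Ω : Set (Space N)}
    (hb : Bornology.IsBounded Ω) {g : Space N → ℝ} (hg : Continuous g) :
    ∫⁻ x in Ω, ‖g x‖ₑ ≠ ⊤ := by
  have h : IntegrableOn g (closure Ω) := hg.continuousOn.integrableOn_compact hb.isCompact_closure
  exact (h.mono_set subset_closure).hasFiniteIntegral.ne

/-- The inequality of Gagliardo–Nirenberg type behind the parabolic exponent: the `L^{1+2/N-α}`
norm is controlled by the `L¹` norm and the weighted energy. It is Gagliardo's inequality for
`v = ⟨φ⟩^{1+1/N-α}` with the weight `w = ⟨φ⟩`, the gradient term being absorbed. -/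
theorem nonlinear_gagliardo_smooth {N : ℕ} (hN : 1 ≤ N) {Ω : Set (Space N)} (hΩ : IsOpen Ω)
    (hbd : Bornology.IsBounded Ω) (hC : HasC1Boundary Ω) {α : ℝ} (hα1 : α < 1)
    {M : ℝ≥0∞} (hM : M ≠ ⊤) :
    ∃ K : ℝ≥0∞, K ≠ ⊤ ∧ ∀ φ : Space N → ℝ, ContDiff ℝ 1 φ →
      ∫⁻ x in Ω, ENNReal.ofReal (jb (φ x)) ≤ M →
      ∫⁻ x in Ω, ENNReal.ofReal (jb (φ x) ^ (1 + 2 / N - α : ℝ)) ≤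
        K * (1 + ∫⁻ x in Ω, ENNReal.ofReal (jb (φ x) ^ (-(1 + α)) * ‖fderiv ℝ φ x‖ ^ 2)) := by
  obtain ⟨C, hCt, hG⟩ := gagliardo_inequality hN hΩ hbd hC
  have hN0 : (0 : ℝ) < N := by exact_mod_cast hN
  set n : ℝ := 1 / N with hn
  have hn0 : 0 < n := by positivity
  set b : ℝ := 1 + n - α with hb
  have hb0 : 0 < b := by linarith
  have hr : (1 + 2 / N - α : ℝ) = b + n := by rw [hb, hn]; ring
  set Cm : ℝ≥0∞ := C * M ^ n with hCm
  have hCmt : Cm ≠ ⊤ := ENNReal.mul_ne_top hCt (ENNReal.rpow_ne_top_of_nonneg hn0.le hM)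
  -- the factor in front of the term to be absorbed is at most `1/2`
  set ε : ℝ := 1 / (2 * (Cm.toReal + 1)) with hε
  have hε0 : 0 < ε := by have := ENNReal.toReal_nonneg (a := Cm); positivity
  have hCε : Cm * ENNReal.ofReal ε ≤ 2⁻¹ := by
    rw [← ENNReal.ofReal_toReal hCmt, ← ENNReal.ofReal_mul ENNReal.toReal_nonneg]
    rw [show (2⁻¹ : ℝ≥0∞) = ENNReal.ofReal 2⁻¹ by
      rw [ENNReal.ofReal_inv_of_pos (by norm_num)]; simp]
    refine ENNReal.ofReal_le_ofReal ?_
    have := ENNReal.toReal_nonneg (a := Cm)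
    rw [hε, mul_one_div, div_le_iff₀ (by positivity)]
    linarith
  obtain ⟨D, hD0, hD⟩ := exists_young_const hn0 hb0 hb hε0
  have hvol : volume Ω ≠ ⊤ := hbd.measure_lt_top.ne
  refine ⟨2 * (Cm * ENNReal.ofReal D * (volume Ω + 1)), by finiteness, ?_⟩
  intro φ hφ hφM
  have hφc : Continuous φ := hφ.continuous
  have hdc : Continuous (fderiv ℝ φ) := hφ.continuous_fderiv one_ne_zero
  rw [hr]
  set X := ∫⁻ x in Ω, ENNReal.ofReal (jb (φ x) ^ (b + n))
  set E := ∫⁻ x in Ω, ENNReal.ofReal (jb (φ x) ^ (-(1 + α)) * ‖fderiv ℝ φ x‖ ^ 2)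
  set v : Space N → ℝ := fun x => jb (φ x) ^ b with hv
  have hv1 : ContDiff ℝ 1 v := ((contDiff_jb_rpow b).of_le (by exact_mod_cast le_top)).comp hφ
  have hXt : X ≠ ⊤ := by
    have := lintegral_ne_top_of_continuous hbd ((continuous_jb_rpow (b + n)).comp hφc)
    convert this using 4
    rw [Function.comp, Real.enorm_of_nonneg (Real.rpow_nonneg (jb_pos _).le _)]
  have hpt : ∀ x, ‖v x‖ₑ + ‖fderiv ℝ v x‖ₑ ≤ ENNReal.ofReal ε *
      ENNReal.ofReal (jb (φ x) ^ (b + n)) + ENNReal.ofReal D *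
      (1 + ENNReal.ofReal (jb (φ x) ^ (-(1 + α)) * ‖fderiv ℝ φ x‖ ^ 2)) := by
    intro x
    have hJ := jb_pos (φ x)
    have hf : HasFDerivAt v ((φ x / jb (φ x) * b * jb (φ x) ^ (b - 1)) • fderiv ℝ φ x) x :=
      (hasDerivAt_jb_rpow b (φ x)).comp_hasFDerivAt x
        (hφ.differentiable one_ne_zero x).hasFDerivAt
    have hnv : ‖fderiv ℝ v x‖ ≤ b * jb (φ x) ^ (b - 1) * ‖fderiv ℝ φ x‖ := by
      rw [hf.fderiv, norm_smul, Real.norm_eq_abs, abs_mul, abs_mul, abs_div, abs_of_pos hJ,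
        abs_of_pos hb0, abs_of_pos (Real.rpow_pos_of_pos hJ _)]
      have : |φ x| / jb (φ x) ≤ 1 := (div_le_one hJ).2 (abs_le_jb _)
      gcongr
      exact mul_le_of_le_one_left hb0.le this
    rw [← ofReal_norm, ← ofReal_norm, ← ENNReal.ofReal_add (norm_nonneg _) (norm_nonneg _),
      ← ENNReal.ofReal_mul hε0.le, ← ENNReal.ofReal_one,
      ← ENNReal.ofReal_add zero_le_one (by positivity), ← ENNReal.ofReal_mul hD0,
      ← ENNReal.ofReal_add (by positivity) (by positivity)]
    refine ENNReal.ofReal_le_ofReal (le_trans ?_ (hD _ _ (one_le_jb (φ x)) (norm_nonneg _)))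
    rw [hv, Real.norm_of_nonneg (by positivity)]
    gcongr
  have hBX : ∫⁻ x in Ω, (‖v x‖ₑ + ‖fderiv ℝ v x‖ₑ) ≤
      ENNReal.ofReal ε * X + ENNReal.ofReal D * (volume Ω + E) := by
    refine (lintegral_mono hpt).trans ?_
    have m1 : Measurable fun x => ENNReal.ofReal (jb (φ x) ^ (b + n)) :=
      ((continuous_jb_rpow _).comp hφc).measurable.ennreal_ofReal
    rw [lintegral_add_left (m1.const_mul _), lintegral_const_mul' _ _ ENNReal.ofReal_ne_top,
      lintegral_const_mul' _ _ ENNReal.ofReal_ne_top, lintegral_add_left measurable_const,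
      setLIntegral_const, one_mul]
  have hmw : Measurable fun x => ENNReal.ofReal (jb (φ x)) :=
    (continuous_jb.comp hφc).measurable.ennreal_ofReal
  have hFt : ∫⁻ x in Ω, (‖v x‖ₑ + ‖fderiv ℝ v x‖ₑ) ≠ ⊤ := by
    rw [lintegral_add_left hv1.continuous.measurable.enorm]
    refine ENNReal.add_ne_top.2 ⟨lintegral_ne_top_of_continuous hbd hv1.continuous, ?_⟩
    have := lintegral_ne_top_of_continuous hbd (hv1.continuous_fderiv one_ne_zero).norm
    simpa using this
  have hmain := hG v hv1 (fun x => ENNReal.ofReal (jb (φ x))) hmw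
    (ne_top_of_le_ne_top hM hφM) hFt
  have hX : ∫⁻ x in Ω, ENNReal.ofReal (jb (φ x)) ^ n * ‖v x‖ₑ = X := by
    refine lintegral_congr fun x => ?_
    have hJ := jb_pos (φ x)
    rw [hv, Real.enorm_of_nonneg (by positivity), ENNReal.ofReal_rpow_of_pos hJ,
      ← ENNReal.ofReal_mul (by positivity), ← Real.rpow_add hJ, add_comm n b]
  rw [hX] at hmain
  have h1 : X ≤ 2⁻¹ * X + Cm * (ENNReal.ofReal D * (volume Ω + E)) := by
    calc X ≤ Cm * (ENNReal.ofReal ε * X + ENNReal.ofReal D * (volume Ω + E)) := by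
          refine hmain.trans ?_
          rw [hCm]
          gcongr
      _ = Cm * ENNReal.ofReal ε * X + Cm * (ENNReal.ofReal D * (volume Ω + E)) := by ring
      _ ≤ _ := by gcongr
  have h2 : X ≤ 2 * (Cm * (ENNReal.ofReal D * (volume Ω + E))) := by
    have e : X = 2⁻¹ * X + 2⁻¹ * X := by rw [← add_mul, ENNReal.inv_two_add_inv_two, one_mul]
    have h3 : 2⁻¹ * X ≤ Cm * (ENNReal.ofReal D * (volume Ω + E)) := by
      have h4 : 2⁻¹ * X + 2⁻¹ * X ≤ 2⁻¹ * X + Cm * (ENNReal.ofReal D * (volume Ω + E)) := by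
        rw [← e]; exact h1
      exact (ENNReal.add_le_add_iff_left (by finiteness)).1 h4
    calc X = 2 * (2⁻¹ * X) := by
          rw [← mul_assoc, ENNReal.mul_inv_cancel two_ne_zero (by simp), one_mul]
      _ ≤ _ := by gcongr
  refine h2.trans ?_
  rw [mul_assoc 2, mul_assoc Cm, mul_assoc Cm, mul_assoc (ENNReal.ofReal D)]
  gcongr
  rw [add_mul, one_mul, mul_add, mul_one]
  have : E ≤ 1 + E := le_add_self
  calc volume Ω + E ≤ volume Ω + (1 + E) := by gcongr
    _ ≤ volume Ω + volume Ω * E + (1 + E) := by gcongr; exact le_self_add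

/-! ### Strong gradients -/

/-- `(u, G)` is the limit in `L²(Ω)` of `(φₙ, ∇φₙ)` with `φₙ ∈ C¹(ℝ^N)`, and `φₙ → u` almost
everywhere. These pairs form the closure of `C¹(ℝ^N)` in `W^{1,2}(Ω)`, which is the form domain of
the Neumann Laplacian used here. -/
structure HasStrongGradient {N : ℕ} (Ω : Set (Space N)) (u : Space N → ℝ)
    (G : Space N → Space N) : Prop where
  memLp_fun : MemLp u 2 (volume.restrict Ω)
  memLp_grad : MemLp G 2 (volume.restrict Ω)
  exists_seq : ∃ φ : ℕ → Space N → ℝ, (∀ n, ContDiff ℝ 1 (φ n)) ∧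
    Tendsto (fun n => eLpNorm (φ n - u) 2 (volume.restrict Ω)) atTop (𝓝 0) ∧
    Tendsto (fun n => eLpNorm (gradient (φ n) - G) 2 (volume.restrict Ω)) atTop (𝓝 0) ∧
    ∀ᵐ x ∂(volume.restrict Ω), Tendsto (fun n => φ n x) atTop (𝓝 (u x))

theorem norm_gradient {N : ℕ} (φ : Space N → ℝ) (x : Space N) :
    ‖gradient φ x‖ = ‖fderiv ℝ φ x‖ := by
  simp [gradient]

theorem continuous_gradient {N : ℕ} {φ : Space N → ℝ} (hφ : ContDiff ℝ 1 φ) :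
    Continuous (gradient φ) :=
  (InnerProductSpace.toDual ℝ (Space N)).symm.continuous.comp (hφ.continuous_fderiv one_ne_zero)

theorem inner_gradient {N : ℕ} (φ : Space N → ℝ) (x y : Space N) :
    inner ℝ (gradient φ x) y = fderiv ℝ φ x y := by
  simp [gradient]

theorem lintegral_enorm_le_eLpNorm_two {N : ℕ} {E : Type*} [NormedAddCommGroup E]
    {Ω : Set (Space N)} {u : Space N → E} (hu : AEStronglyMeasurable u (volume.restrict Ω)) :
    ∫⁻ x in Ω, ‖u x‖ₑ ≤ eLpNorm u 2 (volume.restrict Ω) * volume Ω ^ (1 / 2 : ℝ) := by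
  rw [← eLpNorm_one_eq_lintegral_enorm]
  refine (eLpNorm_le_eLpNorm_mul_rpow_measure_univ (p := 1) (q := 2) (by norm_num) hu).trans ?_
  rw [Measure.restrict_apply_univ]
  norm_num

theorem lintegral_enorm_sq {N : ℕ} {E : Type*} [NormedAddCommGroup E]
    {Ω : Set (Space N)} (u : Space N → E) :
    ∫⁻ x in Ω, ‖u x‖ₑ ^ 2 = eLpNorm u 2 (volume.restrict Ω) ^ 2 := by
  rw [eLpNorm_eq_lintegral_rpow_enorm_toReal two_ne_zero (by simp), ← ENNReal.rpow_natCast,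
    ← ENNReal.rpow_mul]
  simp

/-- The nonlinear interpolation inequality for strong gradients, by approximation. -/
theorem nonlinear_gagliardo {N : ℕ} (hN : 1 ≤ N) {Ω : Set (Space N)} (hΩ : IsOpen Ω)
    (hbd : Bornology.IsBounded Ω) (hC : HasC1Boundary Ω) {α : ℝ} (hα0 : 0 < α) (hα1 : α < 1)
    {M : ℝ≥0∞} (hM : M ≠ ⊤) :
    ∃ K : ℝ≥0∞, K ≠ ⊤ ∧ ∀ (u : Space N → ℝ) (G : Space N → Space N), HasStrongGradient Ω u G →
      ∫⁻ x in Ω, ENNReal.ofReal (jb (u x)) ≤ M →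
      ∫⁻ x in Ω, ENNReal.ofReal (jb (u x) ^ (1 + 2 / N - α : ℝ)) ≤
        K * (1 + ∫⁻ x in Ω, ENNReal.ofReal (jb (u x) ^ (-(1 + α)) * ‖G x‖ ^ 2)) := by
  obtain ⟨K, hKt, hK⟩ := nonlinear_gagliardo_smooth hN hΩ hbd hC hα1
    (M := M + 1) (ENNReal.add_ne_top.2 ⟨hM, by simp⟩)
  refine ⟨K * 2, ENNReal.mul_ne_top hKt (by simp), ?_⟩
  rintro u G ⟨hu, hG, φ, hφ, hφu, hφG, hae⟩ huM
  have hvol : volume Ω ≠ ⊤ := hbd.measure_lt_top.ne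
  have hcr := fun a : ℝ => continuous_jb_rpow a
  set r : ℝ := 1 + 2 / N - α
  set k : ℝ → ℝ := fun s => jb s ^ (-(1 + α)) with hk
  have hk1 : ∀ s, k s ≤ 1 := fun s => jb_rpow_neg_le_one (by linarith) s
  have hk0 : ∀ s, 0 ≤ k s := fun s => Real.rpow_nonneg (jb_pos s).le _
  have hdm : ∀ n, AEStronglyMeasurable (φ n - u) (volume.restrict Ω) := fun n =>
    (hφ n).continuous.aestronglyMeasurable.sub hu.aestronglyMeasurable
  -- The approximations satisfy the `L¹` bound up to `1`, eventually; hence the choice of `M + 1`.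
  have hM1 : ∀ᶠ n in atTop, ∫⁻ x in Ω, ENNReal.ofReal (jb (φ n x)) ≤ M + 1 := by
    have ht : Tendsto (fun n => eLpNorm (φ n - u) 2 (volume.restrict Ω) *
        volume Ω ^ (1 / 2 : ℝ)) atTop (𝓝 0) := by
      simpa using ENNReal.Tendsto.mul_const hφu
        (Or.inr (ENNReal.rpow_ne_top_of_nonneg (by norm_num) hvol))
    filter_upwards [ht.eventually_le_const (show (0 : ℝ≥0∞) < 1 by simp)] with n hn
    calc ∫⁻ x in Ω, ENNReal.ofReal (jb (φ n x))
        ≤ ∫⁻ x in Ω, (ENNReal.ofReal (jb (u x)) + ‖(φ n - u) x‖ₑ) := by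
          refine lintegral_mono fun x => ?_
          rw [← ofReal_norm, ← ENNReal.ofReal_add (jb_pos _).le (norm_nonneg _)]
          refine ENNReal.ofReal_le_ofReal ?_
          have := (le_abs_self _).trans (abs_jb_sub_le (φ n x) (u x))
          simp only [Pi.sub_apply, Real.norm_eq_abs]; linarith
      _ = (∫⁻ x in Ω, ENNReal.ofReal (jb (u x))) + ∫⁻ x in Ω, ‖(φ n - u) x‖ₑ :=
          lintegral_add_right' _ (hdm n).enorm
      _ ≤ M + 1 := add_le_add huM ((lintegral_enorm_le_eLpNorm_two (hdm n)).trans hn)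
  -- `Z n` bounds the energy of `φ n`, and tends to twice the energy of `u`, because the weights
  -- `k (φ n)` are bounded by `1` and converge almost everywhere.
  set Z : ℕ → ℝ≥0∞ := fun n => (2 * ∫⁻ x in Ω, ENNReal.ofReal (k (φ n x) * ‖G x‖ ^ 2)) +
    2 * eLpNorm (gradient (φ n) - G) 2 (volume.restrict Ω) ^ 2 with hZ
  set E := ∫⁻ x in Ω, ENNReal.ofReal (k (u x) * ‖G x‖ ^ 2) with hE
  have hEn : ∀ n, ∫⁻ x in Ω, ENNReal.ofReal (k (φ n x) * ‖fderiv ℝ (φ n) x‖ ^ 2) ≤ Z n := by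
    intro n
    have hGm : AEStronglyMeasurable (gradient (φ n) - G) (volume.restrict Ω) :=
      (continuous_gradient (hφ n)).aestronglyMeasurable.sub hG.aestronglyMeasurable
    rw [hZ]
    dsimp only
    rw [← lintegral_enorm_sq, ← lintegral_const_mul' _ _ (by simp),
      ← lintegral_const_mul' _ _ (by simp), ← lintegral_add_right' _
      ((hGm.enorm.pow_const 2).const_mul 2)]
    refine lintegral_mono fun x => ?_
    have h2 : ∀ y : ℝ, 2 * ENNReal.ofReal y = ENNReal.ofReal (2 * y) := fun y => by
      rw [ENNReal.ofReal_mul (by norm_num), ENNReal.ofReal_ofNat]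
    rw [← ofReal_norm, ← ENNReal.ofReal_pow (norm_nonneg _), h2, h2, ← ENNReal.ofReal_add
      (mul_nonneg (by norm_num) (mul_nonneg (hk0 _) (by positivity))) (by positivity)]
    refine ENNReal.ofReal_le_ofReal ?_
    rw [← norm_gradient]
    have htri : ‖gradient (φ n) x‖ ≤ ‖G x‖ + ‖(gradient (φ n) - G) x‖ := by
      have := norm_add_le (G x) (gradient (φ n) x - G x)
      simpa using this
    set a := ‖gradient (φ n) x‖
    set c := ‖(gradient (φ n) - G) x‖
    have ha : 0 ≤ a := norm_nonneg _
    have h3 : a ^ 2 ≤ 2 * ‖G x‖ ^ 2 + 2 * c ^ 2 := by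
      have : a ^ 2 ≤ (‖G x‖ + c) ^ 2 := by gcongr
      nlinarith [sq_nonneg (‖G x‖ - c)]
    calc k (φ n x) * a ^ 2 ≤ k (φ n x) * (2 * ‖G x‖ ^ 2 + 2 * c ^ 2) :=
          mul_le_mul_of_nonneg_left h3 (hk0 _)
      _ = 2 * (k (φ n x) * ‖G x‖ ^ 2) + k (φ n x) * (2 * c ^ 2) := by ring
      _ ≤ 2 * (k (φ n x) * ‖G x‖ ^ 2) + 1 * (2 * c ^ 2) := by
          gcongr; exact hk1 _
      _ = _ := by ring
  have hZt : Tendsto Z atTop (𝓝 (2 * E)) := by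
    have h1 : Tendsto (fun n => ∫⁻ x in Ω, ENNReal.ofReal (k (φ n x) * ‖G x‖ ^ 2)) atTop
        (𝓝 E) := by
      refine tendsto_lintegral_of_dominated_convergence' (fun x => ‖G x‖ₑ ^ 2) ?_ ?_ ?_ ?_
      · intro n
        exact ((((hcr _).comp (hφ n).continuous).aemeasurable).mul
          (hG.aestronglyMeasurable.norm.aemeasurable.pow_const 2)).ennreal_ofReal
      · intro n
        refine Eventually.of_forall fun x => ?_
        dsimp only
        rw [← ofReal_norm, ← ENNReal.ofReal_pow (norm_nonneg _)]
        refine ENNReal.ofReal_le_ofReal ?_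
        exact mul_le_of_le_one_left (by positivity) (hk1 _)
      · rw [lintegral_enorm_sq]; exact ENNReal.pow_ne_top hG.eLpNorm_lt_top.ne
      · filter_upwards [hae] with x hx
        refine ENNReal.tendsto_ofReal (Tendsto.mul_const _ ?_)
        exact ((hcr _).tendsto _).comp hx
    have h2 : Tendsto (fun n => eLpNorm (gradient (φ n) - G) 2 (volume.restrict Ω) ^ 2) atTop
        (𝓝 0) := by
      simpa using ENNReal.Tendsto.pow (n := 2) hφG
    have := (ENNReal.Tendsto.const_mul h1 (a := 2) (Or.inr (by simp))).add
      (ENNReal.Tendsto.const_mul h2 (a := 2) (Or.inr (by simp)))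
    simpa [hZ] using this
  have hZlim : Tendsto (fun n => K * (1 + Z n)) atTop (𝓝 (K * (1 + 2 * E))) :=
    ENNReal.Tendsto.const_mul (tendsto_const_nhds.add hZt) (Or.inr hKt)
  calc ∫⁻ x in Ω, ENNReal.ofReal (jb (u x) ^ r)
      ≤ liminf (fun n => ∫⁻ x in Ω, ENNReal.ofReal (jb (φ n x) ^ r)) atTop := by
        refine le_trans (le_of_eq ?_) (lintegral_liminf_le' fun n =>
          ((hcr r).comp (hφ n).continuous).aemeasurable.ennreal_ofReal)
        refine lintegral_congr_ae ?_
        filter_upwards [hae] with x hx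
        exact (ENNReal.tendsto_ofReal (((hcr r).tendsto _).comp hx)).liminf_eq.symm
    _ ≤ liminf (fun n => K * (1 + Z n)) atTop := by
        refine liminf_le_liminf ?_
        filter_upwards [hM1] with n hn
        refine (hK (φ n) (hφ n) hn).trans ?_
        gcongr
        exact hEn n
    _ = K * (1 + 2 * E) := hZlim.liminf_eq
    _ ≤ K * 2 * (1 + E) := by
        rw [mul_assoc]
        gcongr
        rw [mul_add]
        gcongr
        norm_num

/-! ### The resolvent of the Neumann Laplacian -/

theorem gradient_add_of_contDiff {N : ℕ} {φ ψ : Space N → ℝ} (hφ : ContDiff ℝ 1 φ)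
    (hψ : ContDiff ℝ 1 ψ) : gradient (φ + ψ) = gradient φ + gradient ψ := by
  funext x
  simp only [gradient, Pi.add_apply]
  rw [fderiv_add (hφ.differentiable one_ne_zero x) (hψ.differentiable one_ne_zero x), map_add]

theorem gradient_smul_of_contDiff {N : ℕ} {φ : Space N → ℝ} (hφ : ContDiff ℝ 1 φ) (c : ℝ) :
    gradient (c • φ) = c • gradient φ := by
  funext x
  simp only [gradient, Pi.smul_apply]
  rw [fderiv_const_smul (hφ.differentiable one_ne_zero x)]
  simp

theorem gradient_comp {N : ℕ} {φ : Space N → ℝ} (hφ : ContDiff ℝ 1 φ) {S k : ℝ → ℝ}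
    (hS : ∀ s, HasDerivAt S (k s) s) (x : Space N) :
    gradient (fun y => S (φ y)) x = k (φ x) • gradient φ x := by
  have : HasFDerivAt (fun y => S (φ y)) (k (φ x) • fderiv ℝ φ x) x :=
    (hS (φ x)).comp_hasFDerivAt x (hφ.differentiable one_ne_zero x).hasFDerivAt
  simp [gradient, this.fderiv]

theorem memLp_of_continuous {N : ℕ} {E : Type*} [NormedAddCommGroup E] {Ω : Set (Space N)}
    (hbd : Bornology.IsBounded Ω) {g : Space N → E} (hg : Continuous g) (p : ℝ≥0∞) :
    MemLp g p (volume.restrict Ω) := by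
  have hvol : IsFiniteMeasure (volume.restrict Ω) :=
    ⟨by rw [Measure.restrict_apply_univ]; exact hbd.measure_lt_top⟩
  have hK : IsCompact (closure Ω) := hbd.isCompact_closure
  obtain ⟨C, hC⟩ := hK.exists_bound_of_continuousOn hg.continuousOn
  have hsm : AEStronglyMeasurable g (volume.restrict (closure Ω)) :=
    hg.continuousOn.aestronglyMeasurable_of_isCompact hK isClosed_closure.measurableSet
  have hsm' := hsm.mono_measure (Measure.restrict_mono (subset_closure (s := Ω)) le_rfl)
  refine MemLp.of_bound hsm' C ?_
  refine ae_restrict_of_ae_restrict_of_subset (subset_closure (s := Ω)) ?_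
  exact (ae_restrict_mem isClosed_closure.measurableSet).mono hC

/-- Existence for the resolvent equation `u - h Δ u = g` with Neumann boundary condition: the pair
`(u, √h ∇u)` is the orthogonal projection of `(g, 0)` onto the closure of the pairs `(φ, √h ∇φ)`
in `L² × L²`. -/
theorem exists_resolvent {N : ℕ} {Ω : Set (Space N)} (hbd : Bornology.IsBounded Ω) {h : ℝ}
    (hh : 0 < h) {g : Space N → ℝ} (hg : MemLp g 2 (volume.restrict Ω)) :
    ∃ (u : Space N → ℝ) (G : Space N → Space N), StronglyMeasurable u ∧ StronglyMeasurable G ∧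
      HasStrongGradient Ω u G ∧ ∀ φ : Space N → ℝ, ContDiff ℝ 1 φ →
        (∫ x in Ω, u x * φ x) + h * ∫ x in Ω, inner ℝ (G x) (gradient φ x) =
          ∫ x in Ω, g x * φ x := by
  set μ := volume.restrict Ω with hμ
  have hmem : ∀ {φ : Space N → ℝ}, ContDiff ℝ 1 φ → MemLp φ 2 μ := fun hφ =>
    memLp_of_continuous hbd hφ.continuous 2
  have hmemg : ∀ {φ : Space N → ℝ}, ContDiff ℝ 1 φ → MemLp (gradient φ) 2 μ := fun hφ =>
    memLp_of_continuous hbd (continuous_gradient hφ) 2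
  set c : ℝ := √h with hc
  have hc0 : 0 < c := Real.sqrt_pos.2 hh
  have hcc : c * c = h := Real.mul_self_sqrt hh.le
  let V : Submodule ℝ (WithLp 2 (Lp ℝ 2 μ × Lp (Space N) 2 μ)) :=
    { carrier := {z | ∃ φ : Space N → ℝ, ContDiff ℝ 1 φ ∧ z.fst =ᵐ[μ] φ ∧
        z.snd =ᵐ[μ] c • gradient φ}
      zero_mem' := by
        refine ⟨0, contDiff_const, Lp.coeFn_zero _ _ _, ?_⟩
        have : gradient (0 : Space N → ℝ) = 0 := by
          funext x; exact gradient_fun_const x 0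
        rw [this, smul_zero]
        exact Lp.coeFn_zero _ _ _
      add_mem' := by
        rintro z w ⟨φ, hφ, h1, h2⟩ ⟨ψ, hψ, h3, h4⟩
        refine ⟨φ + ψ, hφ.add hψ, (Lp.coeFn_add _ _).trans (h1.add h3), ?_⟩
        rw [gradient_add_of_contDiff hφ hψ, smul_add]
        exact (Lp.coeFn_add _ _).trans (h2.add h4)
      smul_mem' := by
        rintro a z ⟨φ, hφ, h1, h2⟩
        refine ⟨a • φ, contDiff_const.smul hφ, (Lp.coeFn_smul _ _).trans (h1.const_smul a), ?_⟩
        rw [gradient_smul_of_contDiff hφ, smul_comm]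
        exact (Lp.coeFn_smul _ _).trans (h2.const_smul a) }
  let W := V.topologicalClosure
  have hWc : IsClosed (W : Set (WithLp 2 (Lp ℝ 2 μ × Lp (Space N) 2 μ))) :=
    V.isClosed_topologicalClosure
  have : CompleteSpace W := hWc.completeSpace_coe
  let z : WithLp 2 (Lp ℝ 2 μ × Lp (Space N) 2 μ) := WithLp.toLp 2 (hg.toLp g, 0)
  let w := W.starProjection z
  have hwW : w ∈ W := W.starProjection_apply_mem z
  have hortho : ∀ v ∈ W, inner ℝ (z - w) v = 0 := fun v hv =>
    W.starProjection_inner_eq_zero z v hv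
  obtain ⟨y, hyV, hyw⟩ := mem_closure_iff_seq_limit.1 hwW
  choose φ hφ h1 h2 using hyV
  have hfst : Tendsto (fun n => (y n).fst) atTop (𝓝 w.fst) :=
    ((WithLp.fstL 2 ℝ (Lp ℝ 2 μ) (Lp (Space N) 2 μ)).continuous.tendsto w).comp hyw
  have hsnd : Tendsto (fun n => (y n).snd) atTop (𝓝 w.snd) :=
    ((WithLp.sndL 2 ℝ (Lp ℝ 2 μ) (Lp (Space N) 2 μ)).continuous.tendsto w).comp hyw
  rw [Lp.tendsto_Lp_iff_tendsto_eLpNorm'] at hfst hsnd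
  let u : Space N → ℝ := ⇑(w.fst : Lp ℝ 2 μ)
  set G : Space N → Space N := c⁻¹ • ((w.snd : Lp (Space N) 2 μ) : Space N → Space N) with hG
  have hwsnd : ((w.snd : Lp (Space N) 2 μ) : Space N → Space N) = c • G := by
    rw [hG, smul_smul, mul_inv_cancel₀ hc0.ne', one_smul]
  have huφ : Tendsto (fun n => eLpNorm (φ n - u) 2 μ) atTop (𝓝 0) := by
    refine hfst.congr fun n => eLpNorm_congr_ae ((h1 n).sub (ae_eq_refl _))
  have hGφ : Tendsto (fun n => eLpNorm (gradient (φ n) - G) 2 μ) atTop (𝓝 0) := by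
    have : ∀ n, eLpNorm (gradient (φ n) - G) 2 μ =
        ‖c⁻¹‖ₑ * eLpNorm (⇑((y n).snd : Lp (Space N) 2 μ) - ⇑(w.snd : Lp (Space N) 2 μ)) 2 μ := by
      intro n
      rw [← eLpNorm_const_smul]
      refine eLpNorm_congr_ae ?_
      filter_upwards [h2 n] with x hx
      simp only [Pi.sub_apply, Pi.smul_apply, hx, hG, smul_sub, smul_smul,
        inv_mul_cancel₀ hc0.ne', one_smul]
    simp_rw [this]
    simpa using ENNReal.Tendsto.const_mul hsnd (Or.inr enorm_ne_top)
  obtain ⟨ns, hns, hae⟩ := (tendstoInMeasure_of_tendsto_eLpNorm two_ne_zero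
    (fun n => (hmem (hφ n)).aestronglyMeasurable) (Lp.aestronglyMeasurable w.fst)
    huφ).exists_seq_tendsto_ae
  refine ⟨u, G, Lp.stronglyMeasurable _, (Lp.stronglyMeasurable _).const_smul _,
    ⟨Lp.memLp _, (Lp.memLp _).const_smul _, fun n => φ (ns n), fun n => hφ _,
      huφ.comp hns.tendsto_atTop, hGφ.comp hns.tendsto_atTop, hae⟩, ?_⟩
  intro ψ hψ
  let v : WithLp 2 (Lp ℝ 2 μ × Lp (Space N) 2 μ) :=
    WithLp.toLp 2 ((hmem hψ).toLp ψ, ((hmemg hψ).const_smul c).toLp (c • gradient ψ))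
  have hv : v ∈ W := V.le_topologicalClosure
    ⟨ψ, hψ, (hmem hψ).coeFn_toLp, ((hmemg hψ).const_smul c).coeFn_toLp⟩
  have hzero := hortho v hv
  rw [inner_sub_left, WithLp.prod_inner_apply, WithLp.prod_inner_apply, sub_eq_zero] at hzero
  have e1 : inner ℝ (z.ofLp.1 : Lp ℝ 2 μ) v.ofLp.1 = ∫ x in Ω, g x * ψ x := by
    rw [L2.inner_def]
    refine integral_congr_ae ?_
    filter_upwards [hg.coeFn_toLp, (hmem hψ).coeFn_toLp] with x hx hx'
    simp [z, v, hx, hx', mul_comm]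
  have e2 : inner ℝ (z.ofLp.2 : Lp (Space N) 2 μ) v.ofLp.2 = 0 := by simp [z]
  have e3 : inner ℝ (w.ofLp.1 : Lp ℝ 2 μ) v.ofLp.1 = ∫ x in Ω, u x * ψ x := by
    rw [L2.inner_def]
    refine integral_congr_ae ?_
    filter_upwards [(hmem hψ).coeFn_toLp] with x hx
    simp only [v, hx]
    exact mul_comm _ _
  have e4 : inner ℝ (w.ofLp.2 : Lp (Space N) 2 μ) v.ofLp.2 =
      h * ∫ x in Ω, inner ℝ (G x) (gradient ψ x) := by
    rw [L2.inner_def, ← integral_const_mul]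
    refine integral_congr_ae ?_
    filter_upwards [((hmemg hψ).const_smul c).coeFn_toLp] with x hx
    have : ((w.ofLp.2 : Lp (Space N) 2 μ) : Space N → Space N) x = c • G x := congrFun hwsnd x
    simp only [v, hx, this]
    rw [Pi.smul_apply, inner_smul_left, inner_smul_right, ← mul_assoc]
    simp [hcc]
  rw [e1, e2, e3, e4, add_zero] at hzero
  exact hzero.symm

/-! ### The renormalized energy estimate -/

theorem integrable_jb_rpow {α : ℝ} (hα : 0 < α) :
    Integrable (fun s : ℝ => jb s ^ (-(1 + α))) := by
  have := integrable_rpow_neg_one_add_norm_sq (E := ℝ) (μ := volume) (r := 1 + α)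
    (by simp [hα])
  refine this.congr (Eventually.of_forall fun s => ?_)
  simp only [jb, Real.sqrt_eq_rpow, Real.norm_eq_abs, sq_abs]
  rw [← Real.rpow_mul (by positivity)]
  congr 1; ring

/-- A bounded nondecreasing function `S` with derivative `⟨s⟩^{-(1+α)}`, together with its convex
primitive `Ψ`, which grows linearly. -/
theorem exists_renormalization {α : ℝ} (hα : 0 < α) :
    ∃ (S Ψ : ℝ → ℝ) (A c : ℝ), 0 < A ∧ 0 < c ∧ (∀ s, HasDerivAt S (jb s ^ (-(1 + α))) s) ∧
      (∀ s, |S s| ≤ A) ∧ Continuous Ψ ∧ (∀ a b, Ψ a - Ψ b ≤ (a - b) * S a) ∧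
      (∀ s, 0 ≤ Ψ s) ∧ (∀ s, Ψ s ≤ A * |s|) ∧ ∀ s, c * (|s| - 1) ≤ Ψ s := by
  set k : ℝ → ℝ := fun s => jb s ^ (-(1 + α)) with hk
  have hkc : Continuous k := continuous_jb_rpow _
  have hk0 : ∀ s, 0 < k s := fun s => Real.rpow_pos_of_pos (jb_pos s) _
  set S : ℝ → ℝ := fun s => ∫ x in (0 : ℝ)..s, k x with hS
  have hSd : ∀ s, HasDerivAt S (k s) s := fun s =>
    intervalIntegral.integral_hasDerivAt_right (hkc.intervalIntegrable _ _)
      (hkc.stronglyMeasurableAtFilter _ _) hkc.continuousAt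
  have hSc : Continuous S := continuous_iff_continuousAt.2 fun s => (hSd s).continuousAt
  have hSm : StrictMono S := strictMono_of_deriv_pos fun s => by rw [(hSd s).deriv]; exact hk0 s
  have hS0 : S 0 = 0 := by simp [hS]
  set Ψ : ℝ → ℝ := fun s => ∫ x in (0 : ℝ)..s, S x with hΨ
  have hΨd : ∀ s, HasDerivAt Ψ (S s) s := fun s =>
    intervalIntegral.integral_hasDerivAt_right (hSc.intervalIntegrable _ _)
      (hSc.stronglyMeasurableAtFilter _ _) hSc.continuousAt
  have hΨ0 : Ψ 0 = 0 := by simp [hΨ]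
  have hconv : ∀ a b, Ψ a - Ψ b ≤ (a - b) * S a := by
    intro a b
    have e : Ψ a - Ψ b = ∫ x in b..a, S x :=
      intervalIntegral.integral_interval_sub_left (hSc.intervalIntegrable _ _)
        (hSc.intervalIntegrable _ _)
    rw [e]
    rcases le_total b a with hab | hab
    · have := intervalIntegral.integral_mono_on hab (hSc.intervalIntegrable _ _)
        (continuous_const.intervalIntegrable (μ := volume) _ _) (g := fun _ => S a)
        (fun x hx => hSm.monotone hx.2)
      simpa using this
    · have := intervalIntegral.integral_mono_on hab
        (continuous_const.intervalIntegrable (μ := volume) _ _) (hSc.intervalIntegrable _ _)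
        (f := fun _ => S a) (fun x hx => hSm.monotone hx.1)
      rw [intervalIntegral.integral_symm]
      simp only [intervalIntegral.integral_const, smul_eq_mul] at this
      linarith
  have hΨn : ∀ s, 0 ≤ Ψ s := fun s => by
    have := hconv 0 s
    rw [hΨ0, hS0] at this
    linarith
  set A : ℝ := (∫ x, k x) + 1 with hA
  have hI : 0 ≤ ∫ x, k x := integral_nonneg fun x => (hk0 x).le
  have hSA : ∀ s, |S s| ≤ A := by
    intro s
    have h1 : ‖S s‖ ≤ ∫ x in Set.uIoc 0 s, ‖k x‖ :=
      intervalIntegral.norm_integral_le_integral_norm_uIoc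
    have h2 : ∫ x in Set.uIoc 0 s, ‖k x‖ ≤ ∫ x, ‖k x‖ :=
      setIntegral_le_integral (integrable_jb_rpow hα).norm
        (Eventually.of_forall fun x => norm_nonneg _)
    have h3 : ∫ x, ‖k x‖ = ∫ x, k x :=
      integral_congr_ae (Eventually.of_forall fun x => Real.norm_of_nonneg (hk0 x).le)
    rw [Real.norm_eq_abs] at h1
    linarith
  have hS1 : 0 < S 1 := by rw [← hS0]; exact hSm one_pos
  have hSn1 : S (-1) < 0 := by rw [← hS0]; exact hSm (by norm_num)
  refine ⟨S, Ψ, A, min (S 1) (-S (-1)), by linarith, lt_min hS1 (by linarith), hSd, hSA,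
    continuous_iff_continuousAt.2 fun s => (hΨd s).continuousAt, hconv, hΨn, ?_, ?_⟩
  · intro s
    have h1 := hconv s 0
    rw [hΨ0, sub_zero, sub_zero] at h1
    calc Ψ s ≤ |s * S s| := h1.trans (le_abs_self _)
      _ = |S s| * |s| := by rw [abs_mul, mul_comm]
      _ ≤ A * |s| := by gcongr; exact hSA s
  · intro s
    rcases le_total |s| 1 with h | h
    · have : 0 < min (S 1) (-S (-1)) := lt_min hS1 (by linarith)
      nlinarith [hΨn s]
    · rcases le_total 0 s with hs | hs
      · rw [abs_of_nonneg hs] at h ⊢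
        have h1 := hconv 1 s
        have h2 := hΨn 1
        nlinarith [min_le_left (S 1) (-S (-1))]
      · rw [abs_of_nonpos hs] at h ⊢
        have h1 := hconv (-1) s
        have h2 := hΨn (-1)
        nlinarith [min_le_right (S 1) (-S (-1))]

theorem enorm_integral_inner_le {N : ℕ} {Ω : Set (Space N)} {F H : Space N → Space N}
    (hF : AEStronglyMeasurable F (volume.restrict Ω))
    (hH : AEStronglyMeasurable H (volume.restrict Ω)) {k : Space N → ℝ} (hk : ∀ x, |k x| ≤ 1) :
    ‖∫ x in Ω, k x * inner ℝ (F x) (H x)‖ₑ ≤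
      eLpNorm F 2 (volume.restrict Ω) * eLpNorm H 2 (volume.restrict Ω) := by
  refine (enorm_integral_le_lintegral_enorm _).trans ?_
  calc ∫⁻ x in Ω, ‖k x * inner ℝ (F x) (H x)‖ₑ ≤ ∫⁻ x in Ω, ‖F x‖ₑ * ‖H x‖ₑ := by
        refine lintegral_mono fun x => ?_
        rw [← ofReal_norm, ← ofReal_norm, ← ofReal_norm, ← ENNReal.ofReal_mul (norm_nonneg _)]
        refine ENNReal.ofReal_le_ofReal ?_
        rw [norm_mul]
        exact (mul_le_of_le_one_left (norm_nonneg _) (hk x)).trans (norm_inner_le_norm _ _)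
    _ ≤ _ := by
        have := ENNReal.lintegral_mul_le_Lp_mul_Lq (volume.restrict Ω)
          (Real.holderConjugate_iff.2 ⟨one_lt_two, by norm_num⟩ : Real.HolderConjugate 2 2)
          hF.enorm hH.enorm
        rw [eLpNorm_eq_lintegral_rpow_enorm_toReal two_ne_zero (by simp),
          eLpNorm_eq_lintegral_rpow_enorm_toReal two_ne_zero (by simp)]
        simpa using this

/-- The resolvent equation may be tested with `S(u)` for a bounded nondecreasing Lipschitz `S`. -/
theorem resolvent_test_comp {N : ℕ} {Ω : Set (Space N)} (hbd : Bornology.IsBounded Ω) {h : ℝ}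
    {u g : Space N → ℝ} {G : Space N → Space N} (huG : HasStrongGradient Ω u G)
    (hg : MemLp g 2 (volume.restrict Ω))
    (heq : ∀ φ : Space N → ℝ, ContDiff ℝ 1 φ →
        (∫ x in Ω, u x * φ x) + h * ∫ x in Ω, inner ℝ (G x) (gradient φ x) = ∫ x in Ω, g x * φ x)
    {S k : ℝ → ℝ} {A : ℝ} (hS : ∀ s, HasDerivAt S (k s) s) (hkc : Continuous k)
    (hk : ∀ s, |k s| ≤ 1) (hSA : ∀ s, |S s| ≤ A) :
    (∫ x in Ω, u x * S (u x)) + h * ∫ x in Ω, k (u x) * ‖G x‖ ^ 2 = ∫ x in Ω, g x * S (u x) := by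
  have hvol : IsFiniteMeasure (volume.restrict Ω) :=
    ⟨by rw [Measure.restrict_apply_univ]; exact hbd.measure_lt_top⟩
  obtain ⟨hu, hG, φ, hφ, hφu, hφG, hae⟩ := huG
  have hSc : Continuous S := continuous_iff_continuousAt.2 fun s => (hS s).continuousAt
  have hS1 : ContDiff ℝ 1 S := by
    rw [contDiff_one_iff_deriv]
    refine ⟨fun s => (hS s).differentiableAt, ?_⟩
    rwa [show deriv S = k from funext fun s => (hS s).deriv]
  have lim : ∀ v : Space N → ℝ, MemLp v 2 (volume.restrict Ω) →
      Tendsto (fun n => ∫ x in Ω, v x * S (φ n x)) atTop (𝓝 (∫ x in Ω, v x * S (u x))) := by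
    intro v hv
    refine tendsto_integral_of_dominated_convergence (fun x => A * |v x|) ?_ ?_ ?_ ?_
    · intro n
      exact hv.aestronglyMeasurable.mul (hSc.comp (hφ n).continuous).aestronglyMeasurable
    · exact (hv.integrable one_le_two).abs.const_mul A
    · intro n
      refine Eventually.of_forall fun x => ?_
      rw [norm_mul, mul_comm, Real.norm_eq_abs, Real.norm_eq_abs]
      gcongr
      exact hSA _
    · filter_upwards [hae] with x hx
      exact ((hSc.tendsto _).comp hx).const_mul _
  have hgm : ∀ n, AEStronglyMeasurable (gradient (φ n) - G) (volume.restrict Ω) := fun n =>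
    (continuous_gradient (hφ n)).aestronglyMeasurable.sub hG.aestronglyMeasurable
  have hG2 : Integrable (fun x => ‖G x‖ ^ 2) (volume.restrict Ω) :=
    (memLp_two_iff_integrable_sq_norm hG.aestronglyMeasurable).1 hG
  have lim1 : Tendsto (fun n => ∫ x in Ω, k (φ n x) * ‖G x‖ ^ 2) atTop
      (𝓝 (∫ x in Ω, k (u x) * ‖G x‖ ^ 2)) := by
    refine tendsto_integral_of_dominated_convergence (fun x => ‖G x‖ ^ 2) ?_ hG2 ?_ ?_
    · intro n
      exact (hkc.comp (hφ n).continuous).aestronglyMeasurable.mul hG2.aestronglyMeasurable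
    · intro n
      refine Eventually.of_forall fun x => ?_
      rw [norm_mul, Real.norm_of_nonneg (by positivity : 0 ≤ ‖G x‖ ^ 2)]
      exact mul_le_of_le_one_left (by positivity) (hk _)
    · filter_upwards [hae] with x hx
      exact ((hkc.tendsto _).comp hx).mul_const _
  have lim2 : Tendsto (fun n => ∫ x in Ω, k (φ n x) * inner ℝ (G x) ((gradient (φ n) - G) x))
      atTop (𝓝 0) := by
    rw [tendsto_zero_iff_enorm_tendsto_zero]
    refine tendsto_of_tendsto_of_tendsto_of_le_of_le tendsto_const_nhds
      (h := fun n => eLpNorm G 2 (volume.restrict Ω) *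
        eLpNorm (gradient (φ n) - G) 2 (volume.restrict Ω)) ?_ (fun n => zero_le) fun n => ?_
    · simpa using ENNReal.Tendsto.const_mul hφG (Or.inr hG.eLpNorm_lt_top.ne)
    · exact enorm_integral_inner_le hG.aestronglyMeasurable (hgm n) fun x => hk _
  have hsplit : ∀ n, ∫ x in Ω, inner ℝ (G x) (gradient (fun y => S (φ n y)) x) =
      (∫ x in Ω, k (φ n x) * ‖G x‖ ^ 2) +
        ∫ x in Ω, k (φ n x) * inner ℝ (G x) ((gradient (φ n) - G) x) := by
    intro n
    have hkm : AEStronglyMeasurable (fun x => k (φ n x)) (volume.restrict Ω) :=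
      (hkc.comp (hφ n).continuous).aestronglyMeasurable
    rw [← integral_add]
    · refine integral_congr_ae (Eventually.of_forall fun x => ?_)
      dsimp only
      rw [gradient_comp (hφ n) hS, inner_smul_right, Pi.sub_apply, inner_sub_right,
        real_inner_self_eq_norm_sq]
      ring
    · exact hG2.bdd_mul hkm (Eventually.of_forall fun x => hk _)
    · have hgmem : MemLp (gradient (φ n) - G) 2 (volume.restrict Ω) :=
        (memLp_of_continuous hbd (continuous_gradient (hφ n)) 2).sub hG
      have : Integrable (fun x => inner ℝ (G x) ((gradient (φ n) - G) x)) (volume.restrict Ω) := by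
        refine (hG.norm.integrable_mul hgmem.norm).mono'
          (hG.aestronglyMeasurable.inner hgmem.aestronglyMeasurable)
          (Eventually.of_forall fun x => ?_)
        exact norm_inner_le_norm _ _
      exact this.bdd_mul hkm (Eventually.of_forall fun x => hk _)
  have key : ∀ n, (∫ x in Ω, u x * S (φ n x)) + h * ((∫ x in Ω, k (φ n x) * ‖G x‖ ^ 2) +
      ∫ x in Ω, k (φ n x) * inner ℝ (G x) ((gradient (φ n) - G) x)) =
      ∫ x in Ω, g x * S (φ n x) := by
    intro n
    rw [← hsplit]
    exact heq _ (hS1.comp (hφ n))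
  have hl := (lim u hu).add ((lim1.add lim2).const_mul h)
  rw [add_zero] at hl
  exact tendsto_nhds_unique hl ((lim g hg).congr fun n => (key n).symm)

/-! ### Implicit time discretization -/

/-- `(u n, G n)` solves the implicit Euler scheme with step `h` for the Neumann heat equation with
the source `f n` on the step from `n` to `n + 1`. The value `G 0` plays no role. -/
structure IsRothe {N : ℕ} (Ω : Set (Space N)) (h : ℝ) (f : ℕ → Space N → ℝ)
    (u : ℕ → Space N → ℝ) (G : ℕ → Space N → Space N) : Prop where
  stronglyMeasurable_fun : ∀ n, StronglyMeasurable (u n)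
  stronglyMeasurable_grad : ∀ n, StronglyMeasurable (G n)
  memLp_fun : ∀ n, MemLp (u n) 2 (volume.restrict Ω)
  memLp_source : ∀ n, MemLp (f n) 2 (volume.restrict Ω)
  hasStrongGradient : ∀ n, HasStrongGradient Ω (u (n + 1)) (G (n + 1))
  integral_eq : ∀ n, ∀ φ : Space N → ℝ, ContDiff ℝ 1 φ →
    (∫ x in Ω, u (n + 1) x * φ x) + h * ∫ x in Ω, inner ℝ (G (n + 1) x) (gradient φ x) =
      ∫ x in Ω, (u n x + h * f n x) * φ x

theorem exists_isRothe {N : ℕ} {Ω : Set (Space N)} (hbd : Bornology.IsBounded Ω) {h : ℝ}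
    (hh : 0 < h) {f : ℕ → Space N → ℝ} (hf : ∀ n, MemLp (f n) 2 (volume.restrict Ω))
    {u₀ : Space N → ℝ} (hu₀ : StronglyMeasurable u₀) (hu₀' : MemLp u₀ 2 (volume.restrict Ω)) :
    ∃ u G, u 0 = u₀ ∧ IsRothe Ω h f u G := by
  let P := {p : (Space N → ℝ) × (Space N → Space N) //
    StronglyMeasurable p.1 ∧ StronglyMeasurable p.2 ∧ MemLp p.1 2 (volume.restrict Ω)}
  have step : ∀ (n : ℕ) (p : P), ∃ p' : P, HasStrongGradient Ω p'.1.1 p'.1.2 ∧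
      ∀ φ : Space N → ℝ, ContDiff ℝ 1 φ →
        (∫ x in Ω, p'.1.1 x * φ x) + h * ∫ x in Ω, inner ℝ (p'.1.2 x) (gradient φ x) =
          ∫ x in Ω, (p.1.1 x + h * f n x) * φ x := by
    intro n p
    obtain ⟨u, G, hu, hG, huG, heq⟩ := exists_resolvent hbd hh (p.2.2.2.add ((hf n).const_mul h))
    exact ⟨⟨(u, G), hu, hG, huG.memLp_fun⟩, huG, heq⟩
  choose next hnext using step
  let s : ℕ → P := fun n => Nat.rec ⟨(u₀, 0), hu₀, stronglyMeasurable_zero, hu₀'⟩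
    (fun n p => next n p) n
  exact ⟨fun n => (s n).1.1, fun n => (s n).1.2, rfl,
    fun n => (s n).2.1, fun n => (s n).2.2.1, fun n => (s n).2.2.2, hf,
    fun n => (hnext n (s n)).1, fun n => (hnext n (s n)).2⟩

theorem integrable_weighted_energy {N : ℕ} {Ω : Set (Space N)} {u : Space N → ℝ}
    {G : Space N → Space N} (hu : MemLp u 2 (volume.restrict Ω))
    (hG : MemLp G 2 (volume.restrict Ω)) {α : ℝ} (hα : 0 < α) :
    IntegrableOn (fun x => jb (u x) ^ (-(1 + α)) * ‖G x‖ ^ 2) Ω := by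
  have hG2 : Integrable (fun x => ‖G x‖ ^ 2) (volume.restrict Ω) :=
    (memLp_two_iff_integrable_sq_norm hG.aestronglyMeasurable).1 hG
  refine hG2.bdd_mul (c := 1) ?_ (Eventually.of_forall fun x => ?_)
  · exact (continuous_jb_rpow _).comp_aestronglyMeasurable hu.aestronglyMeasurable
  · rw [Real.norm_of_nonneg (Real.rpow_nonneg (jb_pos _).le _)]
    exact jb_rpow_neg_le_one (by linarith) _

theorem weighted_energy_nonneg {N : ℕ} {Ω : Set (Space N)} (u : Space N → ℝ)
    (G : Space N → Space N) (α : ℝ) : 0 ≤ ∫ x in Ω, jb (u x) ^ (-(1 + α)) * ‖G x‖ ^ 2 :=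
  integral_nonneg fun x => mul_nonneg (Real.rpow_nonneg (jb_pos _).le _) (by positivity)

/-- Testing the scheme with `S(u)` and summing gives the `L^∞(L¹)` bound and the weighted energy
bound in terms of the `L¹` norms of the data. -/
theorem IsRothe.energy {N : ℕ} {Ω : Set (Space N)} (hbd : Bornology.IsBounded Ω) {h : ℝ}
    (hh : 0 < h) {f u : ℕ → Space N → ℝ} {G : ℕ → Space N → Space N} (H : IsRothe Ω h f u G)
    {α : ℝ} (hα : 0 < α) {S Ψ : ℝ → ℝ} {A : ℝ}
    (hS : ∀ s, HasDerivAt S (jb s ^ (-(1 + α))) s) (hSA : ∀ s, |S s| ≤ A) (hΨc : Continuous Ψ)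
    (hΨ : ∀ a b, Ψ a - Ψ b ≤ (a - b) * S a) (hΨ0 : ∀ s, 0 ≤ Ψ s) (hΨA : ∀ s, Ψ s ≤ A * |s|)
    (n : ℕ) :
    (∫ x in Ω, Ψ (u n x)) + ∑ j ∈ Finset.range n,
        h * ∫ x in Ω, jb (u (j + 1) x) ^ (-(1 + α)) * ‖G (j + 1) x‖ ^ 2 ≤
      A * ((∫ x in Ω, |u 0 x|) + ∑ j ∈ Finset.range n, h * ∫ x in Ω, |f j x|) := by
  have hvol : IsFiniteMeasure (volume.restrict Ω) :=
    ⟨by rw [Measure.restrict_apply_univ]; exact hbd.measure_lt_top⟩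
  have hui : ∀ n, Integrable (u n) (volume.restrict Ω) := fun n =>
    (H.memLp_fun n).integrable one_le_two
  have hfi : ∀ n, Integrable (f n) (volume.restrict Ω) := fun n =>
    (H.memLp_source n).integrable one_le_two
  have hΨi : ∀ n, Integrable (fun x => Ψ (u n x)) (volume.restrict Ω) := fun n => by
    refine ((hui n).abs.const_mul A).mono'
      (hΨc.comp_aestronglyMeasurable (hui n).aestronglyMeasurable)
      (Eventually.of_forall fun x => ?_)
    rw [Real.norm_of_nonneg (hΨ0 _)]
    exact hΨA _
  have hSc : Continuous S := continuous_iff_continuousAt.2 fun s => (hS s).continuousAt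
  induction n with
  | zero =>
    simp only [Finset.range_zero, Finset.sum_empty, add_zero]
    rw [← integral_const_mul]
    exact integral_mono (hΨi 0) ((hui 0).abs.const_mul A) fun x => hΨA _
  | succ n ih =>
    rw [Finset.sum_range_succ, Finset.sum_range_succ]
    have htest := resolvent_test_comp hbd (H.hasStrongGradient n)
      ((H.memLp_fun n).add ((H.memLp_source n).const_mul h)) (H.integral_eq n) hS
      (continuous_jb_rpow _)
      (fun s => by
        rw [abs_of_nonneg (Real.rpow_nonneg (jb_pos _).le _)]
        exact jb_rpow_neg_le_one (by linarith) s) hSA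
    have hSm : AEStronglyMeasurable (fun x => S (u (n + 1) x)) (volume.restrict Ω) :=
      hSc.comp_aestronglyMeasurable (hui (n + 1)).aestronglyMeasurable
    have hmul : ∀ {v : Space N → ℝ}, Integrable v (volume.restrict Ω) →
        Integrable (fun x => v x * S (u (n + 1) x)) (volume.restrict Ω) := fun hv =>
      hv.mul_bdd (c := A) hSm (Eventually.of_forall fun x => hSA _)
    have hsplit : ∫ x in Ω, (u n + fun x => h * f n x) x * S (u (n + 1) x) =
        (∫ x in Ω, u n x * S (u (n + 1) x)) + h * ∫ x in Ω, f n x * S (u (n + 1) x) := by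
      rw [← integral_const_mul, ← integral_add (hmul (hui n)) ((hmul (hfi n)).const_mul h)]
      refine integral_congr_ae (Eventually.of_forall fun x => ?_)
      simp only [Pi.add_apply]; ring
    rw [hsplit] at htest
    have h1 : (∫ x in Ω, Ψ (u (n + 1) x)) - ∫ x in Ω, Ψ (u n x) ≤
        (∫ x in Ω, u (n + 1) x * S (u (n + 1) x)) - ∫ x in Ω, u n x * S (u (n + 1) x) := by
      rw [← integral_sub (hΨi _) (hΨi _), ← integral_sub (hmul (hui _)) (hmul (hui _))]
      refine integral_mono ((hΨi _).sub (hΨi _)) ((hmul (hui _)).sub (hmul (hui _))) fun x => ?_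
      have := hΨ (u (n + 1) x) (u n x)
      dsimp only
      linarith
    have h2 : ∫ x in Ω, f n x * S (u (n + 1) x) ≤ A * ∫ x in Ω, |f n x| := by
      rw [← integral_const_mul]
      refine integral_mono (hmul (hfi n)) ((hfi n).abs.const_mul A) fun x => ?_
      refine (le_abs_self _).trans ?_
      rw [abs_mul, mul_comm]
      gcongr
      exact hSA _
    have h3 : h * ∫ x in Ω, f n x * S (u (n + 1) x) ≤ h * (A * ∫ x in Ω, |f n x|) := by gcongr
    linarith

/-- The admissible range of `q` leaves room for a positive `α`. -/
theorem exists_alpha {N : ℕ} (hN : 1 ≤ N) {q : ℝ} (hq1 : 1 ≤ q)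
    (hq : q < (2 * ((N : ℝ) + 1) - N) / (N + 1)) :
    q < 2 ∧ ∃ α : ℝ, 0 < α ∧ α < 1 ∧ (1 + α) * (q / (2 - q)) ≤ 1 + 2 / N - α := by
  have hN0 : (0 : ℝ) < N := by exact_mod_cast hN
  rw [lt_div_iff₀ (by positivity)] at hq
  have hq2 : q < 2 := by nlinarith
  have h2q : 0 < 2 - q := by linarith
  set δ : ℝ := (1 + 2 / N) * (2 - q) - q with hδ
  have hδ0 : 0 < δ := by
    have : δ = (N * (2 - q) + 2 * (2 - q) - q * N) / N := by rw [hδ]; field_simp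
    rw [this]
    refine div_pos ?_ hN0
    linarith
  refine ⟨hq2, min (1 / 2) (δ / 2), by positivity,
    (min_le_left _ _).trans_lt (by norm_num), ?_⟩
  set α := min (1 / 2) (δ / 2)
  have hα : α ≤ δ / 2 := min_le_right _ _
  rw [← mul_div_assoc, div_le_iff₀ h2q]
  have : (1 + 2 / N - α) * (2 - q) = δ + q - α * (2 - q) := by rw [hδ]; ring
  rw [this]
  linarith

/-- Young's inequality: the gradient is controlled by the weighted energy density and a power. -/
theorem rpow_le_weighted_energy {q α r J d : ℝ} (hq1 : 1 ≤ q) (hq2 : q < 2)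
    (hr : (1 + α) * (q / (2 - q)) ≤ r) (hJ : 1 ≤ J) (hd : 0 ≤ d) :
    d ^ q ≤ J ^ (-(1 + α)) * d ^ 2 + J ^ r := by
  have hJ0 : 0 < J := by linarith
  have h2q : 0 < 2 - q := by linarith
  set k := J ^ (-(1 + α)) with hk
  have hk0 : 0 < k := Real.rpow_pos_of_pos hJ0 _
  have hy : J ^ ((1 + α) * (q / (2 - q))) = k ^ (-(q / (2 - q))) := by
    rw [hk, ← Real.rpow_mul hJ0.le]; congr 1; ring
  have e : d ^ q = (k * d ^ 2) ^ (q / 2) * (k ^ (-(q / (2 - q)))) ^ ((2 - q) / 2) := by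
    rw [Real.mul_rpow hk0.le (by positivity), ← Real.rpow_mul hk0.le, ← Real.rpow_natCast d 2,
      ← Real.rpow_mul hd, mul_right_comm, ← Real.rpow_add hk0]
    have h1 : q / 2 + -(q / (2 - q)) * ((2 - q) / 2) = 0 := by field_simp; ring
    have h2 : ((2 : ℕ) : ℝ) * (q / 2) = q := by push_cast; ring
    rw [h1, h2, Real.rpow_zero, one_mul]
  have h1 := Real.geom_mean_le_arith_mean2_weighted (w₁ := q / 2) (w₂ := (2 - q) / 2)
    (p₁ := k * d ^ 2) (p₂ := k ^ (-(q / (2 - q)))) (by linarith) (by linarith) (by positivity)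
    (by positivity) (by ring)
  rw [← e, ← hy] at h1
  have h2 : J ^ ((1 + α) * (q / (2 - q))) ≤ J ^ r := Real.rpow_le_rpow_of_exponent_le hJ hr
  have h3 : 0 ≤ k * d ^ 2 := by positivity
  have h4 : 0 ≤ J ^ ((1 + α) * (q / (2 - q))) := by positivity
  nlinarith

/-- The a priori bound in `L^q(W^{1,q})` for the scheme; the constant depends on the data only
through a bound for their `L¹` norms. -/
theorem exists_rothe_bound {N : ℕ} (hN : 1 ≤ N) {Ω : Set (Space N)} (hΩ : IsOpen Ω)
    (hbd : Bornology.IsBounded Ω) (hC : HasC1Boundary Ω) {q : ℝ} (hq1 : 1 ≤ q)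
    (hq : q < (2 * ((N : ℝ) + 1) - N) / (N + 1)) (T D : ℝ) :
    ∃ K : ℝ≥0∞, K ≠ ⊤ ∧ ∀ (h : ℝ) (m : ℕ) (f u : ℕ → Space N → ℝ) (G : ℕ → Space N → Space N),
      0 < h → m * h = T → IsRothe Ω h f u G →
      (∫ x in Ω, |u 0 x|) + ∑ j ∈ Finset.range m, h * ∫ x in Ω, |f j x| ≤ D →
      ∑ j ∈ Finset.range m, ENNReal.ofReal h *
        ∫⁻ x in Ω, (‖u (j + 1) x‖ₑ ^ q + ‖G (j + 1) x‖ₑ ^ q) ≤ K := by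
  obtain ⟨hq2, α, hα0, hα1, hα⟩ := exists_alpha hN hq1 hq
  obtain ⟨S, Ψ, A, c, hA, hc, hS, hSA, hΨc, hΨ, hΨ0, hΨA, hΨl⟩ := exists_renormalization hα0
  have hvol : IsFiniteMeasure (volume.restrict Ω) :=
    ⟨by rw [Measure.restrict_apply_univ]; exact hbd.measure_lt_top⟩
  obtain ⟨K, hKt, hK⟩ := nonlinear_gagliardo hN hΩ hbd hC hα0 hα1
    (M := ENNReal.ofReal (2 * (volume.restrict Ω).real univ + A * D / c)) ENNReal.ofReal_ne_top
  refine ⟨(2 * K + 1) * (ENNReal.ofReal T + ENNReal.ofReal (A * D)), by finiteness, ?_⟩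
  intro h m f u G hh hmT H hD
  set r : ℝ := 1 + 2 / N - α with hr
  have hui : ∀ n, Integrable (u n) (volume.restrict Ω) := fun n =>
    (H.memLp_fun n).integrable one_le_two
  set E : ℕ → ℝ := fun j => ∫ x in Ω, jb (u j x) ^ (-(1 + α)) * ‖G j x‖ ^ 2 with hE
  have hE0 : ∀ j, 0 ≤ E j := fun j => weighted_energy_nonneg _ _ _
  have henergy : ∀ n ≤ m, (∫ x in Ω, Ψ (u n x)) + ∑ j ∈ Finset.range n, h * E (j + 1) ≤
      A * D := by
    intro n hn
    refine (H.energy hbd hh hα0 hS hSA hΨc hΨ hΨ0 hΨA n).trans ?_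
    refine mul_le_mul_of_nonneg_left (le_trans ?_ hD) hA.le
    gcongr
  have hΨint0 : ∀ n, 0 ≤ ∫ x in Ω, Ψ (u n x) := fun n => integral_nonneg fun x => hΨ0 _
  have hM : ∀ n ≤ m, ∫⁻ x in Ω, ENNReal.ofReal (jb (u n x)) ≤
      ENNReal.ofReal (2 * (volume.restrict Ω).real univ + A * D / c) := by
    intro n hn
    have hΨi : Integrable (fun x => Ψ (u n x)) (volume.restrict Ω) := by
      refine ((hui n).abs.const_mul A).mono'
        (hΨc.comp_aestronglyMeasurable (hui n).aestronglyMeasurable)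
        (Eventually.of_forall fun x => ?_)
      rw [Real.norm_of_nonneg (hΨ0 _)]
      exact hΨA _
    have hi : Integrable (fun x => 2 + Ψ (u n x) / c) (volume.restrict Ω) :=
      (integrable_const _).add (hΨi.div_const c)
    calc ∫⁻ x in Ω, ENNReal.ofReal (jb (u n x)) ≤ ∫⁻ x in Ω, ENNReal.ofReal (2 + Ψ (u n x) / c) := by
          refine lintegral_mono fun x => ENNReal.ofReal_le_ofReal ?_
          have h1 : |u n x| - 1 ≤ Ψ (u n x) / c := by
            rw [le_div_iff₀ hc, mul_comm]; exact hΨl _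
          linarith [jb_le_one_add_abs (u n x)]
      _ = ENNReal.ofReal (∫ x in Ω, (2 + Ψ (u n x) / c)) := by
          refine (ofReal_integral_eq_lintegral_ofReal hi (Eventually.of_forall fun x => ?_)).symm
          have := hΨ0 (u n x)
          change (0 : ℝ) ≤ 2 + Ψ (u n x) / c
          positivity
      _ ≤ _ := by
          refine ENNReal.ofReal_le_ofReal ?_
          rw [integral_add (integrable_const _) (hΨi.div_const c), integral_const,
            integral_div, smul_eq_mul, mul_comm]
          gcongr
          have h1 := henergy n hn
          have h2 : 0 ≤ ∑ j ∈ Finset.range n, h * E (j + 1) :=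
            Finset.sum_nonneg fun j _ => mul_nonneg hh.le (hE0 _)
          linarith
  have hstep : ∀ j < m, ∫⁻ x in Ω, (‖u (j + 1) x‖ₑ ^ q + ‖G (j + 1) x‖ₑ ^ q) ≤
      (2 * K + 1) * (1 + ENNReal.ofReal (E (j + 1))) := by
    intro j hj
    have hsg := H.hasStrongGradient j
    have hX := hK _ _ hsg (hM (j + 1) hj)
    have hEe : ENNReal.ofReal (E (j + 1)) =
        ∫⁻ x in Ω, ENNReal.ofReal (jb (u (j + 1) x) ^ (-(1 + α)) * ‖G (j + 1) x‖ ^ 2) :=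
      ofReal_integral_eq_lintegral_ofReal
        (integrable_weighted_energy hsg.memLp_fun hsg.memLp_grad hα0)
        (Eventually.of_forall fun x =>
          mul_nonneg (Real.rpow_nonneg (jb_pos _).le _) (by positivity))
    rw [← hEe] at hX
    calc ∫⁻ x in Ω, (‖u (j + 1) x‖ₑ ^ q + ‖G (j + 1) x‖ₑ ^ q)
        ≤ ∫⁻ x in Ω, (2 * ENNReal.ofReal (jb (u (j + 1) x) ^ r) +
            ENNReal.ofReal (jb (u (j + 1) x) ^ (-(1 + α)) * ‖G (j + 1) x‖ ^ 2)) := by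
          refine lintegral_mono fun x => ?_
          have hJ1 := one_le_jb (u (j + 1) x)
          have hJ0 := jb_pos (u (j + 1) x)
          rw [← ofReal_norm, ← ofReal_norm, ENNReal.ofReal_rpow_of_nonneg (norm_nonneg _)
            (by linarith), ENNReal.ofReal_rpow_of_nonneg (norm_nonneg _) (by linarith),
            ← ENNReal.ofReal_add (by positivity) (by positivity), two_mul,
            ← ENNReal.ofReal_add (by positivity) (by positivity),
            ← ENNReal.ofReal_add (by positivity) (by positivity)]
          refine ENNReal.ofReal_le_ofReal ?_
          have h1 := rpow_le_weighted_energy hq1 hq2 hα hJ1 (norm_nonneg (G (j + 1) x))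
          have h2 : ‖u (j + 1) x‖ ^ q ≤ jb (u (j + 1) x) ^ r := by
            calc ‖u (j + 1) x‖ ^ q ≤ jb (u (j + 1) x) ^ q := by
                  gcongr; exact abs_le_jb _
              _ ≤ jb (u (j + 1) x) ^ r := by
                  refine Real.rpow_le_rpow_of_exponent_le hJ1 (le_trans ?_ hα)
                  have h2q : 0 < 2 - q := by linarith
                  rw [← mul_div_assoc, le_div_iff₀ h2q]
                  nlinarith
          linarith
      _ = 2 * (∫⁻ x in Ω, ENNReal.ofReal (jb (u (j + 1) x) ^ r)) + ENNReal.ofReal (E (j + 1)) := by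
          have hm : AEMeasurable (fun x => 2 * ENNReal.ofReal (jb (u (j + 1) x) ^ r))
              (volume.restrict Ω) :=
            (((continuous_jb_rpow r).measurable.comp_aemeasurable
              (hui (j + 1)).aestronglyMeasurable.aemeasurable).ennreal_ofReal).const_mul 2
          rw [lintegral_add_left' hm, lintegral_const_mul' _ _ (by simp), hEe]
      _ ≤ 2 * (K * (1 + ENNReal.ofReal (E (j + 1)))) + (1 + ENNReal.ofReal (E (j + 1))) := by
          gcongr
          exact le_add_self
      _ = _ := by ring
  calc ∑ j ∈ Finset.range m, ENNReal.ofReal h *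
        ∫⁻ x in Ω, (‖u (j + 1) x‖ₑ ^ q + ‖G (j + 1) x‖ₑ ^ q)
      ≤ ∑ j ∈ Finset.range m, (2 * K + 1) * ENNReal.ofReal (h + h * E (j + 1)) := by
        refine Finset.sum_le_sum fun j hj => ?_
        have e : ENNReal.ofReal (h + h * E (j + 1)) =
            ENNReal.ofReal h * (1 + ENNReal.ofReal (E (j + 1))) := by
          rw [← ENNReal.ofReal_one, ← ENNReal.ofReal_add zero_le_one (hE0 _),
            ← ENNReal.ofReal_mul hh.le, mul_add, mul_one]
        rw [e, mul_left_comm]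
        exact mul_le_mul' le_rfl (hstep j (Finset.mem_range.1 hj))
    _ = (2 * K + 1) * ENNReal.ofReal (∑ j ∈ Finset.range m, (h + h * E (j + 1))) := by
        rw [← Finset.mul_sum, ENNReal.ofReal_sum_of_nonneg]
        exact fun j _ => add_nonneg hh.le (mul_nonneg hh.le (hE0 _))
    _ ≤ _ := by
        gcongr
        rw [Finset.sum_add_distrib, Finset.sum_const, Finset.card_range, nsmul_eq_mul, hmT]
        refine ENNReal.ofReal_add_le.trans ?_
        gcongr
        have := henergy m le_rfl
        linarith [hΨint0 m]

/-! ### Weak compactness in `L^q` -/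

/-- Bounded sequences in a Hilbert space converge weakly along every ultrafilter. -/
theorem exists_weak_limit_hilbert {H : Type*} [NormedAddCommGroup H] [InnerProductSpace ℝ H]
    [CompleteSpace H] (F : Ultrafilter ℕ) {a : ℕ → H} {R : ℝ} (ha : ∀ n, ‖a n‖ ≤ R) :
    ∃ b : H, ∀ y, Tendsto (fun n => inner ℝ (a n) y) F (𝓝 (inner ℝ b y)) := by
  let j : ℕ → WeakDual ℝ H := fun n =>
    StrongDual.toWeakDual (InnerProductSpace.toDual ℝ H (a n))
  have hK := WeakDual.isCompact_closedBall (0 : StrongDual ℝ H) R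
  obtain ⟨f, -, hf⟩ := hK.ultrafilter_le_nhds' (F.map j) (by
    refine mem_map.2 (univ_mem' fun n => ?_)
    simp [j, ha n])
  refine ⟨(InnerProductSpace.toDual ℝ H).symm (WeakDual.toStrongDual f), fun y => ?_⟩
  have h1 : Tendsto (fun n => j n y) F (𝓝 (f y)) :=
    ((WeakDual.eval_continuous y).tendsto f).comp hf
  rw [InnerProductSpace.toDual_symm_apply]
  exact h1

theorem integrable_inner_of_bounded {X E : Type*} [MeasurableSpace X] {μ : Measure X}
    [NormedAddCommGroup E] [InnerProductSpace ℝ E] {f ψ : X → E} (hf : Integrable f μ)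
    (hψ : AEStronglyMeasurable ψ μ) {B : ℝ} (hB : ∀ᵐ x ∂μ, ‖ψ x‖ ≤ B) :
    Integrable (fun x => inner ℝ (f x) (ψ x)) μ := by
  refine (hf.norm.const_mul B).mono' (hf.aestronglyMeasurable.inner hψ) ?_
  filter_upwards [hB] with x hx
  refine (norm_inner_le_norm _ _).trans ?_
  rw [mul_comm]
  gcongr

theorem abs_integral_inner_le {X E : Type*} [MeasurableSpace X] {μ : Measure X}
    [NormedAddCommGroup E] [InnerProductSpace ℝ E] {f ψ : X → E} (hf : Integrable f μ) {B : ℝ}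
    (hB : ∀ᵐ x ∂μ, ‖ψ x‖ ≤ B) :
    |∫ x, inner ℝ (f x) (ψ x) ∂μ| ≤ B * ∫ x, ‖f x‖ ∂μ := by
  rw [← Real.norm_eq_abs, ← integral_const_mul]
  refine norm_integral_le_of_norm_le (hf.norm.const_mul B) ?_
  filter_upwards [hB] with x hx
  refine (norm_inner_le_norm _ _).trans ?_
  rw [mul_comm]
  gcongr

/-- The tail of a function above the level `R` is small in `L¹` when its `L^q` norm is bounded. -/
theorem norm_sub_indicator_le {X E : Type*} [NormedAddCommGroup E] {q : ℝ} (hq : 1 < q)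
    (f : X → E) {R : ℝ} (hR : 0 < R) (x : X) :
    ‖f x - {y | ‖f y‖ ≤ R}.indicator f x‖ ≤ R ^ (1 - q) * ‖f x‖ ^ q := by
  by_cases hx : ‖f x‖ ≤ R
  · rw [indicator_of_mem (by exact hx), sub_self, norm_zero]
    positivity
  · have hx' : R < ‖f x‖ := not_le.1 hx
    rw [indicator_of_notMem (by exact hx), sub_zero]
    have h0 : 0 < ‖f x‖ := hR.trans hx'
    calc ‖f x‖ = ‖f x‖ ^ (1 - q) * ‖f x‖ ^ q := by
          rw [← Real.rpow_add h0]; simp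
      _ ≤ R ^ (1 - q) * ‖f x‖ ^ q := by
          gcongr ?_ * _
          exact Real.rpow_le_rpow_of_nonpos hR hx'.le (by linarith)

/-- Weak sequential compactness of bounded sets of `L^q`, `1 < q`, on a finite measure space, tested
against bounded functions. The truncations converge weakly in `L²`; as the tails are uniformly
small in `L¹`, the limits of the truncations form a Cauchy sequence in `L¹`. -/
theorem exists_weak_limit {X E : Type*} [MeasurableSpace X] {μ : Measure X} [IsFiniteMeasure μ]
    [NormedAddCommGroup E] [InnerProductSpace ℝ E] [CompleteSpace E] (F : Ultrafilter ℕ)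
    {w : ℕ → X → E} (hw : ∀ n, StronglyMeasurable (w n)) {q : ℝ} (hq : 1 < q) {C : ℝ}
    (hwi : ∀ n, Integrable (fun x => ‖w n x‖ ^ q) μ) (hwC : ∀ n, ∫ x, ‖w n x‖ ^ q ∂μ ≤ C) :
    ∃ g : X → E, MemLp g (ENNReal.ofReal q) μ ∧ ∀ ψ : X → E, AEStronglyMeasurable ψ μ →
      ∀ B : ℝ, (∀ᵐ x ∂μ, ‖ψ x‖ ≤ B) →
      Tendsto (fun n => ∫ x, inner ℝ (w n x) (ψ x) ∂μ) F (𝓝 (∫ x, inner ℝ (g x) (ψ x) ∂μ)) := by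
  have hC0 : 0 ≤ C := (integral_nonneg fun x => by positivity).trans (hwC 0)
  have hw1 : ∀ n, Integrable (w n) μ := by
    intro n
    refine ((integrable_const (1 : ℝ)).add (hwi n)).mono' (hw n).aestronglyMeasurable
      (Eventually.of_forall fun x => ?_)
    simp only [Pi.add_apply]
    rcases le_total ‖w n x‖ 1 with h | h
    · have : 0 ≤ ‖w n x‖ ^ q := by positivity
      linarith
    · have : ‖w n x‖ ^ (1 : ℝ) ≤ ‖w n x‖ ^ q := Real.rpow_le_rpow_of_exponent_le h hq.le
      rw [Real.rpow_one] at this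
      linarith
  -- The truncations at the level `k + 1` are bounded, so weak compactness in `L²` applies.
  set t : ℕ → ℕ → X → E := fun k n => {y | ‖w n y‖ ≤ (k : ℝ) + 1}.indicator (w n) with ht
  have htm : ∀ k n, StronglyMeasurable (t k n) := fun k n =>
    (hw n).indicator ((hw n).norm.measurable measurableSet_Iic)
  have htb : ∀ k n x, ‖t k n x‖ ≤ (k : ℝ) + 1 := by
    intro k n x
    by_cases hx : x ∈ {y | ‖w n y‖ ≤ (k : ℝ) + 1}
    · simp only [ht, indicator_of_mem hx]; exact hx
    · simp only [ht, indicator_of_notMem hx, norm_zero]; positivity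
  have ht2 : ∀ k n, MemLp (t k n) 2 μ := fun k n =>
    MemLp.of_bound (htm k n).aestronglyMeasurable _ (Eventually.of_forall (htb k n))
  have ht1 : ∀ k n, Integrable (t k n) μ := fun k n => (ht2 k n).integrable one_le_two
  set ε : ℕ → ℝ := fun k => ((k : ℝ) + 1) ^ (1 - q) * C with hε
  have hε0 : Tendsto ε atTop (𝓝 0) := by
    have h1 : Tendsto (fun k : ℕ => (k : ℝ) + 1) atTop atTop :=
      tendsto_atTop_add_const_right _ _ tendsto_natCast_atTop_atTop
    have h2 := (tendsto_rpow_neg_atTop (y := q - 1) (by linarith)).comp h1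
    have h3 := h2.mul_const C
    rw [zero_mul] at h3
    refine h3.congr fun k => ?_
    simp only [hε, Function.comp]
    congr 2; ring
  have hεanti : ∀ {k l}, k ≤ l → ε l ≤ ε k := by
    intro k l hkl
    simp only [hε]
    gcongr ?_ * _
    refine Real.rpow_le_rpow_of_nonpos (by positivity) ?_ (by linarith)
    have : (k : ℝ) ≤ l := by exact_mod_cast hkl
    linarith
  have htail : ∀ k n, ∫ x, ‖w n x - t k n x‖ ∂μ ≤ ε k := by
    intro k n
    calc ∫ x, ‖w n x - t k n x‖ ∂μ ≤ ∫ x, ((k : ℝ) + 1) ^ (1 - q) * ‖w n x‖ ^ q ∂μ :=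
          integral_mono ((hw1 n).sub (ht1 k n)).norm ((hwi n).const_mul _) fun x =>
            norm_sub_indicator_le hq (w n) (by positivity) x
      _ ≤ ε k := by
          rw [integral_const_mul]
          exact mul_le_mul_of_nonneg_left (hwC n) (by positivity)
  -- The truncations at each level have weak limits `g k`.
  have hweak : ∀ k, ∃ g : X → E, MemLp g 2 μ ∧ ∀ ψ : X → E, MemLp ψ 2 μ →
      Tendsto (fun n => ∫ x, inner ℝ (t k n x) (ψ x) ∂μ) F (𝓝 (∫ x, inner ℝ (g x) (ψ x) ∂μ)) := by
    intro k
    obtain ⟨b, hb⟩ := exists_weak_limit_hilbert F (a := fun n => (ht2 k n).toLp (t k n))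
      (R := measureUnivNNReal μ ^ (2 : ℝ≥0∞).toReal⁻¹ * ((k : ℝ) + 1)) (fun n => by
        refine Lp.norm_le_of_ae_bound (by positivity) ?_
        filter_upwards [(ht2 k n).coeFn_toLp] with x hx
        rw [hx]; exact htb k n x)
    refine ⟨b, Lp.memLp b, fun ψ hψ => ?_⟩
    have hb' := hb (hψ.toLp ψ)
    have e1 : ∀ n, inner ℝ ((ht2 k n).toLp (t k n)) (hψ.toLp ψ) =
        ∫ x, inner ℝ (t k n x) (ψ x) ∂μ := by
      intro n
      rw [L2.inner_def]
      refine integral_congr_ae ?_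
      filter_upwards [(ht2 k n).coeFn_toLp, hψ.coeFn_toLp] with x hx hx'
      rw [hx, hx']
    have e2 : inner ℝ b (hψ.toLp ψ) = ∫ x, inner ℝ (b x) (ψ x) ∂μ := by
      rw [L2.inner_def]
      refine integral_congr_ae ?_
      filter_upwards [hψ.coeFn_toLp] with x hx
      rw [hx]
    rw [e2] at hb'
    exact hb'.congr e1
  choose g hg2 hg using hweak
  have hg1 : ∀ k, Integrable (g k) μ := fun k => (hg2 k).integrable one_le_two
  have hbdd2 : ∀ {ψ : X → E}, AEStronglyMeasurable ψ μ → ∀ {B : ℝ}, (∀ᵐ x ∂μ, ‖ψ x‖ ≤ B) →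
      MemLp ψ 2 μ := fun hψ B hB => MemLp.of_bound hψ B hB
  -- By duality, `g k` and `g l` are as close in `L¹` as the truncations at these levels.
  have hcauchy : ∀ k l, ∫ x, ‖g k x - g l x‖ ∂μ ≤ ε k + ε l := by
    intro k l
    set d : X → E := fun x => g k x - g l x with hd
    have hdm : AEStronglyMeasurable d μ := (hg1 k).aestronglyMeasurable.sub
      (hg1 l).aestronglyMeasurable
    set ψ : X → E := fun x => ‖d x‖⁻¹ • d x with hψ
    have hψm : AEStronglyMeasurable ψ μ := by
      have : AEStronglyMeasurable (fun x => ‖d x‖⁻¹) μ :=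
        hdm.norm.aemeasurable.inv.aestronglyMeasurable
      exact this.smul hdm
    have hψ1 : ∀ x, ‖ψ x‖ ≤ 1 := by
      intro x
      rw [hψ]
      dsimp only
      rw [norm_smul, norm_inv, norm_norm]
      exact inv_mul_le_one
    have hψ2 := hbdd2 hψm (Eventually.of_forall hψ1)
    have hlim := (hg k ψ hψ2).sub (hg l ψ hψ2)
    have e : (∫ x, inner ℝ (g k x) (ψ x) ∂μ) - ∫ x, inner ℝ (g l x) (ψ x) ∂μ =
        ∫ x, ‖d x‖ ∂μ := by
      rw [← integral_sub (integrable_inner_of_bounded (hg1 k) hψm (Eventually.of_forall hψ1))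
        (integrable_inner_of_bounded (hg1 l) hψm (Eventually.of_forall hψ1))]
      refine integral_congr_ae (Eventually.of_forall fun x => ?_)
      dsimp only
      rw [← inner_sub_left]
      change inner ℝ (d x) (‖d x‖⁻¹ • d x) = _
      rw [inner_smul_right, real_inner_self_eq_norm_sq]
      by_cases h0 : ‖d x‖ = 0
      · simp [h0]
      · field_simp
    rw [e] at hlim
    refine le_of_tendsto hlim (Eventually.of_forall fun n => ?_)
    rw [← integral_sub (integrable_inner_of_bounded (ht1 k n) hψm (Eventually.of_forall hψ1))
        (integrable_inner_of_bounded (ht1 l n) hψm (Eventually.of_forall hψ1))]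
    simp_rw [← inner_sub_left]
    have hi := (ht1 k n).sub (ht1 l n)
    refine (le_abs_self _).trans ((abs_integral_inner_le (f := fun x => t k n x - t l n x) hi
      (Eventually.of_forall hψ1)).trans ?_)
    rw [one_mul]
    have hik := (hw1 n).sub (ht1 k n)
    have hil := (hw1 n).sub (ht1 l n)
    calc ∫ x, ‖t k n x - t l n x‖ ∂μ
        ≤ ∫ x, (‖w n x - t k n x‖ + ‖w n x - t l n x‖) ∂μ := by
          refine integral_mono hi.norm (hik.norm.add hil.norm) fun x => ?_
          have := norm_sub_le (w n x - t l n x) (w n x - t k n x)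
          rw [sub_sub_sub_cancel_left] at this
          linarith
      _ ≤ ε k + ε l := by
          rw [integral_add (by exact hik.norm) (by exact hil.norm)]
          exact add_le_add (htail k n) (htail l n)
  set y : ℕ → Lp E 1 μ := fun k => (memLp_one_iff_integrable.2 (hg1 k)).toLp (g k) with hy
  have hdist : ∀ k l, dist (y k) (y l) = ∫ x, ‖g k x - g l x‖ ∂μ := by
    intro k l
    rw [dist_eq_norm, hy]
    dsimp only
    rw [← MemLp.toLp_sub, L1.norm_eq_integral_norm]
    refine integral_congr_ae ?_
    filter_upwards [((memLp_one_iff_integrable.2 (hg1 k)).sub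
      (memLp_one_iff_integrable.2 (hg1 l))).coeFn_toLp] with x hx
    rw [hx]; rfl
  have hcs : CauchySeq y := by
    refine cauchySeq_of_le_tendsto_0 (fun k => ε k + ε k) (fun k l n hk hl => ?_)
      (by simpa using hε0.add hε0)
    rw [hdist]
    exact (hcauchy k l).trans (add_le_add (hεanti hk) (hεanti hl))
  obtain ⟨G, hG⟩ := cauchySeq_tendsto_of_complete hcs
  set v : X → E := ⇑G with hv
  have hv1 : Integrable v μ := L1.integrable_coeFn G
  have hgv : Tendsto (fun k => ∫ x, ‖g k x - v x‖ ∂μ) atTop (𝓝 0) := by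
    have := tendsto_iff_dist_tendsto_zero.1 hG
    refine this.congr fun k => ?_
    rw [dist_eq_norm, L1.norm_eq_integral_norm]
    refine integral_congr_ae ?_
    filter_upwards [Lp.coeFn_sub (y k) G, (memLp_one_iff_integrable.2 (hg1 k)).coeFn_toLp]
      with x hx hx'
    rw [hx, Pi.sub_apply, hx']
  have hconv : ∀ ψ : X → E, AEStronglyMeasurable ψ μ → ∀ B : ℝ, (∀ᵐ x ∂μ, ‖ψ x‖ ≤ B) →
      Tendsto (fun n => ∫ x, inner ℝ (w n x) (ψ x) ∂μ) F (𝓝 (∫ x, inner ℝ (v x) (ψ x) ∂μ)) := by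
    intro ψ hψm B hB
    have hBa : ∀ᵐ x ∂μ, ‖ψ x‖ ≤ |B| := hB.mono fun x hx => hx.trans (le_abs_self B)
    rw [Metric.tendsto_nhds]
    intro δ hδ
    have hsmall : Tendsto (fun k => |B| * ε k + |B| * ∫ x, ‖g k x - v x‖ ∂μ) atTop (𝓝 0) := by
      simpa using (hε0.const_mul |B|).add (hgv.const_mul |B|)
    obtain ⟨k, hk⟩ := (hsmall.eventually_lt_const (half_pos hδ)).exists
    filter_upwards [Metric.tendsto_nhds.1 (hg k ψ (hbdd2 hψm hBa)) (δ / 2) (half_pos hδ)] with n hn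
    rw [Real.dist_eq] at hn ⊢
    have h1 : |(∫ x, inner ℝ (w n x) (ψ x) ∂μ) - ∫ x, inner ℝ (t k n x) (ψ x) ∂μ| ≤
        |B| * ε k := by
      rw [← integral_sub (integrable_inner_of_bounded (hw1 n) hψm hBa)
        (integrable_inner_of_bounded (ht1 k n) hψm hBa)]
      simp_rw [← inner_sub_left]
      refine (abs_integral_inner_le (f := fun x => w n x - t k n x)
        ((hw1 n).sub (ht1 k n)) hBa).trans ?_
      gcongr
      exact htail k n
    have h2 : |(∫ x, inner ℝ (g k x) (ψ x) ∂μ) - ∫ x, inner ℝ (v x) (ψ x) ∂μ| ≤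
        |B| * ∫ x, ‖g k x - v x‖ ∂μ := by
      rw [← integral_sub (integrable_inner_of_bounded (hg1 k) hψm hBa)
        (integrable_inner_of_bounded hv1 hψm hBa)]
      simp_rw [← inner_sub_left]
      exact abs_integral_inner_le (f := fun x => g k x - v x) ((hg1 k).sub hv1) hBa
    rw [abs_le] at h1 h2
    rw [abs_lt] at hn ⊢
    constructor <;> linarith [h1.1, h1.2, h2.1, h2.2, hn.1, hn.2]
  refine ⟨v, ?_, hconv⟩
  -- The `L^q` bound for the limit follows by testing with truncations of
  -- `‖v‖^(q-2) v`.
  have hvm : StronglyMeasurable v := Lp.stronglyMeasurable G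
  have hq0 : 0 < q := by linarith
  have hmeas : ∀ R : ℕ, MeasurableSet {y | ‖v y‖ ≤ (R : ℝ)} := fun R =>
    hvm.norm.measurable measurableSet_Iic
  have hYint : ∀ R : ℕ, Integrable ({y | ‖v y‖ ≤ (R : ℝ)}.indicator fun x => ‖v x‖ ^ q) μ := by
    intro R
    refine Integrable.of_bound ((hvm.norm.measurable.pow_const q).stronglyMeasurable.indicator
      (hmeas R)).aestronglyMeasurable ((R : ℝ) ^ q) (Eventually.of_forall fun x => ?_)
    rw [norm_indicator_eq_indicator_norm]
    refine indicator_apply_le' (fun hx => ?_) (fun _ => by positivity)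
    rw [Real.norm_of_nonneg (by positivity)]
    exact Real.rpow_le_rpow (norm_nonneg _) hx hq0.le
  have hY : ∀ R : ℕ, ∫ x, {y | ‖v y‖ ≤ (R : ℝ)}.indicator (fun x => ‖v x‖ ^ q) x ∂μ ≤ C := by
    intro R
    set s : Set X := {y | ‖v y‖ ≤ (R : ℝ)} with hs
    have hsm : MeasurableSet s := hmeas R
    have hYi := hYint R
    set ψ : X → E := s.indicator fun x => ‖v x‖ ^ (q - 2) • v x with hψ
    have hψm : StronglyMeasurable ψ := by
      refine StronglyMeasurable.indicator ?_ hsm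
      exact (hvm.norm.measurable.pow_const (q - 2)).stronglyMeasurable.smul hvm
    have hψn : ∀ x, ‖ψ x‖ = s.indicator (fun x => ‖v x‖ ^ (q - 1)) x := by
      intro x
      rw [hψ, norm_indicator_eq_indicator_norm]
      by_cases hx : x ∈ s
      · rw [indicator_of_mem hx, indicator_of_mem hx, norm_smul, Real.norm_of_nonneg (by positivity)]
        rcases (norm_nonneg (v x)).eq_or_lt with h0 | h0
        · rw [← h0, mul_zero, Real.zero_rpow (by linarith)]
        · nth_rewrite 2 [← Real.rpow_one ‖v x‖]
          rw [← Real.rpow_add h0]; congr 1; ring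
      · rw [indicator_of_notMem hx, indicator_of_notMem hx]
    have hψb : ∀ x, ‖ψ x‖ ≤ (R : ℝ) ^ (q - 1) := by
      intro x
      rw [hψn]
      refine indicator_apply_le' (fun hx => ?_) (fun _ => by positivity)
      exact Real.rpow_le_rpow (norm_nonneg _) hx (by linarith)
    have hlim := hconv ψ hψm.aestronglyMeasurable _ (Eventually.of_forall hψb)
    set Y := ∫ x, s.indicator (fun x => ‖v x‖ ^ q) x ∂μ with hYdef
    have e : ∫ x, inner ℝ (v x) (ψ x) ∂μ = Y := by
      refine integral_congr_ae (Eventually.of_forall fun x => ?_)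
      by_cases hx : x ∈ s
      · simp only [hψ, indicator_of_mem hx]
        rw [inner_smul_right, real_inner_self_eq_norm_sq]
        rcases (norm_nonneg (v x)).eq_or_lt with h0 | h0
        · rw [← h0, Real.zero_rpow hq0.ne']; simp
        · rw [← Real.rpow_natCast, ← Real.rpow_add h0]; congr 1; push_cast; ring
      · simp only [hψ, indicator_of_notMem hx, inner_zero_right]
    rw [e] at hlim
    set q' := q / (q - 1) with hq'
    have hconj : q.HolderConjugate q' := Real.HolderConjugate.conjExponent hq
    have hbound : Y ≤ C / q + Y / q' := by
      refine le_of_tendsto hlim (Eventually.of_forall fun n => ?_)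
      calc ∫ x, inner ℝ (w n x) (ψ x) ∂μ
          ≤ ∫ x, (‖w n x‖ ^ q / q + s.indicator (fun x => ‖v x‖ ^ q) x / q') ∂μ := by
            refine integral_mono (integrable_inner_of_bounded (hw1 n) hψm.aestronglyMeasurable
              (Eventually.of_forall hψb)) (((hwi n).div_const q).add (hYi.div_const q')) fun x => ?_
            refine (real_inner_le_norm _ _).trans
              ((Real.young_inequality_of_nonneg (norm_nonneg _) (norm_nonneg _) hconj).trans ?_)
            have : ‖ψ x‖ ^ q' = s.indicator (fun x => ‖v x‖ ^ q) x := by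
              rw [hψn]
              by_cases hx : x ∈ s
              · rw [indicator_of_mem hx, indicator_of_mem hx, ← Real.rpow_mul (norm_nonneg _)]
                congr 1
                rw [hq']
                have : q - 1 ≠ 0 := by linarith
                field_simp
              · rw [indicator_of_notMem hx, indicator_of_notMem hx,
                  Real.zero_rpow hconj.symm.ne_zero]
            rw [this]
        _ = (∫ x, ‖w n x‖ ^ q ∂μ) / q + Y / q' := by
            rw [integral_add ((hwi n).div_const q) (hYi.div_const q'), integral_div, integral_div]
        _ ≤ C / q + Y / q' := by
            gcongr
            exact hwC n
    have hsum : q⁻¹ + q'⁻¹ = 1 := hconj.inv_add_inv_eq_one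
    have : Y * q⁻¹ ≤ C * q⁻¹ := by
      have h1 : Y = Y * q⁻¹ + Y * q'⁻¹ := by rw [← mul_add, hsum, mul_one]
      rw [div_eq_mul_inv, div_eq_mul_inv] at hbound
      linarith
    exact le_of_mul_le_mul_right this (by positivity)
  have hfin : ∫⁻ x, ENNReal.ofReal (‖v x‖ ^ q) ∂μ ≤ ENNReal.ofReal C := by
    calc ∫⁻ x, ENNReal.ofReal (‖v x‖ ^ q) ∂μ
        ≤ liminf (fun R : ℕ => ∫⁻ x, ENNReal.ofReal
            ({y | ‖v y‖ ≤ (R : ℝ)}.indicator (fun x => ‖v x‖ ^ q) x) ∂μ) atTop := by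
          refine le_trans (lintegral_mono fun x => ?_) (lintegral_liminf_le fun R =>
            ((hvm.norm.measurable.pow_const q).indicator (hmeas R)).ennreal_ofReal)
          refine le_of_eq (Tendsto.liminf_eq ?_).symm
          refine tendsto_const_nhds.congr' ?_
          filter_upwards [eventually_ge_atTop ⌈‖v x‖⌉₊] with R hR
          rw [indicator_of_mem]
          exact Nat.ceil_le.1 hR
      _ ≤ liminf (fun R : ℕ => ENNReal.ofReal C) atTop := by
          refine liminf_le_liminf (Eventually.of_forall fun R => ?_)
          rw [← ofReal_integral_eq_lintegral_ofReal (hYint R) (Eventually.of_forall fun x =>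
            indicator_nonneg (fun x _ => by positivity) x)]
          exact ENNReal.ofReal_le_ofReal (hY R)
      _ = ENNReal.ofReal C := by simp
  refine ⟨hvm.aestronglyMeasurable, ?_⟩
  rw [eLpNorm_lt_top_iff_lintegral_rpow_enorm_lt_top (by simpa using hq0) ENNReal.ofReal_ne_top,
    ENNReal.toReal_ofReal hq0.le]
  refine lt_of_le_of_lt ?_ (ENNReal.ofReal_lt_top (r := C))
  refine le_trans (lintegral_mono fun x => ?_) hfin
  rw [← ofReal_norm, ENNReal.ofReal_rpow_of_nonneg (norm_nonneg _) hq0.le]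

/-! ### The Sobolev embedding for test functions -/

/-- The fundamental theorem of calculus along a line, for the iterated derivatives of a compactly
supported function. -/
theorem enorm_iteratedFDeriv_le_lintegral_line {N : ℕ} {F : Type*} [NormedAddCommGroup F]
    [NormedSpace ℝ F] {φ : Space N → F} (hφ : ContDiff ℝ ∞ φ) (hc : HasCompactSupport φ) (k : ℕ)
    {e : Space N} (he : ‖e‖ = 1) (x : Space N) :
    ‖iteratedFDeriv ℝ k φ x‖ₑ ≤ ∫⁻ t : ℝ, ‖iteratedFDeriv ℝ (k + 1) φ (x + t • e)‖ₑ := by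
  have hd : ContDiff ℝ 1 (iteratedFDeriv ℝ k φ) :=
    hφ.iteratedFDeriv_right (by exact_mod_cast le_top)
  have he0 : e ≠ 0 := fun h => by simp [h] at he
  have hline : IsClosedEmbedding fun t : ℝ => x + t • e :=
    (Homeomorph.addLeft x).isClosedEmbedding.comp (isClosedEmbedding_smul_left he0)
  have hcl : HasCompactSupport fun t : ℝ => iteratedFDeriv ℝ k φ (x + t • e) :=
    (hc.iteratedFDeriv k).comp_isClosedEmbedding hline
  have hcd : ContDiff ℝ 1 fun t : ℝ => iteratedFDeriv ℝ k φ (x + t • e) :=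
    hd.comp (by fun_prop)
  have := HasCompactSupport.enorm_le_lintegral_Ici_deriv hcd hcl 0
  simp only [zero_smul, add_zero] at this
  refine this.trans ((setLIntegral_le_lintegral _ _).trans (lintegral_mono fun t => ?_))
  have h1 : HasDerivAt (fun t : ℝ => x + t • e) e t := by
    simpa using ((hasDerivAt_id t).smul_const e).const_add x
  have h2 : HasDerivAt (fun t : ℝ => iteratedFDeriv ℝ k φ (x + t • e))
      (fderiv ℝ (iteratedFDeriv ℝ k φ) (x + t • e) e) t :=
    ((hd.differentiable one_ne_zero _).hasFDerivAt).comp_hasDerivAt t h1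
  rw [h2.deriv, ← ofReal_norm, ← ofReal_norm]
  refine ENNReal.ofReal_le_ofReal ((ContinuousLinearMap.le_opNorm _ _).trans ?_)
  rw [he, mul_one, norm_fderiv_iteratedFDeriv]

/-- Iterating the fundamental theorem of calculus over all coordinates bounds a compactly supported
function by the `L¹` norm of its `N`-th derivative. -/
theorem enorm_le_lintegral_iteratedFDeriv {N : ℕ} {F : Type*} [NormedAddCommGroup F]
    [NormedSpace ℝ F] {φ : Space N → F} (hφ : ContDiff ℝ ∞ φ) (hc : HasCompactSupport φ)
    (x : Space N) : ‖φ x‖ₑ ≤ ∫⁻ y, ‖iteratedFDeriv ℝ N φ y‖ₑ := by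
  set g : ℕ → (Fin N → ℝ) → ℝ≥0∞ := fun k y => ‖iteratedFDeriv ℝ k φ (WithLp.toLp 2 y)‖ₑ with hg
  have hcont : ∀ k, Continuous (iteratedFDeriv ℝ k φ) := fun k =>
    hφ.continuous_iteratedFDeriv (by exact_mod_cast le_top)
  have hgm : ∀ k, Measurable (g k) := fun k =>
    ((hcont k).comp (PiLp.continuous_toLp 2 _)).enorm.measurable
  have hstep : ∀ k i y, g k y ≤ ∫⁻ t : ℝ, g (k + 1) (Function.update y i t) := by
    intro k i y
    have h := enorm_iteratedFDeriv_le_lintegral_line hφ hc k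
      (e := EuclideanSpace.single i (1 : ℝ)) (by simp) (WithLp.toLp 2 y)
    refine h.trans (le_of_eq ?_)
    rw [← lintegral_sub_right_eq_self _ (y i)]
    refine lintegral_congr fun t => ?_
    have : (WithLp.toLp 2 y : Space N) + (t - y i) • EuclideanSpace.single i (1 : ℝ) =
        WithLp.toLp 2 (Function.update y i t) := by
      ext j
      by_cases hj : j = i
      · subst hj; simp
      · simp [hj]
    rw [this]
  have key : ∀ s : Finset (Fin N), g 0 ≤ ∫⋯∫⁻_s, g s.card := by
    intro s
    induction s using Finset.induction_on with
    | empty => simp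
    | insert i s hi ih =>
      rw [lmarginal_insert' _ (hgm _) hi, Finset.card_insert_of_notMem hi]
      exact ih.trans (lmarginal_mono fun y => hstep _ i y)
  have h := key Finset.univ (WithLp.ofLp x)
  rw [lmarginal_univ, Finset.card_univ, Fintype.card_fin] at h
  have e1 : g 0 (WithLp.ofLp x) = ‖φ x‖ₑ := by
    simp only [hg, WithLp.toLp_ofLp]
    rw [← ofReal_norm, norm_iteratedFDeriv_zero, ofReal_norm]
  rw [e1] at h
  refine h.trans (le_of_eq ?_)
  exact (PiLp.volume_preserving_toLp (Fin N)).lintegral_comp (hcont N).enorm.measurable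

theorem lintegral_sq_rpow_le_sobolevNorm {N : ℕ} (Ω : Opens (Space N)) {s : ℝ} {j : ℕ}
    (hj : (j : ℝ) ≤ s) (φ : 𝓓(Ω, ℝ)) :
    (∫⁻ x in (Ω : Set (Space N)), ‖iteratedFDeriv ℝ j φ x‖ₑ ^ 2) ^ (1 / 2 : ℝ) ≤
      sobolevNorm Ω s φ := by
  unfold sobolevNorm
  refine ENNReal.rpow_le_rpow (le_trans ?_ le_self_add) (by norm_num)
  refine Finset.single_le_sum (f := fun j => ∫⁻ x in (Ω : Set (Space N)),
    ‖iteratedFDeriv ℝ j φ x‖ₑ ^ 2) (fun _ _ => zero_le) ?_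
  rw [Finset.mem_range, Nat.lt_succ_iff]
  exact Nat.le_floor hj

theorem lintegral_enorm_le_sobolevNorm {N : ℕ} (Ω : Opens (Space N)) {s : ℝ} {j : ℕ}
    (hj : (j : ℝ) ≤ s) (φ : 𝓓(Ω, ℝ)) :
    ∫⁻ x, ‖iteratedFDeriv ℝ j φ x‖ₑ ≤
      sobolevNorm Ω s φ * volume (Ω : Set (Space N)) ^ (1 / 2 : ℝ) := by
  have hcont : Continuous (iteratedFDeriv ℝ j φ) :=
    φ.contDiff.continuous_iteratedFDeriv (by exact_mod_cast le_top)
  have hsupp : Function.support (fun x => ‖iteratedFDeriv ℝ j φ x‖ₑ) ⊆ (Ω : Set (Space N)) := by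
    intro x hx
    refine φ.tsupport_subset (support_iteratedFDeriv_subset (𝕜 := ℝ) j ?_)
    simpa using hx
  rw [← setLIntegral_eq_of_support_subset hsupp]
  refine (lintegral_enorm_le_eLpNorm_two hcont.aestronglyMeasurable).trans ?_
  gcongr
  refine le_trans (le_of_eq ?_) (lintegral_sq_rpow_le_sobolevNorm Ω hj φ)
  rw [lintegral_enorm_sq, ← ENNReal.rpow_natCast, ← ENNReal.rpow_mul]
  norm_num

theorem enorm_le_sobolevNorm {N : ℕ} (Ω : Opens (Space N)) {s : ℝ} (hs : (N : ℝ) + 1 ≤ s)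
    (φ : 𝓓(Ω, ℝ)) (x : Space N) :
    ‖φ x‖ₑ ≤ sobolevNorm Ω s φ * volume (Ω : Set (Space N)) ^ (1 / 2 : ℝ) :=
  (enorm_le_lintegral_iteratedFDeriv φ.contDiff φ.hasCompactSupport x).trans
    (lintegral_enorm_le_sobolevNorm Ω (by linarith) φ)

theorem enorm_gradient_le_sobolevNorm {N : ℕ} (Ω : Opens (Space N)) {s : ℝ}
    (hs : (N : ℝ) + 1 ≤ s) (φ : 𝓓(Ω, ℝ)) (x : Space N) :
    ‖gradient φ x‖ₑ ≤ sobolevNorm Ω s φ * volume (Ω : Set (Space N)) ^ (1 / 2 : ℝ) := by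
  have h1 : ContDiff ℝ ∞ (fderiv ℝ φ) := φ.contDiff.fderiv_right (by simp)
  have h := enorm_le_lintegral_iteratedFDeriv h1 (φ.hasCompactSupport.fderiv ℝ) x
  rw [← ofReal_norm, norm_gradient, ofReal_norm]
  refine h.trans (le_trans (le_of_eq ?_)
    (lintegral_enorm_le_sobolevNorm Ω (j := N + 1) (by push_cast; linarith) φ))
  refine lintegral_congr fun y => ?_
  rw [← ofReal_norm, norm_iteratedFDeriv_fderiv, ofReal_norm]

/-- A functional of order one on test functions lies in `W^{-s,2}(Ω)` for `s ≥ N + 1`. -/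
theorem negSobolevNorm_le {N : ℕ} {Ω : Opens (Space N)}
    (hbd : Bornology.IsBounded (Ω : Set (Space N))) {s : ℝ} (hs : (N : ℝ) + 1 ≤ s)
    {ℓ : 𝓓(Ω, ℝ) →ₗ[ℝ] ℝ} {R : ℝ}
    (hℓ : ∀ φ : 𝓓(Ω, ℝ), ∀ B : ℝ, (∀ x, ‖φ x‖ ≤ B) → (∀ x, ‖gradient φ x‖ ≤ B) →
      |ℓ φ| ≤ R * B) :
    negSobolevNorm Ω s ℓ ≤
      ENNReal.ofReal (R * (volume (Ω : Set (Space N)) ^ (1 / 2 : ℝ)).toReal) := by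
  have hvol : volume (Ω : Set (Space N)) ^ (1 / 2 : ℝ) ≠ ⊤ :=
    ENNReal.rpow_ne_top_of_nonneg (by norm_num) hbd.measure_lt_top.ne
  refine iSup₂_le fun φ hφ => ?_
  have hb : ∀ {a : ℝ≥0∞}, a ≤ sobolevNorm Ω s φ * volume (Ω : Set (Space N)) ^ (1 / 2 : ℝ) →
      a ≤ volume (Ω : Set (Space N)) ^ (1 / 2 : ℝ) := fun h =>
    h.trans (mul_le_of_le_one_left (by simp) hφ)
  rw [← ofReal_norm, Real.norm_eq_abs]
  refine ENNReal.ofReal_le_ofReal (hℓ φ _ (fun x => ?_) fun x => ?_)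
  · rw [← toReal_enorm]
    exact ENNReal.toReal_mono hvol (hb (enorm_le_sobolevNorm Ω hs φ x))
  · rw [← toReal_enorm]
    exact ENNReal.toReal_mono hvol (hb (enorm_gradient_le_sobolevNorm Ω hs φ x))

/-! ### Separability of the test functions in `C¹` -/

theorem continuous_gradient_testFunction {N : ℕ} {Ω : Opens (Space N)} (φ : 𝓓(Ω, ℝ)) :
    Continuous (gradient φ) :=
  continuous_gradient (φ.contDiff.of_le (by exact_mod_cast le_top))

theorem gradient_eq_zero_of_notMem {N : ℕ} {Ω : Opens (Space N)} (φ : 𝓓(Ω, ℝ)) {x : Space N}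
    (hx : x ∉ (Ω : Set (Space N))) : gradient φ x = 0 := by
  have : fderiv ℝ φ x = 0 := by
    by_contra h
    exact hx (φ.tsupport_subset (support_fderiv_subset ℝ h))
  simp [gradient, this]

theorem testFunction_eq_zero_of_notMem {N : ℕ} {Ω : Opens (Space N)} (φ : 𝓓(Ω, ℝ))
    {x : Space N} (hx : x ∉ (Ω : Set (Space N))) : φ x = 0 := by
  by_contra h
  exact hx (φ.tsupport_subset (subset_tsupport _ h))

theorem exists_bound_testFunction {N : ℕ} {Ω : Opens (Space N)} (φ : 𝓓(Ω, ℝ)) :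
    ∃ B : ℝ, 0 ≤ B ∧ (∀ x, ‖φ x‖ ≤ B) ∧ ∀ x, ‖gradient φ x‖ ≤ B := by
  obtain ⟨B₁, hB₁⟩ := φ.hasCompactSupport.exists_bound_of_continuous φ.continuous
  have hc : HasCompactSupport (gradient φ) :=
    (φ.hasCompactSupport.fderiv ℝ).comp_left (map_zero (InnerProductSpace.toDual ℝ (Space N)).symm)
  obtain ⟨B₂, hB₂⟩ := hc.exists_bound_of_continuous (continuous_gradient_testFunction φ)
  exact ⟨max B₁ B₂, (norm_nonneg _).trans ((hB₁ 0).trans (le_max_left _ _)),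
    fun x => (hB₁ x).trans (le_max_left _ _), fun x => (hB₂ x).trans (le_max_right _ _)⟩

theorem exists_dense_seq_testFunction {N : ℕ} {Ω : Opens (Space N)}
    (hbd : Bornology.IsBounded (Ω : Set (Space N))) :
    ∃ D : ℕ → 𝓓(Ω, ℝ), ∀ φ : 𝓓(Ω, ℝ), ∀ ε > 0, ∃ n,
      (∀ x, ‖φ x - D n x‖ ≤ ε) ∧ ∀ x, ‖gradient φ x - gradient (D n) x‖ ≤ ε := by
  let K := closure (Ω : Set (Space N))
  have : CompactSpace K := isCompact_iff_compactSpace.1 hbd.isCompact_closure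
  let J : 𝓓(Ω, ℝ) → C(K, ℝ × Space N) := fun φ =>
    ⟨fun x => (φ x, gradient φ x), (φ.continuous.comp continuous_subtype_val).prodMk
      ((continuous_gradient_testFunction φ).comp continuous_subtype_val)⟩
  have : Nonempty (range J) := ⟨⟨J 0, mem_range_self 0⟩⟩
  have hD : ∀ n, ∃ φ, J φ = (denseSeq (range J) n : C(K, ℝ × Space N)) := fun n =>
    (denseSeq (range J) n).2
  choose D hD using hD
  refine ⟨D, fun φ ε hε => ?_⟩
  obtain ⟨n, hn⟩ := (denseRange_denseSeq (range J)).exists_dist_lt ⟨J φ, mem_range_self φ⟩ hε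
  rw [Subtype.dist_eq, ← hD n] at hn
  have hpt : ∀ x : K, dist (J φ x) (J (D n) x) ≤ ε := fun x =>
    (ContinuousMap.dist_apply_le_dist x).trans hn.le
  refine ⟨n, fun x => ?_, fun x => ?_⟩
  · by_cases hx : x ∈ (Ω : Set (Space N))
    · have := hpt ⟨x, subset_closure hx⟩
      rw [Prod.dist_eq] at this
      rw [← dist_eq_norm]
      exact (le_max_left _ _).trans this
    · rw [testFunction_eq_zero_of_notMem φ hx, testFunction_eq_zero_of_notMem (D n) hx]
      simpa using hε.le
  · by_cases hx : x ∈ (Ω : Set (Space N))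
    · have := hpt ⟨x, subset_closure hx⟩
      rw [Prod.dist_eq] at this
      rw [← dist_eq_norm]
      exact (le_max_right _ _).trans this
    · rw [gradient_eq_zero_of_notMem φ hx, gradient_eq_zero_of_notMem (D n) hx]
      simpa using hε.le

/-- The quantifiers "for all test functions" and "for almost all times" may be exchanged for
relations that are continuous in the `C¹` topology. -/
theorem ae_forall_testFunction {N : ℕ} {Ω : Opens (Space N)}
    (hbd : Bornology.IsBounded (Ω : Set (Space N))) {α F : Type*} [MeasurableSpace α]
    {μ : Measure α} [NormedAddCommGroup F] {L : α → 𝓓(Ω, ℝ) → F}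
    (hL : ∀ᵐ t ∂μ, ∃ R : ℝ, ∀ φ ψ : 𝓓(Ω, ℝ), ∀ B : ℝ, (∀ x, ‖φ x - ψ x‖ ≤ B) →
      (∀ x, ‖gradient φ x - gradient ψ x‖ ≤ B) → ‖L t φ - L t ψ‖ ≤ R * B)
    (h : ∀ φ, ∀ᵐ t ∂μ, L t φ = 0) : ∀ᵐ t ∂μ, ∀ φ, L t φ = 0 := by
  obtain ⟨D, hD⟩ := exists_dense_seq_testFunction hbd
  filter_upwards [hL, ae_all_iff.2 fun n => h (D n)] with t ⟨R, hR⟩ ht φ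
  rw [← norm_le_zero_iff]
  have key : ∀ ε > 0, ‖L t φ‖ ≤ R * ε := by
    intro ε hε
    obtain ⟨n, h1, h2⟩ := hD φ ε hε
    simpa [ht n] using hR φ (D n) ε h1 h2
  have hlim : Tendsto (fun ε : ℝ => R * ε) (𝓝[>] 0) (𝓝 0) := by
    have : Tendsto (fun ε : ℝ => R * ε) (𝓝 0) (𝓝 (R * 0)) := tendsto_id.const_mul R
    rw [mul_zero] at this
    exact this.mono_left nhdsWithin_le_nhds
  exact ge_of_tendsto hlim (eventually_nhdsWithin_of_forall key)

/-! ### Continuity in time of weak solutions -/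

/-- An integrable function whose distributional derivative on `(0,T)` is `g`, with initial trace
`c`, is the primitive of `g` with value `c` at `0`. -/
theorem ae_eq_add_integral_of_weak_deriv {T : ℝ} (hT : 0 < T) {v g : ℝ → ℝ} {c : ℝ}
    (hv : IntegrableOn v (Ioo 0 T)) (hg : IntegrableOn g (Ioo 0 T))
    (h : ∀ η : ℝ → ℝ, ContDiff ℝ ∞ η → η T = 0 →
      -∫ t in Ioo 0 T, v t * deriv η t = (∫ t in Ioo 0 T, g t * η t) + c * η 0) :
    ∀ᵐ t ∂(volume.restrict (Ioo 0 T)), v t = c + ∫ τ in (0 : ℝ)..t, g τ := by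
  have hgi : IntervalIntegrable g volume 0 T :=
    (intervalIntegrable_iff_integrableOn_Ioo_of_le hT.le).2 hg
  set P : ℝ → ℝ := fun t => ∫ τ in (0 : ℝ)..t, g τ with hP
  have hPc : ContinuousOn P (uIcc 0 T) :=
    intervalIntegral.continuousOn_primitive_interval' hgi left_mem_uIcc
  have hPac : AbsolutelyContinuousOnInterval P 0 T :=
    hgi.absolutelyContinuousOnInterval_intervalIntegral left_mem_uIcc
  have hPi : IntegrableOn P (Ioo 0 T) :=
    (intervalIntegrable_iff_integrableOn_Ioo_of_le hT.le).1 hPc.intervalIntegrable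
  have hci : IntegrableOn (fun _ : ℝ => c) (Ioo 0 T) := integrableOn_const (by simp)
  have hw : IntegrableOn (fun t => v t - (c + P t)) (Ioo 0 T) := hv.sub (hci.add hPi)
  have key := isOpen_Ioo.ae_eq_zero_of_integral_contDiff_smul_eq_zero
    (μ := volume) hw.locallyIntegrableOn ?_
  · rw [ae_restrict_iff' measurableSet_Ioo]
    filter_upwards [key] with t ht htm
    exact sub_eq_zero.1 (ht htm)
  intro ζ hζ hζc hζs
  rw [← setIntegral_eq_integral_of_forall_compl_eq_zero (s := Ioo 0 T) (fun t ht => by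
    rw [image_eq_zero_of_notMem_tsupport (fun h => ht (hζs h)), zero_smul])]
  set η : ℝ → ℝ := fun t => ∫ τ in T..t, ζ τ with hη
  have hηd : ∀ t, HasDerivAt η (ζ t) t := fun t => by
    exact intervalIntegral.integral_hasDerivAt_right (hζ.continuous.intervalIntegrable _ _)
      (hζ.continuous.stronglyMeasurableAtFilter _ _) hζ.continuous.continuousAt
  have hηd' : deriv η = ζ := funext fun t => (hηd t).deriv
  have hηs : ContDiff ℝ ∞ η := by
    rw [contDiff_infty_iff_deriv, hηd']
    exact ⟨fun t => (hηd t).differentiableAt, hζ⟩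
  have hηT : η T = 0 := by simp [hη]
  have h1 := h η hηs hηT
  rw [hηd'] at h1
  have hηac : AbsolutelyContinuousOnInterval η 0 T :=
    (hηs.of_le (by exact_mod_cast le_top)).contDiffOn.absolutelyContinuousOnInterval
  have h2 := hPac.integral_mul_deriv_eq_deriv_mul hηac
  have h3 : ∫ t in (0 : ℝ)..T, deriv P t * η t = ∫ t in (0 : ℝ)..T, g t * η t := by
    refine intervalIntegral.integral_congr_ae ?_
    filter_upwards [hgi.ae_hasDerivAt_integral] with t ht htm
    rw [(ht (uIoc_subset_uIcc htm) 0 left_mem_uIcc).deriv]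
  have h4 : ∫ t in (0 : ℝ)..T, ζ t = - η 0 := by
    rw [hη]; exact intervalIntegral.integral_symm _ _
  have hP0 : P 0 = 0 := by simp [hP]
  rw [h3, hηd', hηT, hP0, intervalIntegral.integral_of_le hT.le,
    intervalIntegral.integral_of_le hT.le, integral_Ioc_eq_integral_Ioo,
    integral_Ioc_eq_integral_Ioo] at h2
  rw [intervalIntegral.integral_of_le hT.le, integral_Ioc_eq_integral_Ioo] at h4
  obtain ⟨B, hB⟩ := hζc.exists_bound_of_continuous hζ.continuous
  have hmul : ∀ {w : ℝ → ℝ}, IntegrableOn w (Ioo 0 T) →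
      IntegrableOn (fun t => w t * ζ t) (Ioo 0 T) := fun hw =>
    Integrable.mul_bdd hw hζ.continuous.aestronglyMeasurable (Eventually.of_forall hB)
  have h5 : (fun t => ζ t • (v t - (c + P t))) = fun t => v t * ζ t - (c * ζ t + P t * ζ t) := by
    ext t; simp only [smul_eq_mul]; ring
  rw [h5, integral_sub (g := fun t => c * ζ t + P t * ζ t) (hmul hv)
    ((hmul hci).add (hmul hPi)), integral_add (hmul hci) (hmul hPi),
    integral_const_mul, h4]
  linarith

theorem volume_restrict_cylinder {N : ℕ} (Ω : Opens (Space N)) (T : ℝ) :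
    (volume : Measure (ℝ × Space N)).restrict (cylinder Ω T) =
      (volume.restrict (Ioo 0 T)).prod (volume.restrict (Ω : Set (Space N))) := by
  rw [Measure.prod_restrict]; rfl

theorem integrable_mul_testFunction {N : ℕ} {Ω : Opens (Space N)} {u : Space N → ℝ}
    (hu : IntegrableOn u Ω) (φ : 𝓓(Ω, ℝ)) : IntegrableOn (fun x => u x * φ x) Ω := by
  obtain ⟨B, -, hB, -⟩ := exists_bound_testFunction φ
  exact Integrable.mul_bdd hu φ.continuous.aestronglyMeasurable (Eventually.of_forall hB)

theorem integrable_inner_gradient_testFunction {N : ℕ} {Ω : Opens (Space N)} {G : Space N → Space N}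
    (hG : IntegrableOn G Ω) (φ : 𝓓(Ω, ℝ)) :
    IntegrableOn (fun x => inner ℝ (G x) (gradient φ x)) Ω := by
  obtain ⟨B, -, -, hB⟩ := exists_bound_testFunction φ
  exact integrable_inner_of_bounded hG (continuous_gradient_testFunction φ).aestronglyMeasurable
    (Eventually.of_forall hB)

theorem gradient_add_testFunction {N : ℕ} {Ω : Opens (Space N)} (φ ψ : 𝓓(Ω, ℝ)) :
    gradient (φ + ψ : 𝓓(Ω, ℝ)) = gradient φ + gradient ψ :=
  gradient_add_of_contDiff (φ.contDiff.of_le (by exact_mod_cast le_top))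
    (ψ.contDiff.of_le (by exact_mod_cast le_top))

theorem gradient_smul_testFunction {N : ℕ} {Ω : Opens (Space N)} (c : ℝ) (φ : 𝓓(Ω, ℝ)) :
    gradient (c • φ : 𝓓(Ω, ℝ)) = c • gradient φ :=
  gradient_smul_of_contDiff (φ.contDiff.of_le (by exact_mod_cast le_top)) c

theorem gradient_sub_testFunction {N : ℕ} {Ω : Opens (Space N)} (φ ψ : 𝓓(Ω, ℝ)) :
    gradient (φ - ψ : 𝓓(Ω, ℝ)) = gradient φ - gradient ψ := by
  have h := gradient_add_testFunction (φ - ψ) ψ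
  rw [sub_add_cancel] at h
  rw [h, add_sub_cancel_right]


theorem integral_cylinder_mul_of_bounded {N : ℕ} {Ω : Opens (Space N)} {T : ℝ}
    {w : ℝ × Space N → ℝ} (hw : IntegrableOn w (cylinder Ω T)) {a : ℝ → ℝ} (ha : Measurable a)
    {B : ℝ} (hB : ∀ t ∈ Ioo 0 T, ‖a t‖ ≤ B) :
    ∫ z in cylinder Ω T, w z * a z.1 =
      ∫ t in Ioo 0 T, (∫ x in (Ω : Set (Space N)), w (t, x)) * a t := by
  have hm : MeasurableSet (cylinder Ω T) := measurableSet_Ioo.prod Ω.isOpen.measurableSet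
  have hi : IntegrableOn (fun z => w z * a z.1) (cylinder Ω T) := by
    refine Integrable.mul_bdd (c := B) hw (ha.comp measurable_fst).aestronglyMeasurable ?_
    filter_upwards [ae_restrict_mem hm] with z hz using hB _ hz.1
  rw [IntegrableOn, volume_restrict_cylinder] at hi
  rw [volume_restrict_cylinder, integral_prod _ hi]
  simp only [integral_mul_const]

theorem integral_cylinder_mul {N : ℕ} {Ω : Opens (Space N)} {T : ℝ} {w : ℝ × Space N → ℝ}
    (hw : IntegrableOn w (cylinder Ω T)) {a : ℝ → ℝ} (ha : Continuous a) :
    ∫ z in cylinder Ω T, w z * a z.1 =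
      ∫ t in Ioo 0 T, (∫ x in (Ω : Set (Space N)), w (t, x)) * a t := by
  obtain ⟨B, hB⟩ := isCompact_Icc (a := (0 : ℝ)) (b := T) |>.exists_bound_of_continuousOn
    ha.continuousOn
  exact integral_cylinder_mul_of_bounded hw ha.measurable fun t ht => hB t (Ioo_subset_Icc_self ht)

/-- The action of the distributional time derivative of a weak solution on a test function:
`∫_Ω f(τ) φ - ∫_Ω G(τ) · ∇φ` for `τ ∈ (0,T)`, extended by zero. -/
noncomputable def fluxPairing {N : ℕ} (Ω : Opens (Space N)) (T : ℝ) (f : ℝ × Space N → ℝ)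
    (G : ℝ × Space N → Space N) (φ : 𝓓(Ω, ℝ)) : ℝ → ℝ :=
  (Ioo 0 T).indicator fun τ => (∫ x in (Ω : Set (Space N)), f (τ, x) * φ x) -
    ∫ x in (Ω : Set (Space N)), inner ℝ (G (τ, x)) (gradient φ x)

/-- The spatial `L¹` norm of the data of the flux pairing, extended by zero outside `(0,T)`. -/
noncomputable def fluxNorm {N : ℕ} (Ω : Opens (Space N)) (T : ℝ) (f : ℝ × Space N → ℝ)
    (G : ℝ × Space N → Space N) : ℝ → ℝ :=
  (Ioo 0 T).indicator fun τ => (∫ x in (Ω : Set (Space N)), ‖f (τ, x)‖) +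
    ∫ x in (Ω : Set (Space N)), ‖G (τ, x)‖

theorem integrable_mul_testFunction_cylinder {N : ℕ} {Ω : Opens (Space N)} {T : ℝ}
    {u : ℝ × Space N → ℝ} (hu : IntegrableOn u (cylinder Ω T)) (φ : 𝓓(Ω, ℝ)) :
    IntegrableOn (fun z => u z * φ z.2) (cylinder Ω T) := by
  obtain ⟨B, -, hB, -⟩ := exists_bound_testFunction φ
  exact Integrable.mul_bdd hu (φ.continuous.comp continuous_snd).aestronglyMeasurable
    (Eventually.of_forall fun z => hB z.2)

theorem integrable_inner_gradient_testFunction_cylinder {N : ℕ} {Ω : Opens (Space N)} {T : ℝ}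
    {G : ℝ × Space N → Space N} (hG : IntegrableOn G (cylinder Ω T)) (φ : 𝓓(Ω, ℝ)) :
    IntegrableOn (fun z => inner ℝ (G z) (gradient φ z.2)) (cylinder Ω T) := by
  obtain ⟨B, -, -, hB⟩ := exists_bound_testFunction φ
  exact integrable_inner_of_bounded hG
    ((continuous_gradient_testFunction φ).comp continuous_snd).aestronglyMeasurable
    (Eventually.of_forall fun z => hB z.2)

theorem integrable_fluxPairing {N : ℕ} {Ω : Opens (Space N)} {T : ℝ} {f : ℝ × Space N → ℝ}
    {G : ℝ × Space N → Space N} (hf : IntegrableOn f (cylinder Ω T))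
    (hG : IntegrableOn G (cylinder Ω T)) (φ : 𝓓(Ω, ℝ)) : Integrable (fluxPairing Ω T f G φ) := by
  have h1 := integrable_mul_testFunction_cylinder hf φ
  have h2 := integrable_inner_gradient_testFunction_cylinder hG φ
  rw [IntegrableOn, volume_restrict_cylinder] at h1 h2
  exact (integrable_indicator_iff measurableSet_Ioo).2
    (h1.integral_prod_left.sub h2.integral_prod_left)

theorem integrable_fluxNorm {N : ℕ} {Ω : Opens (Space N)} {T : ℝ} {f : ℝ × Space N → ℝ}
    {G : ℝ × Space N → Space N} (hf : IntegrableOn f (cylinder Ω T))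
    (hG : IntegrableOn G (cylinder Ω T)) : Integrable (fluxNorm Ω T f G) := by
  rw [IntegrableOn, volume_restrict_cylinder] at hf hG
  exact (integrable_indicator_iff measurableSet_Ioo).2
    (hf.norm.integral_prod_left.add hG.norm.integral_prod_left)

theorem ae_integrableOn_slice {N : ℕ} {E : Type*} [NormedAddCommGroup E] {Ω : Opens (Space N)}
    {T : ℝ} {u : ℝ × Space N → E} (hu : IntegrableOn u (cylinder Ω T)) :
    ∀ᵐ t ∂(volume.restrict (Ioo 0 T)), IntegrableOn (fun x => u (t, x)) Ω := by
  rw [IntegrableOn, volume_restrict_cylinder] at hu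
  exact hu.prod_right_ae

theorem ae_fluxPairing_add {N : ℕ} {Ω : Opens (Space N)} {T : ℝ} {f : ℝ × Space N → ℝ}
    {G : ℝ × Space N → Space N} (hf : IntegrableOn f (cylinder Ω T))
    (hG : IntegrableOn G (cylinder Ω T)) (φ ψ : 𝓓(Ω, ℝ)) :
    ∀ᵐ τ, fluxPairing Ω T f G (φ + ψ) τ = fluxPairing Ω T f G φ τ + fluxPairing Ω T f G ψ τ := by
  have h1 := (ae_restrict_iff' measurableSet_Ioo).1 (ae_integrableOn_slice hf)
  have h2 := (ae_restrict_iff' measurableSet_Ioo).1 (ae_integrableOn_slice hG)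
  filter_upwards [h1, h2] with τ h1 h2
  by_cases hτ : τ ∈ Ioo 0 T
  · have e1 : ∫ x in (Ω : Set (Space N)), f (τ, x) * (φ + ψ) x =
        (∫ x in (Ω : Set (Space N)), f (τ, x) * φ x) +
          ∫ x in (Ω : Set (Space N)), f (τ, x) * ψ x := by
      rw [← integral_add (integrable_mul_testFunction (h1 hτ) φ)
        (integrable_mul_testFunction (h1 hτ) ψ)]
      exact integral_congr_ae (Eventually.of_forall fun x => mul_add _ _ _)
    have e2 : ∫ x in (Ω : Set (Space N)), inner ℝ (G (τ, x)) (gradient (φ + ψ : 𝓓(Ω, ℝ)) x) =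
        (∫ x in (Ω : Set (Space N)), inner ℝ (G (τ, x)) (gradient φ x)) +
          ∫ x in (Ω : Set (Space N)), inner ℝ (G (τ, x)) (gradient ψ x) := by
      rw [← integral_add (integrable_inner_gradient_testFunction (h2 hτ) φ)
        (integrable_inner_gradient_testFunction (h2 hτ) ψ), gradient_add_testFunction]
      exact integral_congr_ae (Eventually.of_forall fun x => inner_add_right _ _ _)
    simp only [fluxPairing, indicator_of_mem hτ, e1, e2]
    ring
  · simp [fluxPairing, indicator_of_notMem hτ]

theorem fluxPairing_smul {N : ℕ} (Ω : Opens (Space N)) (T : ℝ) (f : ℝ × Space N → ℝ)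
    (G : ℝ × Space N → Space N) (c : ℝ) (φ : 𝓓(Ω, ℝ)) (τ : ℝ) :
    fluxPairing Ω T f G (c • φ) τ = c * fluxPairing Ω T f G φ τ := by
  by_cases hτ : τ ∈ Ioo 0 T
  · have e1 : ∫ x in (Ω : Set (Space N)), f (τ, x) * (c • φ) x =
        c * ∫ x in (Ω : Set (Space N)), f (τ, x) * φ x := by
      rw [← integral_const_mul]
      exact integral_congr_ae (Eventually.of_forall fun x => mul_left_comm _ _ _)
    have e2 : ∫ x in (Ω : Set (Space N)), inner ℝ (G (τ, x)) (gradient (c • φ : 𝓓(Ω, ℝ)) x) =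
        c * ∫ x in (Ω : Set (Space N)), inner ℝ (G (τ, x)) (gradient φ x) := by
      rw [← integral_const_mul, gradient_smul_testFunction]
      exact integral_congr_ae (Eventually.of_forall fun x => inner_smul_right _ _ _)
    simp only [fluxPairing, indicator_of_mem hτ, e1, e2]
    ring
  · simp [fluxPairing, indicator_of_notMem hτ]

theorem abs_integral_mul_le {α : Type*} [MeasurableSpace α] {μ : Measure α} {u φ : α → ℝ} {B : ℝ}
    (hu : Integrable u μ) (hB : ∀ x, ‖φ x‖ ≤ B) : |∫ x, u x * φ x ∂μ| ≤ (∫ x, ‖u x‖ ∂μ) * B := by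
  rw [← Real.norm_eq_abs, ← integral_mul_const]
  refine norm_integral_le_of_norm_le (hu.norm.mul_const B) (Eventually.of_forall fun x => ?_)
  rw [norm_mul]
  exact mul_le_mul_of_nonneg_left (hB x) (norm_nonneg _)

theorem ae_abs_fluxPairing_le {N : ℕ} {Ω : Opens (Space N)} {T : ℝ} {f : ℝ × Space N → ℝ}
    {G : ℝ × Space N → Space N} (hf : IntegrableOn f (cylinder Ω T))
    (hG : IntegrableOn G (cylinder Ω T)) {φ : 𝓓(Ω, ℝ)} {B : ℝ} (h₁ : ∀ x, ‖φ x‖ ≤ B)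
    (h₂ : ∀ x, ‖gradient φ x‖ ≤ B) :
    ∀ᵐ τ, ‖fluxPairing Ω T f G φ τ‖ ≤ fluxNorm Ω T f G τ * B := by
  have h1 := (ae_restrict_iff' measurableSet_Ioo).1 (ae_integrableOn_slice hf)
  have h2 := (ae_restrict_iff' measurableSet_Ioo).1 (ae_integrableOn_slice hG)
  filter_upwards [h1, h2] with τ h1 h2
  by_cases hτ : τ ∈ Ioo 0 T
  · simp only [fluxPairing, fluxNorm, indicator_of_mem hτ]
    have e1 := abs_integral_mul_le (h1 hτ) h₁
    have e2 := abs_integral_inner_le (μ := volume.restrict (Ω : Set (Space N))) (h2 hτ)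
      (Eventually.of_forall h₂)
    rw [add_mul, mul_comm (∫ x in (Ω : Set (Space N)), ‖G (τ, x)‖)]
    exact (norm_sub_le _ _).trans (add_le_add e1 e2)
  · simp [fluxPairing, fluxNorm, indicator_of_notMem hτ]

/-- The continuous representative of a weak solution, as a functional on test functions:
`φ ↦ ∫_Ω θ₀ φ + ∫_0^t ⟨θ_τ, φ⟩ dτ`. -/
noncomputable def timeRepresentative {N : ℕ} {Ω : Opens (Space N)} {T : ℝ}
    {f : ℝ × Space N → ℝ} {G : ℝ × Space N → Space N} {θ₀ : Space N → ℝ}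
    (hf : IntegrableOn f (cylinder Ω T)) (hG : IntegrableOn G (cylinder Ω T))
    (hθ₀ : IntegrableOn θ₀ Ω) (t : ℝ) : 𝓓(Ω, ℝ) →ₗ[ℝ] ℝ where
  toFun φ := (∫ x in (Ω : Set (Space N)), θ₀ x * φ x) + ∫ τ in (0 : ℝ)..t, fluxPairing Ω T f G φ τ
  map_add' φ ψ := by
    have e1 : ∫ x in (Ω : Set (Space N)), θ₀ x * (φ + ψ) x =
        (∫ x in (Ω : Set (Space N)), θ₀ x * φ x) + ∫ x in (Ω : Set (Space N)), θ₀ x * ψ x := by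
      rw [← integral_add (integrable_mul_testFunction hθ₀ φ) (integrable_mul_testFunction hθ₀ ψ)]
      exact integral_congr_ae (Eventually.of_forall fun x => mul_add _ _ _)
    have e2 : ∫ τ in (0 : ℝ)..t, fluxPairing Ω T f G (φ + ψ) τ =
        (∫ τ in (0 : ℝ)..t, fluxPairing Ω T f G φ τ) +
          ∫ τ in (0 : ℝ)..t, fluxPairing Ω T f G ψ τ := by
      rw [← intervalIntegral.integral_add (integrable_fluxPairing hf hG φ).intervalIntegrable
        (integrable_fluxPairing hf hG ψ).intervalIntegrable]
      refine intervalIntegral.integral_congr_ae ?_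
      filter_upwards [ae_fluxPairing_add hf hG φ ψ] with τ hτ _ using hτ
    rw [e1, e2]; ring
  map_smul' c φ := by
    have e1 : ∫ x in (Ω : Set (Space N)), θ₀ x * (c • φ) x =
        c * ∫ x in (Ω : Set (Space N)), θ₀ x * φ x := by
      rw [← integral_const_mul]
      exact integral_congr_ae (Eventually.of_forall fun x => mul_left_comm _ _ _)
    simp only [fluxPairing_smul, intervalIntegral.integral_const_mul, e1, RingHom.id_apply,
      smul_eq_mul]
    ring

theorem timeRepresentative_apply {N : ℕ} {Ω : Opens (Space N)} {T : ℝ}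
    {f : ℝ × Space N → ℝ} {G : ℝ × Space N → Space N} {θ₀ : Space N → ℝ}
    (hf : IntegrableOn f (cylinder Ω T)) (hG : IntegrableOn G (cylinder Ω T))
    (hθ₀ : IntegrableOn θ₀ Ω) (t : ℝ) (φ : 𝓓(Ω, ℝ)) :
    timeRepresentative hf hG hθ₀ t φ =
      (∫ x in (Ω : Set (Space N)), θ₀ x * φ x) + ∫ τ in (0 : ℝ)..t, fluxPairing Ω T f G φ τ := rfl

theorem abs_integral_fluxPairing_le {N : ℕ} {Ω : Opens (Space N)} {T : ℝ}
    {f : ℝ × Space N → ℝ} {G : ℝ × Space N → Space N}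
    (hf : IntegrableOn f (cylinder Ω T)) (hG : IntegrableOn G (cylinder Ω T))
    (a b : ℝ) {φ : 𝓓(Ω, ℝ)} {B : ℝ} (h₁ : ∀ x, ‖φ x‖ ≤ B) (h₂ : ∀ x, ‖gradient φ x‖ ≤ B) :
    |∫ τ in a..b, fluxPairing Ω T f G φ τ| ≤ |∫ τ in a..b, fluxNorm Ω T f G τ| * B := by
  have hB : 0 ≤ B := (norm_nonneg _).trans (h₁ 0)
  rw [← abs_of_nonneg hB, ← abs_mul, ← intervalIntegral.integral_mul_const]
  exact intervalIntegral.norm_integral_le_abs_of_norm_le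
    (ae_restrict_of_ae (ae_abs_fluxPairing_le hf hG h₁ h₂))
    ((integrable_fluxNorm hf hG).mul_const B).intervalIntegrable

theorem abs_timeRepresentative_le {N : ℕ} {Ω : Opens (Space N)} {T : ℝ}
    {f : ℝ × Space N → ℝ} {G : ℝ × Space N → Space N} {θ₀ : Space N → ℝ}
    (hf : IntegrableOn f (cylinder Ω T)) (hG : IntegrableOn G (cylinder Ω T))
    (hθ₀ : IntegrableOn θ₀ Ω) (t : ℝ) {φ : 𝓓(Ω, ℝ)} {B : ℝ} (h₁ : ∀ x, ‖φ x‖ ≤ B)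
    (h₂ : ∀ x, ‖gradient φ x‖ ≤ B) :
    |timeRepresentative hf hG hθ₀ t φ| ≤
      ((∫ x in (Ω : Set (Space N)), ‖θ₀ x‖) + |∫ τ in (0 : ℝ)..t, fluxNorm Ω T f G τ|) * B := by
  rw [timeRepresentative_apply, add_mul]
  exact (abs_add_le _ _).trans (add_le_add (abs_integral_mul_le hθ₀ h₁)
    (abs_integral_fluxPairing_le hf hG 0 t h₁ h₂))

/-- The modulus of continuity is that of the primitive of the integrable function `fluxNorm`. -/
theorem memContNegSobolev_timeRepresentative {N : ℕ} {Ω : Opens (Space N)}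
    (hbd : Bornology.IsBounded (Ω : Set (Space N))) {T s : ℝ} (hs : (N : ℝ) + 1 ≤ s)
    {f : ℝ × Space N → ℝ} {G : ℝ × Space N → Space N} {θ₀ : Space N → ℝ}
    (hf : IntegrableOn f (cylinder Ω T)) (hG : IntegrableOn G (cylinder Ω T))
    (hθ₀ : IntegrableOn θ₀ Ω) : MemContNegSobolev Ω T s (timeRepresentative hf hG hθ₀) where
  norm_lt_top t _ := (negSobolevNorm_le hbd hs fun φ B h₁ h₂ =>
    abs_timeRepresentative_le hf hG hθ₀ t h₁ h₂).trans_lt ENNReal.ofReal_lt_top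
  continuous t _ := by
    have hle : ∀ t', negSobolevNorm Ω s
        (timeRepresentative hf hG hθ₀ t' - timeRepresentative hf hG hθ₀ t) ≤
        ENNReal.ofReal (|∫ τ in t..t', fluxNorm Ω T f G τ| *
          (volume (Ω : Set (Space N)) ^ (1 / 2 : ℝ)).toReal) := fun t' =>
      negSobolevNorm_le hbd hs fun φ B h₁ h₂ => by
        rw [LinearMap.sub_apply, timeRepresentative_apply, timeRepresentative_apply,
          add_sub_add_left_eq_sub, intervalIntegral.integral_interval_sub_left
            (integrable_fluxPairing hf hG φ).intervalIntegrable
            (integrable_fluxPairing hf hG φ).intervalIntegrable]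
        exact abs_integral_fluxPairing_le hf hG t t' h₁ h₂
    have hc : Continuous fun t' => ENNReal.ofReal (|∫ τ in t..t', fluxNorm Ω T f G τ| *
          (volume (Ω : Set (Space N)) ^ (1 / 2 : ℝ)).toReal) :=
      ENNReal.continuous_ofReal.comp ((intervalIntegral.continuous_primitive
        (fun a b => (integrable_fluxNorm hf hG).intervalIntegrable) t).abs.mul continuous_const)
    have h0 := (hc.tendsto t).mono_left (nhdsWithin_le_nhds (s := Icc 0 T))
    simp only [intervalIntegral.integral_same, abs_zero, zero_mul, ENNReal.ofReal_zero] at h0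
    exact tendsto_of_tendsto_of_tendsto_of_le_of_le tendsto_const_nhds h0 (fun _ => zero_le)
      hle

/-- This is the weak formulation tested with products `η(t) φ(x)`. -/
theorem ae_integral_mul_testFunction_eq {N : ℕ} {Ω : Opens (Space N)} {T : ℝ} (hT : 0 < T)
    {f θ : ℝ × Space N → ℝ} {G : ℝ × Space N → Space N} {θ₀ : Space N → ℝ}
    (hf : IntegrableOn f (cylinder Ω T)) (hG : IntegrableOn G (cylinder Ω T))
    (hθ : IntegrableOn θ (cylinder Ω T))
    (hθ₀ : IntegrableOn θ₀ Ω) (hsol : IsWeakNeumannHeatSolution Ω T f θ₀ θ G) (φ : 𝓓(Ω, ℝ)) :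
    ∀ᵐ t ∂(volume.restrict (Ioo 0 T)), ∫ x in (Ω : Set (Space N)), θ (t, x) * φ x =
      timeRepresentative hf hG hθ₀ t φ := by
  have hv := integrable_mul_testFunction_cylinder hθ φ
  have h1 := integrable_mul_testFunction_cylinder hf φ
  have h2 := integrable_inner_gradient_testFunction_cylinder hG φ
  refine ae_eq_add_integral_of_weak_deriv hT ?_ (integrable_fluxPairing hf hG φ).integrableOn ?_
  · rw [IntegrableOn, volume_restrict_cylinder] at hv
    exact hv.integral_prod_left
  intro η hη hηT
  have key := hsol (fun z => η z.1 * φ z.2)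
    ((hη.comp contDiff_fst).mul (φ.contDiff.comp contDiff_snd)) (fun x _ => by simp [hηT])
  have hηc : Continuous (deriv η) := hη.continuous_deriv (by exact_mod_cast le_top)
  have e1 : ∀ z : ℝ × Space N, θ z * deriv (fun τ => η τ * φ z.2) z.1 =
      θ z * φ z.2 * deriv η z.1 := fun z => by
    rw [deriv_mul_const_field]; ring
  have e2 : ∀ z : ℝ × Space N, inner ℝ (G z) (gradient (fun y => η z.1 * φ y) z.2) =
      inner ℝ (G z) (gradient φ z.2) * η z.1 := fun z => by
    have : (fun y => η z.1 * φ y) = η z.1 • (φ : Space N → ℝ) := rfl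
    rw [this, gradient_smul_of_contDiff (φ.contDiff.of_le (by exact_mod_cast le_top)),
      Pi.smul_apply, inner_smul_right, mul_comm]
  have e3 : ∀ z : ℝ × Space N, f z * (η z.1 * φ z.2) = f z * φ z.2 * η z.1 := fun z => by ring
  have e4 : ∀ x, θ₀ x * (η 0 * φ x) = θ₀ x * φ x * η 0 := fun x => by ring
  simp only [e1, e2, e3, e4] at key
  rw [integral_cylinder_mul hv hηc, integral_cylinder_mul h2 hη.continuous,
    integral_cylinder_mul h1 hη.continuous, integral_mul_const] at key
  have e5 : ∫ t in Ioo 0 T, fluxPairing Ω T f G φ t * η t =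
      (∫ t in Ioo 0 T, (∫ x in (Ω : Set (Space N)), f (t, x) * φ x) * η t) -
      ∫ t in Ioo 0 T, (∫ x in (Ω : Set (Space N)), inner ℝ (G (t, x)) (gradient φ x)) * η t := by
    obtain ⟨B, hB⟩ := isCompact_Icc (a := (0 : ℝ)) (b := T) |>.exists_bound_of_continuousOn
      hη.continuous.continuousOn
    have hm : ∀ {w : ℝ → ℝ}, IntegrableOn w (Ioo 0 T) →
        IntegrableOn (fun t => w t * η t) (Ioo 0 T) := fun hw => by
      refine Integrable.mul_bdd (c := B) hw hη.continuous.aestronglyMeasurable ?_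
      filter_upwards [ae_restrict_mem measurableSet_Ioo] with t ht using
        hB _ (Ioo_subset_Icc_self ht)
    rw [IntegrableOn, volume_restrict_cylinder] at h1 h2
    rw [← integral_sub (hm h1.integral_prod_left) (hm h2.integral_prod_left)]
    refine setIntegral_congr_fun measurableSet_Ioo fun t ht => ?_
    simp only [fluxPairing, indicator_of_mem ht, sub_mul]
  rw [e5]
  linarith

/-- A weak solution has a representative which is continuous in time with values in a negative
Sobolev space: its time derivative is integrable in time with values in the dual of `C¹`. -/
theorem IsWeakNeumannHeatSolution.exists_timeRepresentative {N : ℕ} {Ω : Opens (Space N)}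
    (hbd : Bornology.IsBounded (Ω : Set (Space N))) {T s : ℝ} (hT : 0 < T)
    (hs : (N : ℝ) + 1 ≤ s)
    {f θ : ℝ × Space N → ℝ} {G : ℝ × Space N → Space N} {θ₀ : Space N → ℝ}
    (hsol : IsWeakNeumannHeatSolution Ω T f θ₀ θ G)
    (hf : IntegrableOn f (cylinder Ω T)) (hG : IntegrableOn G (cylinder Ω T))
    (hθ : IntegrableOn θ (cylinder Ω T)) (hθ₀ : IntegrableOn θ₀ Ω) :
    ∃ Θ : ℝ → (𝓓(Ω, ℝ) →ₗ[ℝ] ℝ), MemContNegSobolev Ω T s Θ ∧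
      (∀ᵐ t ∂(volume.restrict (Ioo 0 T)), Represents Ω (fun x => θ (t, x)) (Θ t)) ∧
      Represents Ω θ₀ (Θ 0) := by
  refine ⟨_, memContNegSobolev_timeRepresentative hbd hs hf hG hθ₀, ?_, hθ₀, fun φ => by
    simp [timeRepresentative_apply]⟩
  have key := ae_forall_testFunction hbd (μ := volume.restrict (Ioo 0 T))
    (L := fun t φ => timeRepresentative hf hG hθ₀ t φ -
      ∫ x in (Ω : Set (Space N)), θ (t, x) * φ x) ?_ fun φ => ?_
  · filter_upwards [key, ae_integrableOn_slice hθ] with t ht hti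
    exact ⟨hti, fun φ => sub_eq_zero.1 (ht φ)⟩
  · filter_upwards [ae_integrableOn_slice hθ] with t ht
    refine ⟨((∫ x in (Ω : Set (Space N)), ‖θ₀ x‖) + |∫ τ in (0 : ℝ)..t, fluxNorm Ω T f G τ|) +
      ∫ x in (Ω : Set (Space N)), ‖θ (t, x)‖, fun φ ψ B h₁ h₂ => ?_⟩
    have e1 : (∫ x in (Ω : Set (Space N)), θ (t, x) * φ x) -
        ∫ x in (Ω : Set (Space N)), θ (t, x) * ψ x =
        ∫ x in (Ω : Set (Space N)), θ (t, x) * (φ x - ψ x) := by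
      rw [← integral_sub (integrable_mul_testFunction ht φ) (integrable_mul_testFunction ht ψ)]
      exact integral_congr_ae (Eventually.of_forall fun x => (mul_sub _ _ _).symm)
    have e2 := abs_integral_mul_le (φ := fun x => φ x - ψ x) ht h₁
    have e3 := abs_timeRepresentative_le hf hG hθ₀ t (φ := φ - ψ) h₁
      (by rw [gradient_sub_testFunction]; exact h₂)
    rw [sub_sub_sub_comm, ← map_sub, e1, add_mul]
    exact (norm_sub_le _ _).trans (add_le_add e3 e2)
  · filter_upwards [ae_integral_mul_testFunction_eq hT hf hG hθ hθ₀ hsol φ] with t ht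
    rw [ht, sub_self]

/-! ### Functions which are constant in time on the steps of a grid -/

/-- The index `k` of the time step `(kh, (k+1)h]` to which `t` belongs. -/
noncomputable def stepIdx (h t : ℝ) : ℕ := ⌈t / h⌉₊ - 1

theorem measurable_stepIdx (h : ℝ) : Measurable (stepIdx h) :=
  (measurable_from_nat (f := fun n => n - 1)).comp
    (Nat.measurable_ceil.comp (measurable_id.div_const h))

theorem stepIdx_eq {h t : ℝ} (hh : 0 < h) {k : ℕ} (ht : t ∈ Ioc (k * h) ((k + 1 : ℕ) * h)) :
    stepIdx h t = k := by
  have : ⌈t / h⌉₊ = k + 1 := by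
    rw [Nat.ceil_eq_iff (by omega)]
    refine ⟨?_, ?_⟩
    · rw [lt_div_iff₀ hh]; simpa using ht.1
    · rw [div_le_iff₀ hh]; exact ht.2
  rw [stepIdx, this]; rfl

theorem abs_stepIdx_mul_sub_le {h t : ℝ} (hh : 0 < h) (ht : 0 < t) :
    |stepIdx h t * h - t| ≤ h ∧ stepIdx h t * h ∈ Icc 0 t := by
  have h0 : 0 < ⌈t / h⌉₊ := Nat.ceil_pos.2 (div_pos ht hh)
  have h1 : (stepIdx h t : ℝ) = ⌈t / h⌉₊ - 1 := by
    rw [stepIdx, Nat.cast_sub h0]; simp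
  have h2 : (⌈t / h⌉₊ : ℝ) < t / h + 1 := Nat.ceil_lt_add_one (by positivity)
  have h3 := Nat.le_ceil (t / h)
  have h4 : stepIdx h t * h < t := by
    rw [h1, ← lt_div_iff₀ hh]; linarith
  have h5 : t ≤ (stepIdx h t + 1) * h := by
    rw [h1, ← div_le_iff₀ hh]; linarith
  refine ⟨?_, by positivity, h4.le⟩
  rw [abs_le]; constructor <;> linarith

theorem stronglyMeasurable_step {N : ℕ} {E : Type*} [NormedAddCommGroup E]
    [SecondCountableTopology E] {w : ℕ → Space N → E} (hw : ∀ k, StronglyMeasurable (w k)) (h : ℝ) :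
    StronglyMeasurable fun z : ℝ × Space N => w (stepIdx h z.1) z.2 := by
  borelize E
  have h1 : Measurable fun p : ℕ × Space N => w p.1 p.2 :=
    measurable_from_prod_countable_right fun k => (hw k).measurable
  exact (h1.comp (((measurable_stepIdx h).comp measurable_fst).prodMk
    measurable_snd)).stronglyMeasurable

theorem lintegral_Ioc_step {h : ℝ} (hh : 0 < h) (g : ℕ → ℝ≥0∞) (m : ℕ) :
    ∫⁻ t in Ioc 0 (m * h), g (stepIdx h t) = ∑ k ∈ Finset.range m, ENNReal.ofReal h * g k := by
  induction m with
  | zero => simp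
  | succ m ih =>
    have h1 : (m : ℝ) * h ≤ (m + 1 : ℕ) * h := by push_cast; nlinarith
    rw [← Ioc_union_Ioc_eq_Ioc (by positivity : (0 : ℝ) ≤ m * h) h1,
      lintegral_union measurableSet_Ioc (Ioc_disjoint_Ioc_of_le le_rfl), ih,
      Finset.sum_range_succ]
    congr 1
    rw [setLIntegral_congr_fun measurableSet_Ioc (g := fun _ => g m)
      (fun t ht => by simp only [stepIdx_eq hh ht]), setLIntegral_const, Real.volume_Ioc, mul_comm]
    congr 2
    push_cast; ring

theorem lintegral_cylinder_step {N : ℕ} {Ω : Opens (Space N)} {T h : ℝ} {m : ℕ} (hh : 0 < h)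
    (hm : m * h = T) {w : ℕ → Space N → ℝ≥0∞} (hw : ∀ k, Measurable (w k)) :
    ∫⁻ z in cylinder Ω T, w (stepIdx h z.1) z.2 =
      ∑ k ∈ Finset.range m, ENNReal.ofReal h * ∫⁻ x in (Ω : Set (Space N)), w k x := by
  have h1 : Measurable fun p : ℕ × Space N => w p.1 p.2 :=
    measurable_from_prod_countable_right fun k => hw k
  have h2 : Measurable fun z : ℝ × Space N => w (stepIdx h z.1) z.2 :=
    h1.comp (((measurable_stepIdx h).comp measurable_fst).prodMk measurable_snd)
  rw [volume_restrict_cylinder, lintegral_prod _ h2.aemeasurable, restrict_Ioo_eq_restrict_Ioc,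
    ← hm]
  exact lintegral_Ioc_step hh (fun k => ∫⁻ x in (Ω : Set (Space N)), w k x) m

theorem integrableOn_cylinder_step {N : ℕ} {E : Type*} [NormedAddCommGroup E]
    [SecondCountableTopology E] {Ω : Opens (Space N)} {T h : ℝ} {m : ℕ}
    (hh : 0 < h) (hm : m * h = T) {w : ℕ → Space N → E} (hw : ∀ k, StronglyMeasurable (w k))
    (hi : ∀ k, IntegrableOn (w k) Ω) :
    IntegrableOn (fun z => w (stepIdx h z.1) z.2) (cylinder Ω T) := by
  refine ⟨(stronglyMeasurable_step hw h).aestronglyMeasurable, ?_⟩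
  rw [HasFiniteIntegral, lintegral_cylinder_step hh hm (w := fun k x => ‖w k x‖ₑ)
    fun k => (hw k).enorm]
  exact ENNReal.sum_lt_top.2 fun k _ => ENNReal.mul_lt_top ENNReal.ofReal_lt_top (hi k).2

theorem integral_cylinder_eq_sum {N : ℕ} {Ω : Opens (Space N)} {T h : ℝ} {m : ℕ}
    (hh : 0 < h) (hm : m * h = T) {F : ℝ × Space N → ℝ} (hF : IntegrableOn F (cylinder Ω T)) :
    ∫ z in cylinder Ω T, F z = ∑ k ∈ Finset.range m, ∫ t in (k * h)..((k + 1 : ℕ) * h),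
      ∫ x in (Ω : Set (Space N)), F (t, x) := by
  have hT : 0 ≤ T := by rw [← hm]; positivity
  rw [IntegrableOn, volume_restrict_cylinder] at hF
  rw [volume_restrict_cylinder, integral_prod _ hF, ← integral_Ioc_eq_integral_Ioo,
    ← intervalIntegral.integral_of_le hT]
  have hI : IntervalIntegrable (fun t => ∫ x in (Ω : Set (Space N)), F (t, x)) volume 0 T :=
    (intervalIntegrable_iff_integrableOn_Ioo_of_le hT).2 hF.integral_prod_left
  have := intervalIntegral.sum_integral_adjacent_intervals (μ := volume)
    (f := fun t => ∫ x in (Ω : Set (Space N)), F (t, x)) (a := fun k : ℕ => (k : ℝ) * h) (n := m)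
    fun k hk => hI.mono_set ?_
  · rw [this]; simp [hm]
  · have h1 : (k : ℝ) * h ≤ (k + 1 : ℕ) * h := by push_cast; nlinarith
    have h2 : ((k + 1 : ℕ) : ℝ) * h ≤ m * h := by gcongr; exact_mod_cast hk
    rw [uIcc_of_le h1, uIcc_of_le hT]
    exact Icc_subset_Icc (by positivity) (hm ▸ h2)

theorem integral_cylinder_step {N : ℕ} {Ω : Opens (Space N)} {T h : ℝ} {m : ℕ}
    (hh : 0 < h) (hm : m * h = T) {w : ℕ → Space N → ℝ} (hw : ∀ k, StronglyMeasurable (w k))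
    (hi : ∀ k, IntegrableOn (w k) Ω) :
    ∫ z in cylinder Ω T, w (stepIdx h z.1) z.2 =
      ∑ k ∈ Finset.range m, h * ∫ x in (Ω : Set (Space N)), w k x := by
  rw [integral_cylinder_eq_sum hh hm (integrableOn_cylinder_step hh hm hw hi)]
  refine Finset.sum_congr rfl fun k _ => ?_
  have h1 : (k : ℝ) * h ≤ (k + 1 : ℕ) * h := by push_cast; nlinarith
  rw [intervalIntegral.integral_congr_ae (g := fun _ => ∫ x in (Ω : Set (Space N)), w k x)
    (Eventually.of_forall fun t ht => by
      rw [uIoc_of_le h1] at ht; simp only [stepIdx_eq hh ht]), intervalIntegral.integral_const,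
    smul_eq_mul]
  congr 1
  push_cast; ring

/-! ### Slices of smooth space-time test functions -/

theorem contDiff_slice {N : ℕ} {ψ : ℝ × Space N → ℝ} (hψ : ContDiff ℝ ∞ ψ) (t : ℝ) :
    ContDiff ℝ 1 fun x => ψ (t, x) :=
  (hψ.comp (contDiff_const.prodMk contDiff_id)).of_le (by exact_mod_cast le_top)

theorem hasDerivAt_time {N : ℕ} {ψ : ℝ × Space N → ℝ} (hψ : ContDiff ℝ ∞ ψ) (z : ℝ × Space N) :
    HasDerivAt (fun τ => ψ (τ, z.2)) (fderiv ℝ ψ z (1, 0)) z.1 := by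
  have h1 : HasFDerivAt ψ (fderiv ℝ ψ z) (z.1, z.2) :=
    (hψ.differentiable (by simp) z).hasFDerivAt
  exact h1.comp_hasDerivAt z.1 ((hasDerivAt_id z.1).prodMk (hasDerivAt_const z.1 z.2))

theorem continuous_deriv_time {N : ℕ} {ψ : ℝ × Space N → ℝ} (hψ : ContDiff ℝ ∞ ψ) :
    Continuous fun z : ℝ × Space N => deriv (fun τ => ψ (τ, z.2)) z.1 := by
  simp only [(hasDerivAt_time hψ _).deriv]
  exact (hψ.continuous_fderiv (by simp)).clm_apply continuous_const

theorem continuous_gradient_slice {N : ℕ} {ψ : ℝ × Space N → ℝ} (hψ : ContDiff ℝ ∞ ψ) :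
    Continuous fun z : ℝ × Space N => gradient (fun y => ψ (z.1, y)) z.2 := by
  have h1 : ∀ z : ℝ × Space N, fderiv ℝ (fun y => ψ (z.1, y)) z.2 =
      (fderiv ℝ ψ z).comp (ContinuousLinearMap.inr ℝ ℝ (Space N)) := fun z => by
    have h1 : HasFDerivAt ψ (fderiv ℝ ψ z) (z.1, z.2) :=
      (hψ.differentiable (by simp) z).hasFDerivAt
    exact (h1.comp z.2 (hasFDerivAt_prodMk_right z.1 z.2)).fderiv
  simp only [gradient, h1]
  exact (LinearIsometryEquiv.continuous _).comp
    ((hψ.continuous_fderiv (by simp)).clm_comp continuous_const)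

theorem isCompact_closedCylinder {N : ℕ} {Ω : Opens (Space N)}
    (hbd : Bornology.IsBounded (Ω : Set (Space N))) (T : ℝ) :
    IsCompact (Icc 0 T ×ˢ closure (Ω : Set (Space N))) :=
  isCompact_Icc.prod hbd.isCompact_closure

theorem measurableSet_cylinder {N : ℕ} (Ω : Opens (Space N)) (T : ℝ) :
    MeasurableSet (cylinder Ω T) := measurableSet_Ioo.prod Ω.isOpen.measurableSet

theorem exists_bound_cylinder {N : ℕ} {E : Type*} [NormedAddCommGroup E] {Ω : Opens (Space N)}
    (hbd : Bornology.IsBounded (Ω : Set (Space N))) (T : ℝ) {F : ℝ × Space N → E}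
    (hF : Continuous F) : ∃ B, 0 ≤ B ∧ ∀ t ∈ Icc 0 T, ∀ x ∈ Ω, ‖F (t, x)‖ ≤ B := by
  obtain ⟨B, hB⟩ := (isCompact_closedCylinder hbd T).exists_bound_of_continuousOn hF.continuousOn
  exact ⟨max B 0, le_max_right _ _, fun t ht x hx =>
    (hB _ ⟨ht, subset_closure hx⟩).trans (le_max_left _ _)⟩

/-- A continuous function on space-time is uniformly close to its piecewise constant
interpolation at the left grid points, if the step is small. -/
theorem exists_step_close {N : ℕ} {E : Type*} [NormedAddCommGroup E] {Ω : Opens (Space N)}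
    (hbd : Bornology.IsBounded (Ω : Set (Space N))) (T : ℝ) {F : ℝ × Space N → E}
    (hF : Continuous F) {ε : ℝ} (hε : 0 < ε) :
    ∃ δ > 0, ∀ h, 0 < h → h < δ → ∀ z ∈ cylinder Ω T,
      ‖F (stepIdx h z.1 * h, z.2) - F z‖ ≤ ε := by
  obtain ⟨δ, hδ, H⟩ := Metric.uniformContinuousOn_iff.1
    ((isCompact_closedCylinder hbd T).uniformContinuousOn_of_continuous hF.continuousOn) ε hε
  refine ⟨δ, hδ, fun h hh hlt z hz => ?_⟩
  obtain ⟨h1, h2⟩ := abs_stepIdx_mul_sub_le hh hz.1.1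
  rw [← dist_eq_norm]
  refine (H (stepIdx h z.1 * h, z.2) ⟨⟨h2.1, h2.2.trans hz.1.2.le⟩, subset_closure hz.2⟩ z
    ⟨Ioo_subset_Icc_self hz.1, subset_closure hz.2⟩ ?_).le
  rw [Prod.dist_eq, dist_self, max_eq_left dist_nonneg, Real.dist_eq]
  exact h1.trans_lt hlt

/-! ### The weak formulation of the discrete problem -/

theorem integral_cylinder_step_mul_deriv {N : ℕ} {Ω : Opens (Space N)}
    (hbd : Bornology.IsBounded (Ω : Set (Space N))) {T h : ℝ} {m : ℕ} (hh : 0 < h)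
    (hm : m * h = T) {w : ℕ → Space N → ℝ} (hw : ∀ k, StronglyMeasurable (w k))
    (hi : ∀ k, IntegrableOn (w k) Ω) {ψ : ℝ × Space N → ℝ} (hψ : ContDiff ℝ ∞ ψ) :
    ∫ z in cylinder Ω T, w (stepIdx h z.1) z.2 * deriv (fun τ => ψ (τ, z.2)) z.1 =
      ∑ k ∈ Finset.range m, ∫ x in (Ω : Set (Space N)),
        w k x * (ψ ((k + 1 : ℕ) * h, x) - ψ (k * h, x)) := by
  have hc := continuous_deriv_time hψ
  have hT : 0 ≤ T := by rw [← hm]; positivity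
  obtain ⟨B, hB0, hB⟩ := exists_bound_cylinder hbd T hc
  have hint : IntegrableOn (fun z : ℝ × Space N => w (stepIdx h z.1) z.2 *
      deriv (fun τ => ψ (τ, z.2)) z.1) (cylinder Ω T) := by
    refine Integrable.mul_bdd (c := B) (integrableOn_cylinder_step hh hm hw hi)
      hc.aestronglyMeasurable ?_
    filter_upwards [ae_restrict_mem (measurableSet_cylinder Ω T)] with z hz using
      hB _ (Ioo_subset_Icc_self hz.1) _ hz.2
  rw [integral_cylinder_eq_sum hh hm hint]
  refine Finset.sum_congr rfl fun k hk => ?_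
  have h1 : (k : ℝ) * h ≤ (k + 1 : ℕ) * h := by push_cast; nlinarith
  have h2 : ((k + 1 : ℕ) : ℝ) * h ≤ T := by
    rw [← hm]; gcongr; exact_mod_cast Finset.mem_range.1 hk
  have e1 : ∫ t in (k * h)..((k + 1 : ℕ) * h), ∫ x in (Ω : Set (Space N)),
      w (stepIdx h t) x * deriv (fun τ => ψ (τ, x)) t =
      ∫ t in (k * h)..((k + 1 : ℕ) * h), ∫ x in (Ω : Set (Space N)),
      w k x * deriv (fun τ => ψ (τ, x)) t := by
    refine intervalIntegral.integral_congr_ae (Eventually.of_forall fun t ht => ?_)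
    rw [uIoc_of_le h1] at ht
    simp only [stepIdx_eq hh ht]
  rw [e1, intervalIntegral_integral_swap (f := fun t x => w k x * deriv (fun τ => ψ (τ, x)) t)]
  · refine integral_congr_ae (Eventually.of_forall fun x => ?_)
    dsimp only
    rw [intervalIntegral.integral_const_mul, intervalIntegral.integral_eq_sub_of_hasDerivAt
      (f := fun τ => ψ (τ, x)) (fun t _ => (hasDerivAt_time hψ (t, x)).differentiableAt.hasDerivAt)
      (hc.comp (by fun_prop : Continuous fun t : ℝ => (t, x))).continuousOn.intervalIntegrable]
  · have hw1 : Integrable (fun z : ℝ × Space N => w k z.2)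
        ((volume.restrict (uIoc (k * h) ((k + 1 : ℕ) * h))).prod
          (volume.restrict (Ω : Set (Space N)))) := by
      have : IsFiniteMeasure (volume.restrict (uIoc (k * h) ((k + 1 : ℕ) * h))) :=
        ⟨by rw [uIoc_of_le h1]; simp⟩
      exact Integrable.comp_snd (hi k) _
    refine Integrable.mul_bdd (c := B) hw1 hc.aestronglyMeasurable ?_
    rw [Measure.prod_restrict]
    filter_upwards [ae_restrict_mem (measurableSet_uIoc.prod Ω.isOpen.measurableSet)] with z hz
    have hz1 := hz.1
    rw [uIoc_of_le h1] at hz1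
    exact hB _ ⟨le_trans (by positivity) hz1.1.le, hz1.2.trans h2⟩ _ hz.2

/-- Summation by parts in time: the scheme satisfies the weak formulation exactly, if the test
function is sampled at the left grid points wherever it is not differentiated in time. -/
theorem IsRothe.discrete_weak_form {N : ℕ} {Ω : Opens (Space N)}
    (hbd : Bornology.IsBounded (Ω : Set (Space N))) {T h : ℝ} {m : ℕ} (hh : 0 < h)
    (hm : m * h = T) {f u : ℕ → Space N → ℝ} {G : ℕ → Space N → Space N}
    (hR : IsRothe (Ω : Set (Space N)) h f u G) (hf : ∀ k, StronglyMeasurable (f k))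
    {ψ : ℝ × Space N → ℝ} (hψ : ContDiff ℝ ∞ ψ) (hψT : ∀ x ∈ Ω, ψ (T, x) = 0) :
    -(∫ z in cylinder Ω T, u (stepIdx h z.1 + 1) z.2 * deriv (fun τ => ψ (τ, z.2)) z.1)
      + ∫ z in cylinder Ω T, inner ℝ (G (stepIdx h z.1 + 1) z.2)
          (gradient (fun y => ψ (stepIdx h z.1 * h, y)) z.2)
    = (∫ z in cylinder Ω T, f (stepIdx h z.1) z.2 * ψ (stepIdx h z.1 * h, z.2))
      + ∫ x in (Ω : Set (Space N)), u 0 x * ψ (0, x) := by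
  have hfin : IsFiniteMeasure (volume.restrict (Ω : Set (Space N))) :=
    ⟨by rw [Measure.restrict_apply_univ]; exact hbd.measure_lt_top⟩
  have hT : 0 ≤ T := by rw [← hm]; positivity
  have hui : ∀ k, IntegrableOn (u k) Ω := fun k => (hR.memLp_fun k).integrable (by norm_num)
  have hfi : ∀ k, IntegrableOn (f k) Ω := fun k => (hR.memLp_source k).integrable (by norm_num)
  have hGi : ∀ k, IntegrableOn (G (k + 1)) Ω := fun k =>
    (hR.hasStrongGradient k).memLp_grad.integrable (by norm_num)
  have hs : ∀ t, Continuous fun x => ψ (t, x) := fun t => (contDiff_slice hψ t).continuous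
  have hgs : ∀ t, Continuous (gradient fun x => ψ (t, x)) := fun t =>
    continuous_gradient (contDiff_slice hψ t)
  have hb : ∀ {E : Type} [NormedAddCommGroup E] {F : Space N → E}, Continuous F →
      ∃ B, ∀ᵐ x ∂(volume.restrict (Ω : Set (Space N))), ‖F x‖ ≤ B := fun hF => by
    obtain ⟨B, hB⟩ := hbd.isCompact_closure.exists_bound_of_continuousOn hF.continuousOn
    refine ⟨B, ?_⟩
    filter_upwards [ae_restrict_mem Ω.isOpen.measurableSet] with x hx using
      hB x (subset_closure hx)
  have hmul : ∀ {w : Space N → ℝ}, IntegrableOn w Ω → ∀ t,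
      IntegrableOn (fun x => w x * ψ (t, x)) Ω := fun hw t => by
    obtain ⟨B, hB⟩ := hb (hs t)
    exact Integrable.mul_bdd hw (hs t).aestronglyMeasurable hB
  rw [integral_cylinder_step_mul_deriv hbd hh hm (w := fun k => u (k + 1))
      (fun k => hR.stronglyMeasurable_fun _) (fun k => hui _) hψ,
    integral_cylinder_step hh hm
      (w := fun k x => inner ℝ (G (k + 1) x) (gradient (fun y => ψ (k * h, y)) x))
      (fun k => (hR.stronglyMeasurable_grad _).inner (hgs _).stronglyMeasurable) (fun k => by
        obtain ⟨B, hB⟩ := hb (hgs (k * h))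
        exact integrable_inner_of_bounded (hGi k) (hgs _).aestronglyMeasurable hB),
    integral_cylinder_step hh hm (w := fun k x => f k x * ψ (k * h, x))
      (fun k => (hf k).mul (hs _).stronglyMeasurable) (fun k => hmul (hfi k) _)]
  set a : ℕ → ℝ := fun k => ∫ x in (Ω : Set (Space N)), u k x * ψ (k * h, x) with ha
  have ham : a m = 0 := by
    refine setIntegral_eq_zero_of_forall_eq_zero fun x hx => ?_
    rw [hm, hψT x hx, mul_zero]
  have ha0 : a 0 = ∫ x in (Ω : Set (Space N)), u 0 x * ψ (0, x) := by simp [ha]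
  have key : ∀ k ∈ Finset.range m,
      -(∫ x in (Ω : Set (Space N)), u (k + 1) x * (ψ ((k + 1 : ℕ) * h, x) - ψ (k * h, x))) +
        h * ∫ x in (Ω : Set (Space N)),
          inner ℝ (G (k + 1) x) (gradient (fun y => ψ (k * h, y)) x) =
      (h * ∫ x in (Ω : Set (Space N)), f k x * ψ (k * h, x)) + (a k - a (k + 1)) := by
    intro k _
    have h1 := hR.integral_eq k _ (contDiff_slice hψ (k * h))
    have e1 : ∫ x in (Ω : Set (Space N)), (u k x + h * f k x) * ψ (k * h, x) =
        a k + h * ∫ x in (Ω : Set (Space N)), f k x * ψ (k * h, x) := by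
      rw [← integral_const_mul, ha, ← integral_add (hmul (hui k) _) ((hmul (hfi k) _).const_mul h)]
      exact integral_congr_ae (Eventually.of_forall fun x => by dsimp only; ring)
    have e2 : ∫ x in (Ω : Set (Space N)), u (k + 1) x * (ψ ((k + 1 : ℕ) * h, x) - ψ (k * h, x)) =
        a (k + 1) - ∫ x in (Ω : Set (Space N)), u (k + 1) x * ψ (k * h, x) := by
      rw [ha, ← integral_sub (hmul (hui _) _) (hmul (hui _) _)]
      exact integral_congr_ae (Eventually.of_forall fun x => by dsimp only; ring)
    rw [e1] at h1
    rw [e2]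
    linarith
  have hsum := Finset.sum_congr rfl key
  rw [Finset.sum_add_distrib, Finset.sum_add_distrib, Finset.sum_neg_distrib,
    Finset.sum_range_sub', ham, sub_zero, ha0] at hsum
  exact hsum

theorem tendsto_integral_norm_sub_of_eLpNorm_two {N : ℕ} {E : Type*} [NormedAddCommGroup E]
    {Ω : Set (Space N)} (hbd : Bornology.IsBounded Ω) {w : ℕ → Space N → E} {u : Space N → E}
    (hw : ∀ n, AEStronglyMeasurable (w n) (volume.restrict Ω))
    (hu : AEStronglyMeasurable u (volume.restrict Ω))
    (h : Tendsto (fun n => eLpNorm (w n - u) 2 (volume.restrict Ω)) atTop (𝓝 0)) :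
    Tendsto (fun n => ∫ x in Ω, ‖w n x - u x‖) atTop (𝓝 0) := by
  have hvol : volume Ω ^ (1 / 2 : ℝ) ≠ ⊤ :=
    ENNReal.rpow_ne_top_of_nonneg (by norm_num) hbd.measure_lt_top.ne
  have h1 : Tendsto (fun n => ∫⁻ x in Ω, ‖(w n - u) x‖ₑ) atTop (𝓝 0) := by
    have h2 := ENNReal.Tendsto.mul_const (b := volume Ω ^ (1 / 2 : ℝ)) h (Or.inr hvol)
    rw [zero_mul] at h2
    exact tendsto_of_tendsto_of_tendsto_of_le_of_le tendsto_const_nhds h2 (fun _ => zero_le)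
      fun n => lintegral_enorm_le_eLpNorm_two ((hw n).sub hu)
  have h2 := (ENNReal.tendsto_toReal ENNReal.zero_ne_top).comp h1
  refine h2.congr fun n => ?_
  exact (integral_norm_eq_lintegral_enorm ((hw n).sub hu)).symm

/-- A strong gradient is a weak gradient, tested in a fixed direction. -/
theorem HasStrongGradient.integral_mul_inner_gradient {N : ℕ} {Ω : Opens (Space N)}
    (hbd : Bornology.IsBounded (Ω : Set (Space N))) {u : Space N → ℝ} {G : Space N → Space N}
    (h : HasStrongGradient (Ω : Set (Space N)) u G) (φ : 𝓓(Ω, ℝ)) (e : Space N) :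
    ∫ x in (Ω : Set (Space N)), u x * inner ℝ (gradient φ x) e =
      -∫ x in (Ω : Set (Space N)), inner ℝ (G x) (φ x • e) := by
  have hfin : IsFiniteMeasure (volume.restrict (Ω : Set (Space N))) :=
    ⟨by rw [Measure.restrict_apply_univ]; exact hbd.measure_lt_top⟩
  obtain ⟨w, hw, h1, h2, -⟩ := h.exists_seq
  obtain ⟨B, hB0, hB, hB'⟩ := exists_bound_testFunction φ
  have hui : IntegrableOn u Ω := h.memLp_fun.integrable (by norm_num)
  have hGi : IntegrableOn G Ω := h.memLp_grad.integrable (by norm_num)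
  have hwi : ∀ n, IntegrableOn (w n) Ω := fun n =>
    (memLp_of_continuous hbd (hw n).continuous 1).integrable le_rfl
  have hwi' : ∀ n, IntegrableOn (gradient (w n)) Ω := fun n =>
    (memLp_of_continuous hbd (continuous_gradient (hw n)) 1).integrable le_rfl
  have hc1 : Continuous fun x => inner ℝ (gradient φ x) e :=
    (continuous_gradient_testFunction φ).inner continuous_const
  have hc2 : Continuous fun x => φ x • e := φ.continuous.smul continuous_const
  have hb1 : ∀ x, ‖inner ℝ (gradient φ x) e‖ ≤ B * ‖e‖ := fun x =>
    (norm_inner_le_norm _ _).trans (mul_le_mul_of_nonneg_right (hB' x) (norm_nonneg _))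
  have hb2 : ∀ x, ‖φ x • e‖ ≤ B * ‖e‖ := fun x => by
    rw [norm_smul]; exact mul_le_mul_of_nonneg_right (hB x) (norm_nonneg _)
  have hm1 : ∀ {v : Space N → ℝ}, IntegrableOn v Ω →
      IntegrableOn (fun x => v x * inner ℝ (gradient φ x) e) Ω := fun hv =>
    Integrable.mul_bdd hv hc1.aestronglyMeasurable (Eventually.of_forall hb1)
  have hm2 : ∀ {v : Space N → Space N}, IntegrableOn v Ω →
      IntegrableOn (fun x => inner ℝ (v x) (φ x • e)) Ω := fun hv =>
    integrable_inner_of_bounded hv hc2.aestronglyMeasurable (Eventually.of_forall hb2)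
  -- For a `C¹` function the identity is an integration by parts in the whole space.
  have key : ∀ n, ∫ x in (Ω : Set (Space N)), w n x * inner ℝ (gradient φ x) e =
      -∫ x in (Ω : Set (Space N)), inner ℝ (gradient (w n) x) (φ x • e) := by
    intro n
    have hφ : ContDiff ℝ 1 φ := φ.contDiff.of_le (by exact_mod_cast le_top)
    simp only [inner_smul_right, inner_gradient]
    rw [setIntegral_eq_integral_of_forall_compl_eq_zero (fun x hx => by
        rw [← inner_gradient, gradient_eq_zero_of_notMem φ hx]; simp),
      setIntegral_eq_integral_of_forall_compl_eq_zero (fun x hx => by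
        rw [testFunction_eq_zero_of_notMem φ hx]; simp)]
    have hc3 : Continuous fun x => fderiv ℝ (w n) x e :=
      ((hw n).continuous_fderiv one_ne_zero).clm_apply continuous_const
    have hc4 : Continuous fun x => fderiv ℝ φ x e :=
      (hφ.continuous_fderiv one_ne_zero).clm_apply continuous_const
    rw [integral_mul_fderiv_eq_neg_fderiv_mul_of_integrable]
    · congr 1
      exact integral_congr_ae (Eventually.of_forall fun x => mul_comm _ _)
    · exact (hc3.mul φ.continuous).integrable_of_hasCompactSupport
        φ.hasCompactSupport.mul_left
    · exact ((hw n).continuous.mul hc4).integrable_of_hasCompactSupport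
        (φ.hasCompactSupport.fderiv_apply ℝ e).mul_left
    · exact ((hw n).continuous.mul φ.continuous).integrable_of_hasCompactSupport
        φ.hasCompactSupport.mul_left
    · exact fun x _ => (hw n).differentiable one_ne_zero x
    · exact fun x _ => hφ.differentiable one_ne_zero x
  have lim1 : Tendsto (fun n => ∫ x in (Ω : Set (Space N)), ‖w n x - u x‖) atTop (𝓝 0) :=
    tendsto_integral_norm_sub_of_eLpNorm_two hbd (fun n => (hwi n).1) hui.1 h1
  have lim2 : Tendsto (fun n => ∫ x in (Ω : Set (Space N)), ‖gradient (w n) x - G x‖) atTop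
      (𝓝 0) :=
    tendsto_integral_norm_sub_of_eLpNorm_two hbd (fun n => (hwi' n).1) hGi.1 h2
  have hle : ∀ n, ‖(∫ x in (Ω : Set (Space N)), u x * inner ℝ (gradient φ x) e) +
      ∫ x in (Ω : Set (Space N)), inner ℝ (G x) (φ x • e)‖ ≤
      (∫ x in (Ω : Set (Space N)), ‖w n x - u x‖) * (B * ‖e‖) +
        (B * ‖e‖) * ∫ x in (Ω : Set (Space N)), ‖gradient (w n) x - G x‖ := by
    intro n
    have e1 : ∫ x in (Ω : Set (Space N)), (w n x - u x) * inner ℝ (gradient φ x) e =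
        (∫ x in (Ω : Set (Space N)), w n x * inner ℝ (gradient φ x) e) -
          ∫ x in (Ω : Set (Space N)), u x * inner ℝ (gradient φ x) e := by
      simp only [sub_mul]
      exact integral_sub (hm1 (hwi n)) (hm1 hui)
    have e2 : ∫ x in (Ω : Set (Space N)), inner ℝ (gradient (w n) x - G x) (φ x • e) =
        (∫ x in (Ω : Set (Space N)), inner ℝ (gradient (w n) x) (φ x • e)) -
          ∫ x in (Ω : Set (Space N)), inner ℝ (G x) (φ x • e) := by
      simp only [inner_sub_left]
      exact integral_sub (hm2 (hwi' n)) (hm2 hGi)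
    have b1 := abs_integral_mul_le (μ := volume.restrict (Ω : Set (Space N)))
      ((hwi n).sub hui) hb1
    have b2 := abs_integral_inner_le (μ := volume.restrict (Ω : Set (Space N)))
      ((hwi' n).sub hGi) (Eventually.of_forall hb2)
    simp only [Pi.sub_apply] at b1 b2
    rw [e1] at b1
    rw [e2] at b2
    have := key n
    rw [Real.norm_eq_abs, abs_le]
    rw [abs_le] at b1 b2
    constructor <;> linarith [b1.1, b1.2, b2.1, b2.2]
  have lim3 := (lim1.mul_const (B * ‖e‖)).add (lim2.const_mul (B * ‖e‖))
  simp only [zero_mul, mul_zero, add_zero] at lim3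
  have := ge_of_tendsto' lim3 hle
  exact eq_neg_of_add_eq_zero_left (norm_le_zero_iff.1 this)

/-! ### Approximate solutions -/

/-- `θ`, with spatial gradient `G`, solves the Neumann problem up to an error controlled by `δ`:
the weak formulation holds with data which are `δ`-close to `f` and `θ₀` in `L¹`, and with the
test function sampled at the left grid points of a time grid of step at most `δ` in the terms not
involving its time derivative. The bound `K` controls `θ` and `G` in `L^q`. -/
structure IsApproximateSolution {N : ℕ} (Ω : Opens (Space N)) (T q : ℝ) (f : ℝ × Space N → ℝ)
    (θ₀ : Space N → ℝ) (K : ℝ≥0∞) (δ : ℝ) (θ : ℝ × Space N → ℝ)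
    (G : ℝ × Space N → Space N) : Prop where
  stronglyMeasurable_fun : StronglyMeasurable θ
  stronglyMeasurable_grad : StronglyMeasurable G
  lintegral_le : ∫⁻ z in cylinder Ω T, (‖θ z‖ₑ ^ q + ‖G z‖ₑ ^ q) ≤ K
  hasStrongGradient : ∀ t, HasStrongGradient (Ω : Set (Space N)) (fun x => θ (t, x))
    (fun x => G (t, x))
  weak_form : ∃ (h : ℝ) (g : ℝ × Space N → ℝ) (v : Space N → ℝ), 0 < h ∧ h ≤ δ ∧
    IntegrableOn g (cylinder Ω T) ∧ IntegrableOn v Ω ∧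
    ∫ z in cylinder Ω T, ‖g z - f z‖ ≤ δ ∧ ∫ x in (Ω : Set (Space N)), ‖v x - θ₀ x‖ ≤ δ ∧
    ∀ ψ : ℝ × Space N → ℝ, ContDiff ℝ ∞ ψ → (∀ x ∈ Ω, ψ (T, x) = 0) →
      -(∫ z in cylinder Ω T, θ z * deriv (fun τ => ψ (τ, z.2)) z.1)
        + ∫ z in cylinder Ω T, inner ℝ (G z) (gradient (fun y => ψ (stepIdx h z.1 * h, y)) z.2)
      = (∫ z in cylinder Ω T, g z * ψ (stepIdx h z.1 * h, z.2))
        + ∫ x in (Ω : Set (Space N)), v x * ψ (0, x)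

theorem volume_cylinder_lt_top {N : ℕ} {Ω : Opens (Space N)}
    (hbd : Bornology.IsBounded (Ω : Set (Space N))) (T : ℝ) :
    volume (cylinder Ω T) < ⊤ := by
  rw [cylinder, Measure.volume_eq_prod, Measure.prod_prod]
  exact ENNReal.mul_lt_top (by simp) hbd.measure_lt_top

/-- Approximate solutions exist, with a bound which does not depend on the accuracy: the data are
replaced by continuous ones, and the implicit Euler scheme is solved with a small step. -/
theorem exists_isApproximateSolution {N : ℕ} (hN : 1 ≤ N) {Ω : Opens (Space N)}
    (hbd : Bornology.IsBounded (Ω : Set (Space N))) (hC : HasC1Boundary (Ω : Set (Space N)))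
    {T q : ℝ} (hT : 0 < T) (hq1 : 1 ≤ q) (hq : q < (2 * ((N : ℝ) + 1) - N) / (N + 1))
    {f : ℝ × Space N → ℝ} {θ₀ : Space N → ℝ} (hf : IntegrableOn f (cylinder Ω T))
    (hθ₀ : IntegrableOn θ₀ Ω) :
    ∃ K : ℝ≥0∞, K ≠ ⊤ ∧ ∀ δ, 0 < δ → δ ≤ 1 →
      ∃ θ G, IsApproximateSolution Ω T q f θ₀ K δ θ G := by
  have hQ := volume_cylinder_lt_top hbd T
  have hfin : IsFiniteMeasure (volume.restrict (cylinder Ω T)) :=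
    ⟨by rw [Measure.restrict_apply_univ]; exact hQ⟩
  have hfin' : IsFiniteMeasure (volume.restrict (Ω : Set (Space N))) :=
    ⟨by rw [Measure.restrict_apply_univ]; exact hbd.measure_lt_top⟩
  set V : ℝ := (volume (cylinder Ω T)).toReal with hV
  have hV0 : 0 ≤ V := ENNReal.toReal_nonneg
  obtain ⟨K, hK, H⟩ := exists_rothe_bound hN Ω.isOpen hbd hC hq1 hq T
    ((∫ x in (Ω : Set (Space N)), ‖θ₀ x‖) + 1 + ((∫ z in cylinder Ω T, ‖f z‖) + 1))
  refine ⟨K, hK, fun δ hδ hδ1 => ?_⟩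
  -- Half of the accuracy is spent on the replacement of `f` by a continuous function `g`, the other
  -- half on the replacement of `g` by a step function, uniformly up to `ε`.
  set ε : ℝ := δ / (2 * (V + 1)) with hε
  have hε0 : 0 < ε := by positivity
  have hεV : ε * V ≤ δ / 2 := by
    rw [hε, div_mul_eq_mul_div, div_le_div_iff₀ (by positivity) (by norm_num)]
    nlinarith
  have hmQ := measurableSet_cylinder Ω T
  have hmΩ : MeasurableSet (Ω : Set (Space N)) := Ω.isOpen.measurableSet
  have hf1 := (integrable_indicator_iff hmQ).2 hf
  have hθ1 := (integrable_indicator_iff hmΩ).2 hθ₀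
  obtain ⟨g, -, hg, hgc, hgi⟩ := hf1.exists_hasCompactSupport_integral_sub_le (half_pos hδ)
  obtain ⟨v, -, hv, hvc, hvi⟩ := hθ1.exists_hasCompactSupport_integral_sub_le hδ
  have hg' : ∫ z in cylinder Ω T, ‖g z - f z‖ ≤ δ / 2 := by
    refine le_trans (le_of_eq ?_) ((setIntegral_le_integral (s := cylinder Ω T)
      (hf1.sub hgi).norm (Eventually.of_forall fun _ => norm_nonneg _)).trans hg)
    refine setIntegral_congr_fun hmQ fun z hz => ?_
    simp only [Pi.sub_apply, indicator_of_mem hz]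
    exact norm_sub_rev _ _
  have hv' : ∫ x in (Ω : Set (Space N)), ‖v x - θ₀ x‖ ≤ δ := by
    refine le_trans (le_of_eq ?_) ((setIntegral_le_integral (s := (Ω : Set (Space N)))
      (hθ1.sub hvi).norm (Eventually.of_forall fun _ => norm_nonneg _)).trans hv)
    refine setIntegral_congr_fun hmΩ fun x hx => ?_
    simp only [Pi.sub_apply, indicator_of_mem hx]
    exact norm_sub_rev _ _
  obtain ⟨η, hη, hclose⟩ := exists_step_close hbd T hgc hε0
  obtain ⟨m, hm⟩ := exists_nat_gt (T / min δ η)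
  have hmin : 0 < min δ η := lt_min hδ hη
  have hm0 : (0 : ℝ) < m := (by positivity : 0 < T / min δ η).trans hm
  set h : ℝ := T / m with hh
  have hh0 : 0 < h := by positivity
  have hmh : m * h = T := by rw [hh]; field_simp
  have hlt : h < min δ η := by
    rw [hh, div_lt_iff₀ hm0, mul_comm]; exact (div_lt_iff₀ hmin).1 hm
  have hs : ∀ t, Continuous fun x => g (t, x) := fun t => hgc.comp (by fun_prop)
  set F : ℕ → Space N → ℝ := fun k x => g (k * h, x) with hF
  have hFm : ∀ k, StronglyMeasurable (F k) := fun k => (hs _).stronglyMeasurable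
  have hFi : ∀ k, IntegrableOn (F k) Ω := fun k =>
    (memLp_of_continuous hbd (hs _) 1).integrable le_rfl
  obtain ⟨u, G, hu0, hR⟩ := exists_isRothe hbd hh0 (f := F)
    (fun k => memLp_of_continuous hbd (hs _) 2) hvc.stronglyMeasurable
    (memLp_of_continuous hbd hvc 2)
  have hgn : IntegrableOn (fun z : ℝ × Space N => F (stepIdx h z.1) z.2) (cylinder Ω T) :=
    integrableOn_cylinder_step hh0 hmh hFm hFi
  have hgn' : ∫ z in cylinder Ω T, ‖F (stepIdx h z.1) z.2 - f z‖ ≤ δ := by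
    have h1 : ∀ z ∈ cylinder Ω T, ‖F (stepIdx h z.1) z.2 - f z‖ ≤ ε + ‖g z - f z‖ :=
      fun z hz => by
        have := hclose h hh0 (hlt.trans_le (min_le_right _ _)) z hz
        calc ‖F (stepIdx h z.1) z.2 - f z‖
            = ‖(g (stepIdx h z.1 * h, z.2) - g z) + (g z - f z)‖ := by rw [hF]; congr 1; ring
          _ ≤ _ := (norm_add_le _ _).trans (by gcongr)
    have h2 : IntegrableOn (fun z => ‖g z - f z‖) (cylinder Ω T) :=
      (hgi.integrableOn.sub hf).norm
    refine (setIntegral_mono_on (hgn.sub hf).norm ((integrable_const ε).add h2) hmQ h1).trans ?_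
    simp only [Pi.add_apply]
    rw [integral_add (integrable_const ε) h2, integral_const, smul_eq_mul,
      measureReal_restrict_apply_univ, measureReal_def, ← hV, mul_comm]
    linarith
  have hvΩ : IntegrableOn v Ω := hvi.integrableOn
  have hD : (∫ x in (Ω : Set (Space N)), |u 0 x|) +
      ∑ j ∈ Finset.range m, h * ∫ x in (Ω : Set (Space N)), |F j x| ≤
      (∫ x in (Ω : Set (Space N)), ‖θ₀ x‖) + 1 + ((∫ z in cylinder Ω T, ‖f z‖) + 1) := by
    rw [hu0, ← integral_cylinder_step hh0 hmh (w := fun k x => |F k x|)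
      (fun k => (hFm k).norm) fun k => (hFi k).norm]
    have tri : ∀ {α : Type} [MeasurableSpace α] {μ : Measure α} {a b : α → ℝ}, Integrable a μ →
        Integrable b μ → ∫ x, ‖a x - b x‖ ∂μ ≤ δ → ∫ x, |a x| ∂μ ≤ (∫ x, ‖b x‖ ∂μ) + 1 := by
      intro α _ μ a b ha hb hab
      have h1 : ∫ x, |a x| ∂μ ≤ ∫ x, (‖b x‖ + ‖a x - b x‖) ∂μ := by
        refine integral_mono ha.abs (hb.norm.add (ha.sub hb).norm) fun x => ?_
        have := norm_add_le (b x) (a x - b x)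
        rwa [add_sub_cancel] at this
      rw [integral_add (f := fun x => ‖b x‖) (g := fun x => ‖a x - b x‖) hb.norm
        (ha.sub hb).norm] at h1
      linarith
    exact add_le_add (tri hvΩ hθ₀ hv') (tri hgn hf hgn')
  refine ⟨fun z => u (stepIdx h z.1 + 1) z.2, fun z => G (stepIdx h z.1 + 1) z.2,
    stronglyMeasurable_step (fun k => hR.stronglyMeasurable_fun (k + 1)) h,
    stronglyMeasurable_step (fun k => hR.stronglyMeasurable_grad (k + 1)) h, ?_,
    fun t => hR.hasStrongGradient (stepIdx h t), h, fun z => F (stepIdx h z.1) z.2, v, hh0,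
    (hlt.trans_le (min_le_left _ _)).le, hgn, hvΩ, hgn', hv', fun ψ hψ hψT => ?_⟩
  · rw [lintegral_cylinder_step hh0 hmh (w := fun k x => ‖u (k + 1) x‖ₑ ^ q + ‖G (k + 1) x‖ₑ ^ q)
      fun k => ((hR.stronglyMeasurable_fun _).enorm.pow_const q).add
        ((hR.stronglyMeasurable_grad _).enorm.pow_const q)]
    exact H h m F u G hh0 hmh hR hD
  · rw [← hu0]
    exact hR.discrete_weak_form hbd hh0 hmh hFm hψ hψT

/-! ### Passage to the limit -/

theorem integrable_rpow_norm_of_lintegral_le {X E : Type*} [MeasurableSpace X] {μ : Measure X}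
    [NormedAddCommGroup E] {w : X → E} (hw : StronglyMeasurable w) {q : ℝ} (hq : 0 ≤ q) {K : ℝ≥0∞}
    (hK : K ≠ ⊤) (h : ∫⁻ x, ‖w x‖ₑ ^ q ∂μ ≤ K) :
    Integrable (fun x => ‖w x‖ ^ q) μ ∧ ∫ x, ‖w x‖ ^ q ∂μ ≤ K.toReal := by
  have h0 : ∀ x, 0 ≤ ‖w x‖ ^ q := fun x => by positivity
  have h1 : ∀ x, ENNReal.ofReal (‖w x‖ ^ q) = ‖w x‖ₑ ^ q := fun x => by
    rw [← ENNReal.ofReal_rpow_of_nonneg (norm_nonneg _) hq, ofReal_norm]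
  have hm : AEStronglyMeasurable (fun x => ‖w x‖ ^ q) μ :=
    (hw.norm.measurable.pow_const q).aestronglyMeasurable
  refine ⟨⟨hm, ?_⟩, ?_⟩
  · rw [hasFiniteIntegral_iff_ofReal (Eventually.of_forall h0)]
    simp only [h1]
    exact h.trans_lt hK.lt_top
  · rw [integral_eq_lintegral_of_nonneg_ae (Eventually.of_forall h0) hm]
    simp only [h1]
    exact ENNReal.toReal_mono hK h

theorem integrable_and_integral_norm_le {X E : Type*} [MeasurableSpace X] {μ : Measure X}
    [IsFiniteMeasure μ] [NormedAddCommGroup E] {w : X → E} (hw : AEStronglyMeasurable w μ) {q : ℝ}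
    (hq : 1 ≤ q) {C : ℝ} (hi : Integrable (fun x => ‖w x‖ ^ q) μ) (hC : ∫ x, ‖w x‖ ^ q ∂μ ≤ C) :
    Integrable w μ ∧ ∫ x, ‖w x‖ ∂μ ≤ μ.real univ + C := by
  have hle : ∀ x, ‖w x‖ ≤ 1 + ‖w x‖ ^ q := fun x => by
    rcases le_total ‖w x‖ 1 with h | h
    · have : 0 ≤ ‖w x‖ ^ q := by positivity
      linarith
    · have : ‖w x‖ ^ (1 : ℝ) ≤ ‖w x‖ ^ q := Real.rpow_le_rpow_of_exponent_le h hq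
      rw [Real.rpow_one] at this
      linarith
  have hi' := (integrable_const (1 : ℝ)).add hi
  have hwi : Integrable w μ := hi'.mono' hw (Eventually.of_forall hle)
  refine ⟨hwi, (integral_mono hwi.norm hi' hle).trans ?_⟩
  simp only [Pi.add_apply]
  rw [integral_add (integrable_const _) hi, integral_const, smul_eq_mul, mul_one]
  linarith

theorem isFiniteMeasure_cylinder {N : ℕ} {Ω : Opens (Space N)}
    (hbd : Bornology.IsBounded (Ω : Set (Space N))) (T : ℝ) :
    IsFiniteMeasure (volume.restrict (cylinder Ω T)) :=
  ⟨by rw [Measure.restrict_apply_univ]; exact volume_cylinder_lt_top hbd T⟩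

theorem measurable_left_gridPoint {N : ℕ} (h : ℝ) :
    Measurable fun z : ℝ × Space N => (stepIdx h z.1 * h, z.2) :=
  (((measurable_from_nat (f := fun n : ℕ => (n : ℝ))).comp
    ((measurable_stepIdx h).comp measurable_fst)).mul_const h).prodMk measurable_snd

/-- The defect in the weak formulation of an approximate solution tends to zero. -/
theorem tendsto_defect {N : ℕ} {Ω : Opens (Space N)}
    (hbd : Bornology.IsBounded (Ω : Set (Space N))) {T q : ℝ} (hT : 0 ≤ T)
    {f : ℝ × Space N → ℝ} {θ₀ : Space N → ℝ} (hf : IntegrableOn f (cylinder Ω T))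
    (hθ₀ : IntegrableOn θ₀ Ω) {K : ℝ≥0∞} {δ : ℕ → ℝ} (hδ : Tendsto δ atTop (𝓝 0))
    {θ : ℕ → ℝ × Space N → ℝ} {G : ℕ → ℝ × Space N → Space N}
    (H : ∀ n, IsApproximateSolution Ω T q f θ₀ K (δ n) (θ n) (G n)) {M : ℝ}
    (hG : ∀ n, IntegrableOn (G n) (cylinder Ω T))
    (hM : ∀ n, ∫ z in cylinder Ω T, ‖G n z‖ ≤ M)
    {ψ : ℝ × Space N → ℝ} (hψ : ContDiff ℝ ∞ ψ) (hψT : ∀ x ∈ Ω, ψ (T, x) = 0) :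
    Tendsto (fun n => -(∫ z in cylinder Ω T, θ n z * deriv (fun τ => ψ (τ, z.2)) z.1)
      + ∫ z in cylinder Ω T, inner ℝ (G n z) (gradient (fun y => ψ (z.1, y)) z.2)) atTop
      (𝓝 ((∫ z in cylinder Ω T, f z * ψ z) + ∫ x in (Ω : Set (Space N)), θ₀ x * ψ (0, x))) := by
  have hfin := isFiniteMeasure_cylinder hbd T
  have hmQ := measurableSet_cylinder Ω T
  have hM0 : 0 ≤ M := (integral_nonneg fun _ => norm_nonneg _).trans (hM 0)
  obtain ⟨B, hB0, hB⟩ := exists_bound_cylinder hbd T hψ.continuous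
  obtain ⟨B', -, hB'⟩ := exists_bound_cylinder hbd T (continuous_gradient_slice hψ)
  set A : ℝ := ∫ z in cylinder Ω T, ‖f z‖ with hA
  have hA0 : 0 ≤ A := integral_nonneg fun _ => norm_nonneg _
  rw [Metric.tendsto_atTop]
  intro ε hε
  set ε' : ℝ := ε / (2 * (M + A + 1)) with hε'
  have hε0 : 0 < ε' := by positivity
  have hεb : ε' * (M + A) < ε / 2 := by
    rw [hε', div_mul_eq_mul_div, div_lt_div_iff₀ (by positivity) (by norm_num)]
    nlinarith
  obtain ⟨η₁, hη₁, hc₁⟩ := exists_step_close hbd T hψ.continuous hε0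
  obtain ⟨η₂, hη₂, hc₂⟩ := exists_step_close hbd T (continuous_gradient_slice hψ) hε0
  have hlim : Tendsto (fun n => δ n * (2 * B)) atTop (𝓝 0) := by
    simpa using hδ.mul_const (2 * B)
  obtain ⟨n₀, hn₀⟩ := eventually_atTop.1 ((hδ.eventually (gt_mem_nhds (lt_min hη₁ hη₂))).and
    (hlim.eventually (gt_mem_nhds (half_pos hε))))
  refine ⟨n₀, fun n hn => ?_⟩
  obtain ⟨hn1, hn2⟩ := hn₀ n hn
  obtain ⟨h, g, v, hh, hhδ, hg, hv, hgf, hvθ, hweak⟩ := (H n).weak_form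
  have hψ1 := hc₁ h hh (hhδ.trans_lt (hn1.trans_le (min_le_left _ _)))
  have hψ2 := hc₂ h hh (hhδ.trans_lt (hn1.trans_le (min_le_right _ _)))
  have hgrid : ∀ z ∈ cylinder Ω T, stepIdx h z.1 * h ∈ Icc 0 T := fun z hz =>
    have := (abs_stepIdx_mul_sub_le hh hz.1.1).2
    ⟨this.1, this.2.trans hz.1.2.le⟩
  have hm1 : AEStronglyMeasurable (fun z : ℝ × Space N => ψ (stepIdx h z.1 * h, z.2))
      (volume.restrict (cylinder Ω T)) :=
    (hψ.continuous.measurable.comp (measurable_left_gridPoint h)).aestronglyMeasurable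
  have hm2 : AEStronglyMeasurable (fun z : ℝ × Space N =>
      gradient (fun y => ψ (stepIdx h z.1 * h, y)) z.2) (volume.restrict (cylinder Ω T)) :=
    ((continuous_gradient_slice hψ).measurable.comp
      (measurable_left_gridPoint h)).aestronglyMeasurable
  have hb1 : ∀ᵐ z ∂(volume.restrict (cylinder Ω T)), ‖ψ (stepIdx h z.1 * h, z.2)‖ ≤ B := by
    filter_upwards [ae_restrict_mem hmQ] with z hz using hB _ (hgrid z hz) _ hz.2
  have hb2 : ∀ᵐ z ∂(volume.restrict (cylinder Ω T)),
      ‖gradient (fun y => ψ (stepIdx h z.1 * h, y)) z.2‖ ≤ B' := by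
    filter_upwards [ae_restrict_mem hmQ] with z hz using hB' _ (hgrid z hz) _ hz.2
  have hb3 : ∀ᵐ z ∂(volume.restrict (cylinder Ω T)), ‖ψ z‖ ≤ B := by
    filter_upwards [ae_restrict_mem hmQ] with z hz using hB _ (Ioo_subset_Icc_self hz.1) _ hz.2
  have hb4 : ∀ᵐ z ∂(volume.restrict (cylinder Ω T)),
      ‖gradient (fun y => ψ (z.1, y)) z.2‖ ≤ B' := by
    filter_upwards [ae_restrict_mem hmQ] with z hz using hB' _ (Ioo_subset_Icc_self hz.1) _ hz.2
  have hb5 : ∀ᵐ x ∂(volume.restrict (Ω : Set (Space N))), ‖ψ (0, x)‖ ≤ B := by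
    filter_upwards [ae_restrict_mem Ω.isOpen.measurableSet] with x hx using
      hB 0 ⟨le_rfl, hT⟩ x hx
  have hm5 : AEStronglyMeasurable (fun x => ψ (0, x)) (volume.restrict (Ω : Set (Space N))) :=
    (contDiff_slice hψ 0).continuous.aestronglyMeasurable
  have hmf : AEStronglyMeasurable ψ (volume.restrict (cylinder Ω T)) :=
    hψ.continuous.aestronglyMeasurable
  have i1 := integrable_inner_of_bounded (hG n) hm2 hb2
  have i2 := integrable_inner_of_bounded (hG n)
    (continuous_gradient_slice hψ).aestronglyMeasurable hb4
  have i3 : IntegrableOn (fun z => g z * ψ (stepIdx h z.1 * h, z.2)) (cylinder Ω T) :=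
    Integrable.mul_bdd hg hm1 hb1
  have i4 : IntegrableOn (fun z => f z * ψ (stepIdx h z.1 * h, z.2)) (cylinder Ω T) :=
    Integrable.mul_bdd hf hm1 hb1
  have i5 : IntegrableOn (fun z => f z * ψ z) (cylinder Ω T) := Integrable.mul_bdd hf hmf hb3
  have i6 : IntegrableOn (fun x => v x * ψ (0, x)) Ω := Integrable.mul_bdd hv hm5 hb5
  have i7 : IntegrableOn (fun x => θ₀ x * ψ (0, x)) Ω := Integrable.mul_bdd hθ₀ hm5 hb5
  have b1 : |(∫ z in cylinder Ω T, inner ℝ (G n z) (gradient (fun y => ψ (z.1, y)) z.2)) -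
      ∫ z in cylinder Ω T, inner ℝ (G n z) (gradient (fun y => ψ (stepIdx h z.1 * h, y)) z.2)| ≤
      ε' * M := by
    rw [← integral_sub i2 i1]
    simp only [← inner_sub_right]
    refine (abs_integral_inner_le (hG n) (B := ε') ?_).trans
      (mul_le_mul_of_nonneg_left (hM n) hε0.le)
    filter_upwards [ae_restrict_mem hmQ] with z hz
    rw [norm_sub_rev]
    exact hψ2 z hz
  have bd : ∀ {α : Type} [MeasurableSpace α] {μ : Measure α} {a b : α → ℝ} {C : ℝ},
      Integrable a μ → (∀ᵐ x ∂μ, ‖b x‖ ≤ C) → |∫ x, a x * b x ∂μ| ≤ C * ∫ x, ‖a x‖ ∂μ := by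
    intro α _ μ a b C ha hb
    refine le_trans (le_of_eq ?_) (abs_integral_inner_le ha hb)
    congr 1
    exact integral_congr_ae (Eventually.of_forall fun x => mul_comm _ _)
  have b2 : |(∫ z in cylinder Ω T, g z * ψ (stepIdx h z.1 * h, z.2)) -
      ∫ z in cylinder Ω T, f z * ψ (stepIdx h z.1 * h, z.2)| ≤ B * δ n := by
    rw [← integral_sub i3 i4]
    simp only [← sub_mul]
    exact (bd (hg.sub hf) hb1).trans (mul_le_mul_of_nonneg_left hgf hB0)
  have b3 : |(∫ z in cylinder Ω T, f z * ψ (stepIdx h z.1 * h, z.2)) -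
      ∫ z in cylinder Ω T, f z * ψ z| ≤ ε' * A := by
    rw [← integral_sub i4 i5]
    simp only [← mul_sub]
    refine bd hf ?_
    filter_upwards [ae_restrict_mem hmQ] with z hz using hψ1 z hz
  have b4 : |(∫ x in (Ω : Set (Space N)), v x * ψ (0, x)) -
      ∫ x in (Ω : Set (Space N)), θ₀ x * ψ (0, x)| ≤ B * δ n := by
    rw [← integral_sub i6 i7]
    simp only [← sub_mul]
    exact (bd (hv.sub hθ₀) hb5).trans (mul_le_mul_of_nonneg_left hvθ hB0)
  have hw := hweak ψ hψ hψT
  rw [Real.dist_eq, abs_lt]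
  rw [abs_le] at b1 b2 b3 b4
  constructor <;> linarith [b1.1, b1.2, b2.1, b2.2, b3.1, b3.2, b4.1, b4.2]

/-- The weak gradient identity in the direction `e`, weighted by a function of time. -/
theorem integral_cylinder_gradient_pairing {N : ℕ} {Ω : Opens (Space N)} {T : ℝ}
    {u : ℝ × Space N → ℝ} {G : ℝ × Space N → Space N} (hu : IntegrableOn u (cylinder Ω T))
    (hG : IntegrableOn G (cylinder Ω T)) (φ : 𝓓(Ω, ℝ)) (e : Space N) {a : ℝ → ℝ}
    (ha : Measurable a) {B : ℝ} (hB : ∀ t, ‖a t‖ ≤ B) :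
    (∫ z in cylinder Ω T, inner ℝ (u z) (a z.1 * inner ℝ (gradient φ z.2) e)) +
      ∫ z in cylinder Ω T, inner ℝ (G z) (a z.1 • φ z.2 • e) =
    ∫ t in Ioo 0 T, ((∫ x in (Ω : Set (Space N)), u (t, x) * inner ℝ (gradient φ x) e) +
      ∫ x in (Ω : Set (Space N)), inner ℝ (G (t, x)) (φ x • e)) * a t := by
  obtain ⟨C, hC0, hC, hC'⟩ := exists_bound_testFunction φ
  have hc1 : Continuous fun x => inner ℝ (gradient φ x) e :=
    (continuous_gradient_testFunction φ).inner continuous_const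
  have hc2 : Continuous fun x => φ x • e := φ.continuous.smul continuous_const
  have hb1 : ∀ x, ‖inner ℝ (gradient φ x) e‖ ≤ C * ‖e‖ := fun x =>
    (norm_inner_le_norm _ _).trans (mul_le_mul_of_nonneg_right (hC' x) (norm_nonneg _))
  have hb2 : ∀ x, ‖φ x • e‖ ≤ C * ‖e‖ := fun x => by
    rw [norm_smul]; exact mul_le_mul_of_nonneg_right (hC x) (norm_nonneg _)
  have i1 : IntegrableOn (fun z => u z * inner ℝ (gradient φ z.2) e) (cylinder Ω T) :=
    Integrable.mul_bdd hu (hc1.comp continuous_snd).aestronglyMeasurable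
      (Eventually.of_forall fun z => hb1 z.2)
  have i2 : IntegrableOn (fun z => inner ℝ (G z) (φ z.2 • e)) (cylinder Ω T) :=
    integrable_inner_of_bounded hG (hc2.comp continuous_snd).aestronglyMeasurable
      (Eventually.of_forall fun z => hb2 z.2)
  have ham : AEStronglyMeasurable (fun z : ℝ × Space N => a z.1)
      (volume.restrict (cylinder Ω T)) := (ha.comp measurable_fst).aestronglyMeasurable
  have j1 : IntegrableOn (fun z => u z * inner ℝ (gradient φ z.2) e * a z.1) (cylinder Ω T) :=
    Integrable.mul_bdd i1 ham (Eventually.of_forall fun z => hB z.1)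
  have j2 : IntegrableOn (fun z => inner ℝ (G z) (φ z.2 • e) * a z.1) (cylinder Ω T) :=
    Integrable.mul_bdd i2 ham (Eventually.of_forall fun z => hB z.1)
  have e1 : ∀ z : ℝ × Space N, inner ℝ (u z) (a z.1 * inner ℝ (gradient φ z.2) e) =
      u z * inner ℝ (gradient φ z.2) e * a z.1 := fun z => by
    rw [RCLike.inner_apply, conj_trivial]; ring
  have e2 : ∀ z : ℝ × Space N, inner ℝ (G z) (a z.1 • φ z.2 • e) =
      inner ℝ (G z) (φ z.2 • e) * a z.1 := fun z => by
    rw [inner_smul_right, mul_comm]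
  simp only [e1, e2]
  rw [← integral_add j1 j2]
  simp only [← add_mul]
  rw [integral_cylinder_mul_of_bounded (w := fun z => u z * inner ℝ (gradient φ z.2) e +
    inner ℝ (G z) (φ z.2 • e)) (i1.add i2) ha fun t _ => hB t]
  refine integral_congr_ae ?_
  filter_upwards [ae_integrableOn_slice i1, ae_integrableOn_slice i2] with t h1 h2
  rw [integral_add h1 h2]

/-- Weak gradients pass to weak limits: for a fixed test function and a fixed direction the
identity at time `t` is tested against arbitrary sets of times, and the exceptional sets are
combined by separability. -/
theorem ae_hasWeakGradient_of_tendsto {N : ℕ} {Ω : Opens (Space N)}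
    (hbd : Bornology.IsBounded (Ω : Set (Space N))) {T : ℝ} {F : Filter ℕ} [F.NeBot]
    {u : ℕ → ℝ × Space N → ℝ} {G : ℕ → ℝ × Space N → Space N}
    (hu : ∀ n, IntegrableOn (u n) (cylinder Ω T)) (hG : ∀ n, IntegrableOn (G n) (cylinder Ω T))
    (hs : ∀ n t, HasStrongGradient (Ω : Set (Space N)) (fun x => u n (t, x)) fun x => G n (t, x))
    {θ : ℝ × Space N → ℝ} {H : ℝ × Space N → Space N} (hθ : IntegrableOn θ (cylinder Ω T))
    (hH : IntegrableOn H (cylinder Ω T))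
    (hlim : ∀ ψ : ℝ × Space N → ℝ, AEStronglyMeasurable ψ (volume.restrict (cylinder Ω T)) →
      ∀ B : ℝ, (∀ᵐ z ∂(volume.restrict (cylinder Ω T)), ‖ψ z‖ ≤ B) →
      Tendsto (fun n => ∫ z in cylinder Ω T, inner ℝ (u n z) (ψ z)) F
        (𝓝 (∫ z in cylinder Ω T, inner ℝ (θ z) (ψ z))))
    (hlim' : ∀ ψ : ℝ × Space N → Space N, AEStronglyMeasurable ψ (volume.restrict (cylinder Ω T)) →
      ∀ B : ℝ, (∀ᵐ z ∂(volume.restrict (cylinder Ω T)), ‖ψ z‖ ≤ B) →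
      Tendsto (fun n => ∫ z in cylinder Ω T, inner ℝ (G n z) (ψ z)) F
        (𝓝 (∫ z in cylinder Ω T, inner ℝ (H z) (ψ z)))) :
    ∀ᵐ t ∂(volume.restrict (Ioo 0 T)),
      HasWeakGradient Ω (fun x => θ (t, x)) (fun x => H (t, x)) := by
  -- The identity tested in a fixed direction with a fixed test function passes to the limit.
  have dir : ∀ (φ : 𝓓(Ω, ℝ)) (e : Space N), ∀ᵐ t ∂(volume.restrict (Ioo 0 T)),
      (∫ x in (Ω : Set (Space N)), θ (t, x) * inner ℝ (gradient φ x) e) +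
        ∫ x in (Ω : Set (Space N)), inner ℝ (H (t, x)) (φ x • e) = 0 := by
    intro φ e
    obtain ⟨C, hC0, hC, hC'⟩ := exists_bound_testFunction φ
    have hc1 : Continuous fun x => inner ℝ (gradient φ x) e :=
      (continuous_gradient_testFunction φ).inner continuous_const
    have hc2 : Continuous fun x => φ x • e := φ.continuous.smul continuous_const
    have hb1 : ∀ x, ‖inner ℝ (gradient φ x) e‖ ≤ C * ‖e‖ := fun x =>
      (norm_inner_le_norm _ _).trans (mul_le_mul_of_nonneg_right (hC' x) (norm_nonneg _))
    have hb2 : ∀ x, ‖φ x • e‖ ≤ C * ‖e‖ := fun x => by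
      rw [norm_smul]; exact mul_le_mul_of_nonneg_right (hC x) (norm_nonneg _)
    have i1 : IntegrableOn (fun z => θ z * inner ℝ (gradient φ z.2) e) (cylinder Ω T) :=
      Integrable.mul_bdd hθ (hc1.comp continuous_snd).aestronglyMeasurable
        (Eventually.of_forall fun z => hb1 z.2)
    have i2 : IntegrableOn (fun z => inner ℝ (H z) (φ z.2 • e)) (cylinder Ω T) :=
      integrable_inner_of_bounded hH (hc2.comp continuous_snd).aestronglyMeasurable
        (Eventually.of_forall fun z => hb2 z.2)
    rw [IntegrableOn, volume_restrict_cylinder] at i1 i2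
    refine Integrable.ae_eq_zero_of_forall_setIntegral_eq_zero
      (i1.integral_prod_left.add i2.integral_prod_left) fun S hS _ => ?_
    set a : ℝ → ℝ := S.indicator fun _ => 1 with ha
    have ham : Measurable a := measurable_const.indicator hS
    have haB : ∀ t, ‖a t‖ ≤ 1 := fun t => by
      by_cases ht : t ∈ S <;> simp [ha, ht]
    have ham' : AEStronglyMeasurable (fun z : ℝ × Space N => a z.1)
        (volume.restrict (cylinder Ω T)) := (ham.comp measurable_fst).aestronglyMeasurable
    have l1 := hlim (fun z => a z.1 * inner ℝ (gradient φ z.2) e)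
      (ham'.mul (hc1.comp continuous_snd).aestronglyMeasurable) (1 * (C * ‖e‖))
      (Eventually.of_forall fun z => by
        rw [norm_mul]
        exact mul_le_mul (haB _) (hb1 _) (norm_nonneg _) zero_le_one)
    have l2 := hlim' (fun z => a z.1 • φ z.2 • e)
      (ham'.smul (hc2.comp continuous_snd).aestronglyMeasurable) (1 * (C * ‖e‖))
      (Eventually.of_forall fun z => by
        rw [norm_smul]
        exact mul_le_mul (haB _) (hb2 _) (norm_nonneg _) zero_le_one)
    have l3 := l1.add l2
    rw [integral_cylinder_gradient_pairing hθ hH φ e ham haB] at l3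
    have z : ∀ n, (∫ z in cylinder Ω T, inner ℝ (u n z) (a z.1 * inner ℝ (gradient φ z.2) e)) +
        ∫ z in cylinder Ω T, inner ℝ (G n z) (a z.1 • φ z.2 • e) = 0 := fun n => by
      rw [integral_cylinder_gradient_pairing (hu n) (hG n) φ e ham haB]
      refine integral_eq_zero_of_ae (Eventually.of_forall fun t => ?_)
      simp only [(hs n t).integral_mul_inner_gradient hbd φ e, neg_add_cancel, zero_mul,
        Pi.zero_apply]
    simp only [z] at l3
    rw [← integral_indicator hS]
    refine Eq.trans ?_ (tendsto_nhds_unique l3 tendsto_const_nhds)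
    refine integral_congr_ae (Eventually.of_forall fun t => ?_)
    by_cases ht : t ∈ S <;> simp [ha, ht]
  have sm1 : ∀ {w : Space N → ℝ}, IntegrableOn w Ω → ∀ φ : 𝓓(Ω, ℝ),
      IntegrableOn (fun x => w x • gradient φ x) Ω := fun hw φ => by
    obtain ⟨B, -, -, hB⟩ := exists_bound_testFunction φ
    exact Integrable.smul_bdd hw B (continuous_gradient_testFunction φ).aestronglyMeasurable
      (Eventually.of_forall hB)
  have sm2 : ∀ {w : Space N → Space N}, IntegrableOn w Ω → ∀ φ : 𝓓(Ω, ℝ),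
      IntegrableOn (fun x => φ x • w x) Ω := fun hw φ => by
    obtain ⟨B, -, hB, -⟩ := exists_bound_testFunction φ
    exact Integrable.bdd_smul hw B φ.continuous.aestronglyMeasurable
      (Eventually.of_forall hB)
  have key := ae_forall_testFunction hbd (μ := volume.restrict (Ioo 0 T))
    (L := fun t φ => (∫ x in (Ω : Set (Space N)), θ (t, x) • gradient φ x) +
      ∫ x in (Ω : Set (Space N)), φ x • H (t, x)) ?_ fun φ => ?_
  · filter_upwards [key, ae_integrableOn_slice hθ, ae_integrableOn_slice hH] with t ht h1 h2
    exact ⟨h1.locallyIntegrableOn, h2.locallyIntegrableOn, fun φ =>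
      eq_neg_of_add_eq_zero_left (ht φ)⟩
  · filter_upwards [ae_integrableOn_slice hθ, ae_integrableOn_slice hH] with t h1 h2
    refine ⟨(∫ x in (Ω : Set (Space N)), ‖θ (t, x)‖) + ∫ x in (Ω : Set (Space N)), ‖H (t, x)‖,
      fun φ ψ B hB hB' => ?_⟩
    rw [add_sub_add_comm, ← integral_sub (sm1 h1 φ) (sm1 h1 ψ),
      ← integral_sub (sm2 h2 φ) (sm2 h2 ψ), add_mul, ← integral_mul_const, ← integral_mul_const]
    refine (norm_add_le _ _).trans (add_le_add ?_ ?_)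
    · refine norm_integral_le_of_norm_le (h1.norm.mul_const B) (Eventually.of_forall fun x => ?_)
      rw [← smul_sub, norm_smul]
      exact mul_le_mul_of_nonneg_left (hB' x) (norm_nonneg _)
    · refine norm_integral_le_of_norm_le (h2.norm.mul_const B) (Eventually.of_forall fun x => ?_)
      rw [← sub_smul, norm_smul, mul_comm]
      exact mul_le_mul_of_nonneg_left (hB x) (norm_nonneg _)
  · have hb := ae_all_iff.2 fun i => dir φ (EuclideanSpace.basisFun (Fin N) ℝ i)
    filter_upwards [hb, ae_integrableOn_slice hθ, ae_integrableOn_slice hH] with t ht h1 h2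
    refine InnerProductSpace.ext_inner_left_basis (𝕜 := ℝ)
      (EuclideanSpace.basisFun (Fin N) ℝ).toBasis fun i => ?_
    rw [OrthonormalBasis.coe_toBasis, inner_zero_right, inner_add_right,
      ← integral_inner (sm1 h1 φ), ← integral_inner (sm2 h2 φ), ← ht i]
    congr 1
    · refine integral_congr_ae (Eventually.of_forall fun x => ?_)
      dsimp only
      rw [inner_smul_right, real_inner_comm]
    · refine integral_congr_ae (Eventually.of_forall fun x => ?_)
      dsimp only
      rw [inner_smul_right, inner_smul_right, real_inner_comm]

/-- Approximate solutions which are bounded in `L^q`, `q > 1`, converge weakly, along an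
ultrafilter, to a weak solution. -/
theorem exists_solution_of_isApproximateSolution {N : ℕ} {Ω : Opens (Space N)}
    (hbd : Bornology.IsBounded (Ω : Set (Space N))) {T q : ℝ} (hT : 0 ≤ T) (hq : 1 < q)
    {f : ℝ × Space N → ℝ} {θ₀ : Space N → ℝ} (hf : IntegrableOn f (cylinder Ω T))
    (hθ₀ : IntegrableOn θ₀ Ω) {K : ℝ≥0∞} (hK : K ≠ ⊤) {δ : ℕ → ℝ} (hδ : Tendsto δ atTop (𝓝 0))
    {u : ℕ → ℝ × Space N → ℝ} {G : ℕ → ℝ × Space N → Space N}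
    (H : ∀ n, IsApproximateSolution Ω T q f θ₀ K (δ n) (u n) (G n)) :
    ∃ θ Γ, MemLqW1q Ω T q θ Γ ∧ IsWeakNeumannHeatSolution Ω T f θ₀ θ Γ := by
  have hfin := isFiniteMeasure_cylinder hbd T
  have hmQ := measurableSet_cylinder Ω T
  have b1 := fun n => integrable_rpow_norm_of_lintegral_le (μ := volume.restrict (cylinder Ω T))
    (H n).stronglyMeasurable_fun (zero_le_one.trans hq.le) hK
    ((lintegral_mono fun z => le_self_add).trans (H n).lintegral_le)
  have b2 := fun n => integrable_rpow_norm_of_lintegral_le (μ := volume.restrict (cylinder Ω T))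
    (H n).stronglyMeasurable_grad (zero_le_one.trans hq.le) hK
    ((lintegral_mono fun z => le_add_self).trans (H n).lintegral_le)
  have c1 := fun n => integrable_and_integral_norm_le
    (H n).stronglyMeasurable_fun.aestronglyMeasurable hq.le (b1 n).1 (b1 n).2
  have c2 := fun n => integrable_and_integral_norm_le
    (H n).stronglyMeasurable_grad.aestronglyMeasurable hq.le (b2 n).1 (b2 n).2
  obtain ⟨θ, hθ, hlim⟩ := exists_weak_limit (hyperfilter ℕ)
    (fun n => (H n).stronglyMeasurable_fun) hq (fun n => (b1 n).1) fun n => (b1 n).2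
  obtain ⟨Γ, hΓ, hlim'⟩ := exists_weak_limit (hyperfilter ℕ)
    (fun n => (H n).stronglyMeasurable_grad) hq (fun n => (b2 n).1) fun n => (b2 n).2
  have hq1 : (1 : ℝ≥0∞) ≤ ENNReal.ofReal q := by
    rw [← ENNReal.ofReal_one]; exact ENNReal.ofReal_le_ofReal hq.le
  have hθi : IntegrableOn θ (cylinder Ω T) := hθ.integrable hq1
  have hΓi : IntegrableOn Γ (cylinder Ω T) := hΓ.integrable hq1
  refine ⟨θ, Γ, ⟨hθ, hΓ, ae_hasWeakGradient_of_tendsto hbd (F := (hyperfilter ℕ : Filter ℕ))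
    (fun n => (c1 n).1) (fun n => (c2 n).1) (fun n => (H n).hasStrongGradient) hθi hΓi hlim hlim'⟩,
    fun ψ hψ hψT => ?_⟩
  obtain ⟨B, -, hB⟩ := exists_bound_cylinder hbd T (continuous_deriv_time hψ)
  obtain ⟨B', -, hB'⟩ := exists_bound_cylinder hbd T (continuous_gradient_slice hψ)
  have l1 := hlim _ (continuous_deriv_time hψ).aestronglyMeasurable B (by
    filter_upwards [ae_restrict_mem hmQ] with z hz using hB _ (Ioo_subset_Icc_self hz.1) _ hz.2)
  have l2 := hlim' _ (continuous_gradient_slice hψ).aestronglyMeasurable B' (by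
    filter_upwards [ae_restrict_mem hmQ] with z hz using hB' _ (Ioo_subset_Icc_self hz.1) _ hz.2)
  have e1 : ∀ a b : ℝ, inner ℝ a b = a * b := fun a b => by
    rw [RCLike.inner_apply, conj_trivial, mul_comm]
  simp only [e1] at l1
  have l3 := (tendsto_defect hbd hT hf hθ₀ hδ H (fun n => (c2 n).1) (fun n => (c2 n).2)
    hψ hψT).mono_left Nat.hyperfilter_le_atTop
  exact tendsto_nhds_unique (l1.neg.add l2) l3

end HeatL1

theorem mainTheorem2 (N : ℕ) (hN : 1 ≤ N) :
    ∃ s₀ : ℝ, ∀ s : ℝ, s₀ ≤ s →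
      ∀ (Ω : TopologicalSpace.Opens (HeatL1.Space N)),
        Bornology.IsBounded (Ω : Set (HeatL1.Space N)) →
        HeatL1.HasC1Boundary (Ω : Set (HeatL1.Space N)) →
      ∀ T : ℝ, 0 < T →
      ∀ q : ℝ, 1 ≤ q → q < (2 * ((N : ℝ) + 1) - (N : ℝ)) / ((N : ℝ) + 1) →
      ∀ (f : ℝ × HeatL1.Space N → ℝ) (θ₀ : HeatL1.Space N → ℝ),
        MeasureTheory.IntegrableOn f (HeatL1.cylinder Ω T) →
        MeasureTheory.IntegrableOn θ₀ (Ω : Set (HeatL1.Space N)) →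
      ∃ (θ : ℝ × HeatL1.Space N → ℝ) (G : ℝ × HeatL1.Space N → HeatL1.Space N),
        HeatL1.MemLqW1q Ω T q θ G ∧
        (∃ Θ : ℝ → (𝓓(Ω, ℝ) →ₗ[ℝ] ℝ),
          HeatL1.MemContNegSobolev Ω T s Θ ∧
          (∀ᵐ t ∂(MeasureTheory.volume.restrict (Set.Ioo 0 T)),
            HeatL1.Represents Ω (fun x => θ (t, x)) (Θ t)) ∧
          HeatL1.Represents Ω θ₀ (Θ 0)) ∧
        HeatL1.IsWeakNeumannHeatSolution Ω T f θ₀ θ G := by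
  refine ⟨(N : ℝ) + 1, fun s hs Ω hbd hC T hT q hq1 hq f θ₀ hf hθ₀ => ?_⟩
  -- Weak compactness needs an exponent larger than `1`, so a larger admissible exponent is used.
  obtain ⟨p, hqp, hp⟩ := exists_between hq
  have hp1 : 1 < p := hq1.trans_lt hqp
  obtain ⟨K, hK, H⟩ := HeatL1.exists_isApproximateSolution hN hbd hC hT hp1.le hp hf hθ₀
  choose u G hu using fun n : ℕ => H (1 / ((n : ℝ) + 1)) (by positivity) (by
    rw [div_le_one (by positivity)]; linarith [n.cast_nonneg (α := ℝ)])
  obtain ⟨θ, Γ, hθ, hsol⟩ := HeatL1.exists_solution_of_isApproximateSolution hbd hT.le hp1 hf hθ₀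
    hK tendsto_one_div_add_atTop_nhds_zero_nat hu
  have hfin := HeatL1.isFiniteMeasure_cylinder hbd T
  have hp' : (1 : ℝ≥0∞) ≤ ENNReal.ofReal p := by
    rw [← ENNReal.ofReal_one]; exact ENNReal.ofReal_le_ofReal hp1.le
  have hqp' : ENNReal.ofReal q ≤ ENNReal.ofReal p := ENNReal.ofReal_le_ofReal hqp.le
  exact ⟨θ, Γ, ⟨hθ.memLp_fun.mono_exponent hqp', hθ.memLp_grad.mono_exponent hqp',
    hθ.hasWeakGradient⟩, hsol.exists_timeRepresentative hbd hT hs hf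
      (hθ.memLp_grad.integrable hp') (hθ.memLp_fun.integrable hp') hθ₀, hsol⟩
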